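/- **Part A (coupled bialgebras).** Let $R$ be a commutative ring. A *coupled tensor product* of $R$-modules $M,N$ is an $R$-module $M\tilde\otimes N$ with a bilinear map $\zeta:M\times N\to M\tilde\otimes N$ whose linear factor $M\otimes N\to M\tilde\otimes N$ is injective, such that the *couplings*, i.e. the linear maps $P:M\tilde\otimes N\to M\otimes N$ with $P(\zeta(a,b))=a\otimes b$, separate the points of $M\tilde\otimes N$. A *coupled bialgebra* $(H,\circledast,\mathbf 1,\Delta,\epsilon)$ is an associative unital $R$-algebra $H$ with coupled tensor products $H\tilde\otimes H$ and $H\tilde\otimes H\tilde\otimes H$ (the latter a coupled tensor product both of $H$ and $H\tilde\otimes H$ and of $H\tilde\otimes H$ and $H$, with $\zeta(a,\zeta(b,c))=\zeta(\zeta(a,b),c)$), an algebra structure $\circledast^{(2)}$ on $H\tilde\otimes H$ with unit $\zeta(\mathbf 1,\mathbf 1)$, algebra homomorphisms $\Delta:H\to H\tilde\otimes H$ and $\epsilon:H\to R$, and linear maps $$I\tilde\otimes\Delta,\ \Delta\tilde\otimes I:\ H\tilde\otimes H\to H\tilde\otimes H\tilde\otimes H,\qquad I\tilde\otimes\epsilon,\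 \epsilon\tilde\otimes I:\ H\tilde\otimes H\to H$$ that take $\zeta(a,b)$ to $\zeta(a,\Delta b)$, $\zeta(\Delta a,b)$, $\epsilon(b)a$, $\epsilon(a)b$ respectively, with $(I\tilde\otimes\Delta)\Delta=(\Delta\tilde\otimes I)\Delta$ and $(I\tilde\otimes\epsilon)\Delta=I=(\epsilon\tilde\otimes I)\Delta$. Fix couplings $P:H\tilde\otimes H\to H\otimes H$, which is an algebra homomorphism, and $P_{12}:H\tilde\otimes H\tilde\otimes H\to H\otimes(H\tilde\otimes H)$, $P_{21}:H\tilde\otimes H\tilde\otimes H\to(H\tilde\otimes H)\otimes H$ with $$(I\otimes P)P_{12}=(P\otimes I)P_{21},\quad P_{12}(I\tilde\otimes\Delta)=(I\otimes\Delta)P,\quad P_{21}(\Delta\tilde\otimes I)=(\Delta\otimes I)P,\quad I\tilde\otimes\epsilon=(I\otimes\epsilon)P,\quad \epsilon\tilde\otimes I=(\epsilon\otimes I)P .$$ Assume that $H=\bigoplus_{i\in I}H_i$ is an algebra graded by a monoid $I$ that has an additive map $|\cdot|:I\to\mathbb N_0$ with $|i|=0$ only for $i=0$, that $H_0=R\mathbf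 1$, and that there are submodules $V_{jk}\subseteq H\tilde\otimes H$ with $\zeta(H_j,H_k)\subseteq V_{jk}$, with $P(V_{jk})$ in the image of $H_j\otimes H_k$, and with $\Delta(H_i)\subseteq\sum_{j+k=i}V_{jk}$. Let $\mathcal A$ be a commutative $R$-algebra with multiplication $m_{\mathcal A}$. For $f,g\in\mathrm{Lin}_R(H,\mathcal A)$ let $f\tilde\otimes g:=(f\otimes g)\circ P$ and $f*g:=m_{\mathcal A}\circ(f\tilde\otimes g)\circ\Delta$, with powers $f^{*0}=1_{\mathcal A}\epsilon$, $f^{*(n+1)}=f*f^{*n}$. Let $\mathcal G(H,\mathcal A)$ be the set of characters (linear $f$ with $f(\mathbf 1)=1$ and $f(x\circledast y)=f(x)f(y)$), and let $\mathfrak g(H,\mathcal A)$ be the module of derivations (linear $f$ with $f(x\circledast y)=f(x)\epsilon(y)+\epsilon(x)f(y)$). Then: 1. For $f\in\mathcal G(H,\mathcal A)$ the series $\mathscr S[f]:=\sum_{n\ge0}(1_{\mathcal A}\epsilon-f)^{*n}$ has only finitely many non-zero terms at each $x\in H$, and $\mathcal G(H,\mathcal A)$ is a group under $*$ with unit $1_{\mathcal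 A}\epsilon$ and inverse $f^{-1}=\mathscr S[f]$. 2. For $f\in\mathcal G(H,\mathcal A)$, $s=\mathscr S[f]$ is the only linear map $H\to\mathcal A$ that satisfies $s(\mathbf 1)=1$ and the left Bogoliubov recursion $s(x)=-f(x)-m_{\mathcal A}(s\tilde\otimes f)(\Delta' x)$ for all $x\in\ker\epsilon$, where $\Delta'x=\Delta x-\zeta(\mathbf 1,x)-\zeta(x,\mathbf 1)$; it is likewise the only one that satisfies $s(\mathbf 1)=1$ and the right recursion, with $f\tilde\otimes s$ in place of $s\tilde\otimes f$. 3. $\mathfrak g(H,\mathcal A)$ is a Lie algebra over $R$ with the bracket $[f,g]_*=f*g-g*f$. 4. If $\mathcal A$ is a $\mathbb Q$-algebra, then $$\exp_*(f)=\sum_{n\ge0}\frac{f^{*n}}{n!},\qquad \log_*(F)=\sum_{n\ge1}(-1)^{n+1}\frac{(F-1_{\mathcal A}\epsilon)^{*n}}{n},$$ are, at every $x\in H$, sums with finitely many non-zero terms for $f\in\mathfrak g(H,\mathcal A)$, $F\in\mathcal G(H,\mathcal A)$, and they are mutually inverse bijections $\mathfrak g(H,\mathcal A)\leftrightarrow\mathcal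 G(H,\mathcal A)$. **Part B (Lions forests, dual in the almost sure sense).** A *Lions forest* $T=(N,E,h_0,H,L)$ (possibly empty) is a finite rooted forest with node set $N$, edges $(x,y)\in E$ pointing from a node to its parent, labels $L:N\to\{1,\dots,d\}$, a set $h_0\subseteq N$ and a partition $H$ of $N\setminus h_0$, such that: if $h_0\ne\emptyset$ then it contains a root; if $x,y$ lie in the same block $h$ of $H\cup\{h_0\}$ and $y$ is further from its root than $x$, then the parent of $y$ exists and lies in $h$; if $x_1,y_1$ lie in the same block $h$ at the same distance from their roots and have distinct parents, both parents lie in $h$. The product $T_1\circledast T_2$ is the disjoint union, with the sets $h_0$ of the two forests merged. A set $S$ of nodes is *root-closed* if it contains the parents of its elements; it splits $T$ into the root $T_S^R$ and the prune $T_S^P$, the restrictions of $T$ to $S$ and to $N\setminus S$. Root-closed sets $S\ne\emptyset,N$ are the cuts. Let $(\Omega,\mathbb P)$ be a probability space and let $A$ be a commutative topological ring. A *functional* $f$ assigns to each Lions forest $T$ a class $\langle f,T\rangle$ of random variables on $(\Omega\times\Omega^{H},\mathbb P\times\mathbb P^{H})$ with values in $A^{\{1,\dots,d\}^{N}}$ (that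 is, in $A\otimes(\mathbb R^d)^{\otimes N}$ when $A$ is a real algebra). It is *natural* if it is compatible with isomorphisms of Lions forests. For forests $T',T''$ that are restrictions of $T$ to complementary sets of nodes let $\langle f,T'\rangle\otimes^{H}\langle g,T''\rangle$ be the tensor product of both random variables, evaluated at $(\omega_0,\omega_H)$, where each block of $T'$ or $T''$ not contained in $h_0$ is given the coordinate of the block of $H$ that contains it. Put $$\langle f*g,T\rangle=\sum_{S\ \text{root-closed}}\langle f,T_S^P\rangle\otimes^{H}\langle g,T_S^R\rangle ,$$ and let $\epsilon$ be the functional equal to $1$ on the empty forest and to $0$ on all others. *Characters* are the natural functionals with $\langle f,\mathbf 1\rangle=1$ and $\langle f,T_1\circledast T_2\rangle=\langle f,T_1\rangle\otimes\langle f,T_2\rangle$; *derivations* are the natural functionals with $\langle f,T_1\circledast T_2\rangle=\langle f,T_1\rangle\otimes\langle \epsilon,T_2\rangle+\langle \epsilon,T_1\rangle\otimes\langle f,T_2\rangle$. Then: 1. For each character $f$ the series $\mathscr S[f]=\sum_{n\ge0}(\epsilon-f)^{*n}$ has finitely many non-zero terms on each forest, and the characters form a group under $*$ with unit $\epsilon$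 and inverse $f^{-1}=\mathscr S[f]$. 2. For each character $f$, $s=\mathscr S[f]$ is the only functional with $\langle s,\mathbf 1\rangle=1$ and $$\langle s,T\rangle=-\langle f,T\rangle-\sum_{S\text{ cut}}\langle s,T_S^P\rangle\otimes^H\langle f,T_S^R\rangle\quad\text{for all non-empty }T,$$ and also the only one with $\langle s,\mathbf 1\rangle=1$ and the same recursion with summands $\langle f,T_S^P\rangle\otimes^H\langle s,T_S^R\rangle$. 3. The derivations form a Lie algebra over $L^0(\Omega,\mathbb P;A)$, which acts through the coordinate $\omega_0$, with the bracket $f*g-g*f$. 4. If $A$ is a real algebra with continuous multiplication by each real scalar, then $\exp_*(f)=\sum_{n\ge0}f^{*n}/n!$ and $\log_*(F)=\sum_{n\ge1}(-1)^{n+1}(F-\epsilon)^{*n}/n$ have finitely many non-zero terms on each forest and are mutually inverse bijections between the derivations and the characters. -/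

import Mathlib

namespace CoupledHopf

open scoped TensorProduct

/-- A coupled tensor product `C` of `A` and `B`: a bilinear map `ζ` whose linear factor
`A ⊗ B → C` is injective, such that the couplings `P : C → A ⊗ B` separate the points of `C`. -/
structure CoupledTensor (R A B C : Type*) [CommRing R] [AddCommGroup A] [Module R A]
    [AddCommGroup B] [Module R B] [AddCommGroup C] [Module R C] where
  ζ : A →ₗ[R] B →ₗ[R] C
  lift_injective : Function.Injective (TensorProduct.lift ζ)
  couplings_separate : ∀ c : C,
    (∀ P : C →ₗ[R] A ⊗[R] B, (∀ a b, P (ζ a b) = a ⊗ₜ b) → P c = 0) → c = 0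

/-- The couplings of a coupled tensor product. -/
def CoupledTensor.couplings {R A B C : Type*} [CommRing R] [AddCommGroup A] [Module R A]
    [AddCommGroup B] [Module R B] [AddCommGroup C] [Module R C] (t : CoupledTensor R A B C) :
    Set (C →ₗ[R] A ⊗[R] B) :=
  {P | ∀ a b, P (t.ζ a b) = a ⊗ₜ b}

/-- A coupled bialgebra. The modules `V₂` and `V₃` are the coupled tensor products `H ⊗̃ H` and
`H ⊗̃ H ⊗̃ H`; the multiplication of `V₂` is the product `⊛⁽²⁾`, for which the coproduct is
multiplicative. -/
structure CoupledBialgebra (R H V₂ V₃ : Type*) [CommRing R] [Ring H] [Algebra R H]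
    [Ring V₂] [Algebra R V₂] [AddCommGroup V₃] [Module R V₃] where
  t₂ : CoupledTensor R H H V₂
  t₁₂ : CoupledTensor R H V₂ V₃
  t₂₁ : CoupledTensor R V₂ H V₃
  assoc : ∀ a b c, t₁₂.ζ a (t₂.ζ b c) = t₂₁.ζ (t₂.ζ a b) c
  ζ_one : t₂.ζ 1 1 = 1
  comul : H →ₐ[R] V₂
  counit : H →ₐ[R] R
  /-- `I ⊗̃ Δ` -/
  idComul : V₂ →ₗ[R] V₃
  /-- `Δ ⊗̃ I` -/
  comulId : V₂ →ₗ[R] V₃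
  /-- `I ⊗̃ ε` -/
  idCounit : V₂ →ₗ[R] H
  /-- `ε ⊗̃ I` -/
  counitId : V₂ →ₗ[R] H
  idComul_ζ : ∀ a b, idComul (t₂.ζ a b) = t₁₂.ζ a (comul b)
  comulId_ζ : ∀ a b, comulId (t₂.ζ a b) = t₂₁.ζ (comul a) b
  idCounit_ζ : ∀ a b, idCounit (t₂.ζ a b) = counit b • a
  counitId_ζ : ∀ a b, counitId (t₂.ζ a b) = counit a • b
  coassoc : ∀ x, idComul (comul x) = comulId (comul x)
  idCounit_comul : ∀ x, idCounit (comul x) = x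
  counitId_comul : ∀ x, counitId (comul x) = x

section
variable {R H V₂ V₃ : Type*} [CommRing R] [Ring H] [Algebra R H]
    [Ring V₂] [Algebra R V₂] [AddCommGroup V₃] [Module R V₃]

/-- A choice of couplings through which linear maps on `H` are extended to the coupled tensor
products, compatible with the structure maps. -/
structure CouplingSystem (B : CoupledBialgebra R H V₂ V₃) where
  P : V₂ →ₐ[R] H ⊗[R] H
  P₁₂ : V₃ →ₗ[R] H ⊗[R] V₂
  P₂₁ : V₃ →ₗ[R] V₂ ⊗[R] H
  P_coupling : P.toLinearMap ∈ B.t₂.couplings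
  P₁₂_coupling : P₁₂ ∈ B.t₁₂.couplings
  P₂₁_coupling : P₂₁ ∈ B.t₂₁.couplings
  coherence : ∀ v, TensorProduct.map LinearMap.id P.toLinearMap (P₁₂ v) =
    TensorProduct.assoc R H H H (TensorProduct.map P.toLinearMap LinearMap.id (P₂₁ v))
  P₁₂_idComul : ∀ v, P₁₂ (B.idComul v) =
    TensorProduct.map LinearMap.id B.comul.toLinearMap (P v)
  P₂₁_comulId : ∀ v, P₂₁ (B.comulId v) =
    TensorProduct.map B.comul.toLinearMap LinearMap.id (P v)
  idCounit_eq : ∀ v, B.idCounit v =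
    TensorProduct.rid R H (TensorProduct.map LinearMap.id B.counit.toLinearMap (P v))
  counitId_eq : ∀ v, B.counitId v =
    TensorProduct.lid R H (TensorProduct.map B.counit.toLinearMap LinearMap.id (P v))

/-- The gradings `𝓗` of `H` and `𝓥` of `H ⊗̃ H` are compatible with the coupled bialgebra and
the coupling, positive by means of `deg`, and connected. -/
structure IsGradedConnected {B : CoupledBialgebra R H V₂ V₃} (K : CouplingSystem B)
    {ι : Type*} [AddMonoid ι] (deg : ι →+ ℕ) (𝓗 : ι → Submodule R H)
    (𝓥 : ι → ι → Submodule R V₂) : Prop where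
  deg_pos : ∀ i, deg i = 0 → i = 0
  ζ_mem : ∀ i j, ∀ x ∈ 𝓗 i, ∀ y ∈ 𝓗 j, B.t₂.ζ x y ∈ 𝓥 i j
  P_mem : ∀ i j, ∀ v ∈ 𝓥 i j,
    K.P v ∈ LinearMap.range (TensorProduct.map (𝓗 i).subtype (𝓗 j).subtype)
  comul_mem : ∀ i, ∀ x ∈ 𝓗 i,
    B.comul x ∈ ⨆ p : ι × ι, ⨆ _ : p.1 + p.2 = i, 𝓥 p.1 p.2
  connected : 𝓗 0 = 1

variable {B : CoupledBialgebra R H V₂ V₃} {A : Type*} [CommRing A] [Algebra R A]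

/-- The linear map `m_A ∘ (f ⊗̃ g)` on `H ⊗̃ H`. -/
noncomputable def tensorMap (K : CouplingSystem B) (f g : H →ₗ[R] A) : V₂ →ₗ[R] A :=
  LinearMap.mul' R A ∘ₗ TensorProduct.map f g ∘ₗ K.P.toLinearMap

/-- The coupled convolution product. -/
noncomputable def conv (K : CouplingSystem B) (f g : H →ₗ[R] A) : H →ₗ[R] A :=
  tensorMap K f g ∘ₗ B.comul.toLinearMap

variable (B A) in
/-- The map `1_A · ε`. -/
noncomputable def unit : H →ₗ[R] A := Algebra.linearMap R A ∘ₗ B.counit.toLinearMap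

noncomputable def convPow (K : CouplingSystem B) (f : H →ₗ[R] A) : ℕ → (H →ₗ[R] A)
  | 0 => unit B A
  | n + 1 => conv K f (convPow K f n)

structure IsCharacter (f : H →ₗ[R] A) : Prop where
  map_one : f 1 = 1
  map_mul : ∀ x y, f (x * y) = f x * f y

variable (R H A) in
abbrev Characters : Type _ := {f : H →ₗ[R] A // IsCharacter f}

variable (B A) in
/-- The module of derivations. -/
noncomputable def Derivations : Submodule R (H →ₗ[R] A) where
  carrier := {f | ∀ x y, f (x * y) = f x * unit B A y + unit B A x * f y}
  add_mem' := by
    intro f g hf hg x y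
    simp only [LinearMap.add_apply, hf x y, hg x y]
    ring
  zero_mem' := by
    intro x y
    simp
  smul_mem' := by
    intro r f hf x y
    simp only [LinearMap.smul_apply, hf x y, smul_add, smul_mul_assoc, mul_smul_comm]

/-- The geometric series. -/
noncomputable def antipode (K : CouplingSystem B) (f : H →ₗ[R] A) (x : H) : A :=
  ∑ᶠ n : ℕ, convPow K (unit B A - f) n x

variable (B) in
/-- The reduced coproduct. -/
noncomputable def reducedComul (x : H) : V₂ := B.comul x - B.t₂.ζ 1 x - B.t₂.ζ x 1

/-- The left Bogoliubov recursion for `s`. -/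
def BogoliubovLeft (K : CouplingSystem B) (f s : H →ₗ[R] A) : Prop :=
  s 1 = 1 ∧ ∀ x, B.counit x = 0 → s x = - f x - tensorMap K s f (reducedComul B x)

/-- The right Bogoliubov recursion for `s`. -/
def BogoliubovRight (K : CouplingSystem B) (f s : H →ₗ[R] A) : Prop :=
  s 1 = 1 ∧ ∀ x, B.counit x = 0 → s x = - f x - tensorMap K f s (reducedComul B x)

open scoped Nat in
noncomputable def convExp [Algebra ℚ A] (K : CouplingSystem B) (f : H →ₗ[R] A) (x : H) : A :=
  ∑ᶠ n : ℕ, ((n ! : ℚ)⁻¹) • convPow K f n x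

noncomputable def convLog [Algebra ℚ A] (K : CouplingSystem B) (f : H →ₗ[R] A) (x : H) : A :=
  ∑ᶠ n : ℕ, ((-1 : ℚ) ^ ((n + 1) + 1) / ((n + 1 : ℕ) : ℚ)) •
    convPow K (f - unit B A) (n + 1) x

end

end CoupledHopf

namespace LionsHopf

open MeasureTheory Relation

/-- The number of proper ancestors of a node. -/
noncomputable def depth {N : Type} (edge : N → N → Prop) (x : N) : ℕ :=
  Nat.card {z : N // TransGen edge x z}

structure LionsForest (d : ℕ) where
  N : Type
  finite : Finite N
  edge : N → N → Prop
  edge_unique : ∀ x y z, edge x y → edge x z → y = z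
  acyclic : ∀ x, ¬ TransGen edge x x
  h0 : Set N
  hyp : Setoid N
  h0_class : ∀ x ∈ h0, ∀ y, y ∈ h0 ↔ hyp x y
  root_mem : h0.Nonempty → ∃ x ∈ h0, ∀ y, depth edge x ≤ depth edge y
  parent_mem : ∀ x y, hyp x y → depth edge x < depth edge y → ∃ z, hyp y z ∧ edge y z
  parents_mem : ∀ x₁ y₁ x₂ y₂, hyp x₁ y₁ → depth edge x₁ = depth edge y₁ →
    edge x₁ x₂ → edge y₁ y₂ → x₂ ≠ y₂ → hyp x₁ x₂ ∧ hyp y₁ y₂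
  L : N → Fin d

attribute [instance] LionsForest.finite

section depth
variable {N : Type} {edge : N → N → Prop}

theorem depth_of_no_parent {x : N} (h : ∀ y, ¬ edge x y) : depth edge x = 0 := by
  have : IsEmpty {z : N // TransGen edge x z} := ⟨fun ⟨z, hz⟩ => by
    rcases TransGen.head'_iff.1 hz with ⟨y, hy, -⟩
    exact h y hy⟩
  simp [depth]

theorem depth_of_edge [Finite N] (hu : ∀ x y z, edge x y → edge x z → y = z)
    (ha : ∀ x, ¬ TransGen edge x x) {x y : N} (h : edge x y) :
    depth edge x = depth edge y + 1 := by
  have key : {z : N | TransGen edge x z} = insert y {z : N | TransGen edge y z} := by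
    ext z
    simp only [Set.mem_ofPred_eq, Set.mem_insert_iff]
    constructor
    · intro hz
      rcases TransGen.head'_iff.1 hz with ⟨w, hw, hwz⟩
      obtain rfl := hu _ _ _ h hw
      rcases reflTransGen_iff_eq_or_transGen.1 hwz with h1 | h1
      · exact Or.inl h1
      · exact Or.inr h1
    · rintro (rfl | hz)
      · exact TransGen.single h
      · exact TransGen.head h hz
  have h1 : depth edge x = Set.ncard {z : N | TransGen edge x z} := rfl
  have h2 : depth edge y = Set.ncard {z : N | TransGen edge y z} := rfl
  rw [h1, h2, key]
  exact Set.ncard_insert_of_notMem (ha y) (Set.toFinite _)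

theorem exists_edge_of_depth_pos {x : N} (h : 0 < depth edge x) : ∃ y, edge x y := by
  by_contra! h'
  exact h.ne' (depth_of_no_parent h')

theorem exists_depth_zero [Finite N] (hu : ∀ x y z, edge x y → edge x z → y = z)
    (ha : ∀ x, ¬ TransGen edge x x) (x : N) : ∃ y, depth edge y = 0 := by
  induction hn : depth edge x generalizing x with
  | zero => exact ⟨x, hn⟩
  | succ n ih =>
    obtain ⟨y, hy⟩ := exists_edge_of_depth_pos (x := x) (edge := edge) (by omega)
    have := depth_of_edge hu ha hy
    exact ih y (by omega)

/-- An edge-preserving map along which parents lift preserves the depth. -/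
theorem depth_map {M : Type} {edge' : M → M → Prop} [Finite N] [Finite M]
    (hu : ∀ x y z, edge x y → edge x z → y = z) (ha : ∀ x, ¬ TransGen edge x x)
    (hu' : ∀ x y z, edge' x y → edge' x z → y = z) (ha' : ∀ x, ¬ TransGen edge' x x)
    (φ : M → N) (hφ : ∀ x y, edge' x y → edge (φ x) (φ y))
    (hl : ∀ x z, edge (φ x) z → ∃ y, edge' x y) (x : M) :
    depth edge (φ x) = depth edge' x := by
  induction hn : depth edge' x generalizing x with
  | zero =>
    refine depth_of_no_parent fun z hz => ?_
    obtain ⟨y, hy⟩ := hl x z hz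
    have := depth_of_edge hu' ha' hy
    omega
  | succ n ih =>
    obtain ⟨y, hy⟩ := exists_edge_of_depth_pos (x := x) (edge := edge') (by omega)
    have h1 := depth_of_edge hu' ha' hy
    rw [depth_of_edge hu ha (hφ _ _ hy), ih y (by omega)]

end depth

namespace LionsForest
variable {d : ℕ} (T : LionsForest d)

theorem h0_root {r y z : T.N} (hr : ∀ w, depth T.edge r ≤ depth T.edge w) (hr0 : r ∈ T.h0)
    (hy : y ∈ T.h0) (hyz : T.edge y z) : z ∈ T.h0 := by
  have h1 := depth_of_edge T.edge_unique T.acyclic hyz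
  have h2 := hr z
  obtain ⟨w, hw, hw'⟩ := T.parent_mem r y ((T.h0_class r hr0 y).1 hy) (by omega)
  obtain rfl := T.edge_unique _ _ _ hyz hw'
  exact (T.h0_class y hy _).2 hw

/-- A node of `h0` that is not a root has its parent in `h0`. -/
theorem h0_parent {y z : T.N} (hy : y ∈ T.h0) (hyz : T.edge y z) : z ∈ T.h0 := by
  obtain ⟨r, hr0, hr⟩ := T.root_mem ⟨y, hy⟩
  exact T.h0_root hr hr0 hy hyz

/-- The edges between nodes of `S`. -/
def resEdge (S : Set T.N) (a b : S) : Prop := T.edge a b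

theorem resEdge_unique (S : Set T.N) (x y z : S) (h : T.resEdge S x y) (h' : T.resEdge S x z) :
    y = z := Subtype.ext (T.edge_unique _ _ _ h h')

theorem resEdge_acyclic (S : Set T.N) (x : S) : ¬ TransGen (T.resEdge S) x x := fun h =>
  T.acyclic x (TransGen.lift (r := T.resEdge S) (p := T.edge) Subtype.val (fun _ _ h => h) _ _ h)

theorem resEdge_depth (S : Set T.N) (x y : S) (h : T.edge x y) :
    depth (T.resEdge S) x = depth (T.resEdge S) y + 1 :=
  depth_of_edge (edge := T.resEdge S) (T.resEdge_unique S) (T.resEdge_acyclic S) h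

/-- A set of nodes containing the parents of all its elements. -/
def RootClosed (S : Set T.N) : Prop := ∀ x y, T.edge x y → x ∈ S → y ∈ S

theorem depth_root (S : Set T.N) (hS : T.RootClosed S) (x : S) :
    depth T.edge (x : T.N) = depth (T.resEdge S) x :=
  depth_map (edge' := T.resEdge S) T.edge_unique T.acyclic (T.resEdge_unique S)
    (T.resEdge_acyclic S) Subtype.val (fun _ _ h => h) (fun x z h => ⟨⟨z, hS _ _ h x.2⟩, h⟩) x

/-- The root of a cut. -/
def root (S : Set T.N) (hS : T.RootClosed S) : LionsForest d where
  N := S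
  finite := inferInstance
  edge := T.resEdge S
  edge_unique := T.resEdge_unique S
  acyclic := T.resEdge_acyclic S
  h0 := {x | (x : T.N) ∈ T.h0}
  hyp := T.hyp.comap Subtype.val
  h0_class := fun x hx y => T.h0_class x hx y
  root_mem := by
    rintro ⟨x, hx⟩
    have : ∀ n, ∀ y : S, (y : T.N) ∈ T.h0 → depth T.edge (y : T.N) = n →
        ∃ r : S, (r : T.N) ∈ T.h0 ∧ depth T.edge (r : T.N) = 0 := by
      intro n
      induction n with
      | zero => exact fun y hy hn => ⟨y, hy, hn⟩
      | succ n ih =>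
        intro y hy hn
        obtain ⟨z, hz⟩ := exists_edge_of_depth_pos (x := (y : T.N)) (edge := T.edge) (by omega)
        have h1 := depth_of_edge T.edge_unique T.acyclic hz
        exact ih ⟨z, hS _ _ hz y.2⟩ (T.h0_parent hy hz) (by simp only; omega)
    obtain ⟨r, hr, hr0⟩ := this _ x hx rfl
    exact ⟨r, hr, fun y => by rw [← T.depth_root S hS, hr0]; omega⟩
  parent_mem := fun x y hxy hlt => by
    rw [← T.depth_root S hS, ← T.depth_root S hS] at hlt
    obtain ⟨z, hz, hyz⟩ := T.parent_mem x y hxy hlt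
    exact ⟨⟨z, hS _ _ hyz y.2⟩, hz, hyz⟩
  parents_mem := fun x₁ y₁ x₂ y₂ h hdep hx hy hne => by
    rw [← T.depth_root S hS, ← T.depth_root S hS] at hdep
    exact T.parents_mem x₁ y₁ x₂ y₂ h hdep hx hy fun h => hne (Subtype.ext h)
  L := fun x => T.L x

theorem depth_prune (S : Set T.N) (hS : T.RootClosed S) (y z : (Sᶜ : Set T.N)) (hyz : T.edge y z)
    (hne : ¬ T.hyp y z) (n : ℕ) : ∀ w : T.N, T.hyp y w → depth T.edge w = n → ∃ hw : w ∈ Sᶜ,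
        depth (T.resEdge Sᶜ) ⟨w, hw⟩ + depth T.edge (z : T.N) =
          depth T.edge w + depth (T.resEdge Sᶜ) z := by
  have hup : ∀ x y : T.N, T.edge x y → y ∈ Sᶜ → x ∈ Sᶜ := fun x y h hy hx => hy (hS _ _ h hx)
  have hy := depth_of_edge T.edge_unique T.acyclic hyz
  induction n with
  | zero =>
    intro w hw hn
    obtain ⟨z', h1, h2⟩ := T.parent_mem w y (T.hyp.symm hw) (by omega)
    obtain rfl := T.edge_unique _ _ _ hyz h2
    exact absurd h1 hne
  | succ n ih =>
    intro w hw hn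
    rcases lt_trichotomy (depth T.edge w) (depth T.edge (y : T.N)) with hlt | heq | hgt
    · obtain ⟨z', h1, h2⟩ := T.parent_mem w y (T.hyp.symm hw) hlt
      obtain rfl := T.edge_unique _ _ _ hyz h2
      exact absurd h1 hne
    · obtain ⟨w₂, hw₂⟩ := exists_edge_of_depth_pos (x := w) (edge := T.edge) (by omega)
      have hz : (z : T.N) = w₂ := by
        by_contra hz
        exact hne (T.parents_mem y w z w₂ hw heq.symm hyz hw₂ hz).1
      subst hz
      refine ⟨hup _ _ hw₂ z.2, ?_⟩
      have := T.resEdge_depth Sᶜ ⟨w, hup _ _ hw₂ z.2⟩ z hw₂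
      omega
    · obtain ⟨w', h1, h2⟩ := T.parent_mem y w hw hgt
      have h3 := depth_of_edge T.edge_unique T.acyclic h2
      obtain ⟨hw', h4⟩ := ih w' (T.hyp.trans hw h1) (by omega)
      refine ⟨hup _ _ h2 hw', ?_⟩
      have := T.resEdge_depth Sᶜ ⟨w, hup _ _ h2 hw'⟩ ⟨w', hw'⟩ h2
      omega

/-- The prune of a cut. -/
def prune (S : Set T.N) (hS : T.RootClosed S) : LionsForest d where
  N := (Sᶜ : Set T.N)
  finite := inferInstance
  edge := T.resEdge Sᶜ
  edge_unique := T.resEdge_unique Sᶜ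
  acyclic := T.resEdge_acyclic Sᶜ
  h0 := {x | (x : T.N) ∈ T.h0}
  hyp := T.hyp.comap Subtype.val
  h0_class := fun x hx y => T.h0_class x hx y
  root_mem := by
    rintro ⟨x, hx⟩
    have : ∀ n, ∀ y : (Sᶜ : Set T.N), (y : T.N) ∈ T.h0 →
        depth (T.resEdge Sᶜ) y = n →
        ∃ r : (Sᶜ : Set T.N), (r : T.N) ∈ T.h0 ∧
          depth (T.resEdge Sᶜ) r = 0 := by
      intro n
      induction n with
      | zero => exact fun y hy hn => ⟨y, hy, hn⟩
      | succ n ih =>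
        intro y hy hn
        obtain ⟨z, hz⟩ := exists_edge_of_depth_pos (x := y)
          (edge := T.resEdge Sᶜ) (by omega)
        have h1 := T.resEdge_depth Sᶜ _ _ hz
        exact ih z (T.h0_parent hy hz) (by omega)
    obtain ⟨r, hr, hr0⟩ := this _ x hx rfl
    exact ⟨r, hr, fun y => by rw [hr0]; omega⟩
  parent_mem := fun x y hxy hlt => by
    obtain ⟨z, hz⟩ := exists_edge_of_depth_pos (x := y)
      (edge := T.resEdge Sᶜ) (by omega)
    by_cases h : T.hyp y z
    · exact ⟨z, h, hz⟩
    exfalso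
    obtain ⟨_, h1⟩ := T.depth_prune S hS y z hz h _ x (T.hyp.symm hxy) rfl
    obtain ⟨_, h2⟩ := T.depth_prune S hS y z hz h _ y (T.hyp.refl _) rfl
    obtain ⟨z', h3, h4⟩ := T.parent_mem x y hxy (by simp only [Subtype.coe_eta] at h1 h2; omega)
    obtain rfl := T.edge_unique _ _ _ hz h4
    exact h h3
  parents_mem := by
    have aux : ∀ x₁ y₁ x₂ y₂ : (Sᶜ : Set T.N), T.hyp x₁ y₁ →
        depth (T.resEdge Sᶜ) x₁ =
          depth (T.resEdge Sᶜ) y₁ →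
        T.edge x₁ x₂ → T.edge y₁ y₂ → x₂ ≠ y₂ → T.hyp x₁ x₂ := by
      intro x₁ y₁ x₂ y₂ hh hdep hx hy hne
      by_contra h
      obtain ⟨_, h1⟩ := T.depth_prune S hS x₁ x₂ hx h _ y₁ hh rfl
      obtain ⟨_, h2⟩ := T.depth_prune S hS x₁ x₂ hx h _ x₁ (T.hyp.refl _) rfl
      exact h (T.parents_mem x₁ y₁ x₂ y₂ hh
        (by simp only [Subtype.coe_eta] at h1 h2; omega) hx hy
        fun h => hne (Subtype.ext h)).1
    exact fun x₁ y₁ x₂ y₂ h hdep hx hy hne =>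
      ⟨aux x₁ y₁ x₂ y₂ h hdep hx hy hne,
        aux y₁ x₁ y₂ x₂ (T.hyp.symm h) hdep.symm hy hx hne.symm⟩
  L := fun x => T.L x

section mul
variable (T₁ T₂ : LionsForest d)

/-- The edges of the disjoint union. -/
def mulEdge : T₁.N ⊕ T₂.N → T₁.N ⊕ T₂.N → Prop
  | .inl x, .inl y => T₁.edge x y
  | .inr x, .inr y => T₂.edge x y
  | _, _ => False

/-- The hyperedges of the disjoint union: the hyperedges of both forests, with the two
distinguished hyperedges merged. -/
def mulRel : T₁.N ⊕ T₂.N → T₁.N ⊕ T₂.N → Prop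
  | .inl x, .inl y => T₁.hyp x y
  | .inr x, .inr y => T₂.hyp x y
  | .inl x, .inr y => x ∈ T₁.h0 ∧ y ∈ T₂.h0
  | .inr x, .inl y => x ∈ T₂.h0 ∧ y ∈ T₁.h0

def mulSetoid : Setoid (T₁.N ⊕ T₂.N) where
  r := mulRel T₁ T₂
  iseqv :=
  { refl := by rintro (x | x) <;> simp [mulRel, Setoid.refl]
    symm := by
      rintro (x | x) (y | y) h <;> simp only [mulRel] at h ⊢
      exacts [T₁.hyp.symm h, h.symm, h.symm, T₂.hyp.symm h]
    trans := by
      rintro (x | x) (y | y) (z | z) h h' <;> simp only [mulRel] at h h' ⊢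
      · exact T₁.hyp.trans h h'
      · exact ⟨(T₁.h0_class y h'.1 x).2 (T₁.hyp.symm h), h'.2⟩
      · exact (T₁.h0_class x h.1 z).1 h'.2
      · exact ⟨h.1, (T₂.h0_class y h.2 z).2 h'⟩
      · exact ⟨h.1, (T₁.h0_class y h.2 z).2 h'⟩
      · exact (T₂.h0_class x h.1 z).1 h'.2
      · exact ⟨(T₂.h0_class y h'.1 x).2 (T₂.hyp.symm h), h'.2⟩
      · exact T₂.hyp.trans h h' }

theorem mulEdge_unique (x y z) (h : mulEdge T₁ T₂ x y) (h' : mulEdge T₁ T₂ x z) : y = z := by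
  rcases x with x | x <;> rcases y with y | y <;> rcases z with z | z <;>
    simp only [mulEdge] at h h'
  · rw [T₁.edge_unique _ _ _ h h']
  · rw [T₂.edge_unique _ _ _ h h']

theorem mulEdge_trans (x y) (h : TransGen (mulEdge T₁ T₂) x y) :
    (∃ a b, x = .inl a ∧ y = .inl b ∧ TransGen T₁.edge a b) ∨
      ∃ a b, x = .inr a ∧ y = .inr b ∧ TransGen T₂.edge a b := by
  induction h with
  | single h =>
    rename_i y
    rcases x with x | x <;> rcases y with y | y <;> simp only [mulEdge] at h
    · exact Or.inl ⟨_, _, rfl, rfl, .single h⟩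
    · exact Or.inr ⟨_, _, rfl, rfl, .single h⟩
  | @tail w z _ h ih =>
    rcases ih with ⟨a, b, rfl, rfl, hab⟩ | ⟨a, b, rfl, rfl, hab⟩ <;> rcases z with z | z <;>
      simp only [mulEdge] at h
    · exact Or.inl ⟨_, _, rfl, rfl, .tail hab h⟩
    · exact Or.inr ⟨_, _, rfl, rfl, .tail hab h⟩

theorem mulEdge_acyclic (x) : ¬ TransGen (mulEdge T₁ T₂) x x := fun h => by
  rcases mulEdge_trans T₁ T₂ x x h with ⟨a, b, rfl, hb, hab⟩ | ⟨a, b, rfl, hb, hab⟩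
  · cases hb; exact T₁.acyclic _ hab
  · cases hb; exact T₂.acyclic _ hab

theorem depth_inl (x : T₁.N) : depth (mulEdge T₁ T₂) (.inl x) = depth T₁.edge x :=
  depth_map (edge := mulEdge T₁ T₂) (mulEdge_unique T₁ T₂) (mulEdge_acyclic T₁ T₂)
    T₁.edge_unique T₁.acyclic Sum.inl (fun _ _ h => h)
    (by rintro x (z | z) h <;> simp only [mulEdge] at h; exact ⟨z, h⟩) x

theorem depth_inr (x : T₂.N) : depth (mulEdge T₁ T₂) (.inr x) = depth T₂.edge x :=
  depth_map (edge := mulEdge T₁ T₂) (mulEdge_unique T₁ T₂) (mulEdge_acyclic T₁ T₂)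
    T₂.edge_unique T₂.acyclic Sum.inr (fun _ _ h => h)
    (by rintro x (z | z) h <;> simp only [mulEdge] at h; exact ⟨z, h⟩) x

theorem exists_h0_depth_zero (T : LionsForest d) (h : T.h0.Nonempty) :
    ∃ x ∈ T.h0, depth T.edge x = 0 := by
  obtain ⟨x, hx, hm⟩ := T.root_mem h
  obtain ⟨y, hy⟩ := exists_depth_zero T.edge_unique T.acyclic x
  exact ⟨x, hx, by have := hm y; omega⟩

/-- The product of two Lions forests: disjoint union, the distinguished hyperedges are merged. -/
def mul : LionsForest d where
  N := T₁.N ⊕ T₂.N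
  finite := inferInstance
  edge := mulEdge T₁ T₂
  edge_unique := mulEdge_unique T₁ T₂
  acyclic := mulEdge_acyclic T₁ T₂
  h0 := {x | Sum.elim (· ∈ T₁.h0) (· ∈ T₂.h0) x}
  hyp := mulSetoid T₁ T₂
  h0_class := by
    rintro (x | x) hx (y | y)
    · exact T₁.h0_class x hx y
    · exact ⟨fun h => ⟨hx, h⟩, fun h => h.2⟩
    · exact ⟨fun h => ⟨hx, h⟩, fun h => h.2⟩
    · exact T₂.h0_class x hx y
  root_mem := by
    rintro ⟨x | x, hx⟩
    · obtain ⟨r, hr, h0⟩ := T₁.exists_h0_depth_zero ⟨x, hx⟩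
      exact ⟨.inl r, hr, fun y => by rw [depth_inl, h0]; omega⟩
    · obtain ⟨r, hr, h0⟩ := T₂.exists_h0_depth_zero ⟨x, hx⟩
      exact ⟨.inr r, hr, fun y => by rw [depth_inr, h0]; omega⟩
  parent_mem := by
    rintro (x | x) (y | y) h hlt
    · rw [depth_inl, depth_inl] at hlt
      obtain ⟨z, hz⟩ := T₁.parent_mem x y h hlt
      exact ⟨.inl z, hz⟩
    · obtain ⟨z, hz⟩ := exists_edge_of_depth_pos (x := y) (edge := T₂.edge)
        (by rw [depth_inr] at hlt; omega)
      exact ⟨.inr z, (T₂.h0_class y h.2 z).1 (T₂.h0_parent h.2 hz), hz⟩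
    · obtain ⟨z, hz⟩ := exists_edge_of_depth_pos (x := y) (edge := T₁.edge)
        (by rw [depth_inl] at hlt; omega)
      exact ⟨.inl z, (T₁.h0_class y h.2 z).1 (T₁.h0_parent h.2 hz), hz⟩
    · rw [depth_inr, depth_inr] at hlt
      obtain ⟨z, hz⟩ := T₂.parent_mem x y h hlt
      exact ⟨.inr z, hz⟩
  parents_mem := by
    have h1 : ∀ x y : T₁.N, x ∈ T₁.h0 → T₁.edge x y → T₁.hyp x y :=
      fun x y hx h => (T₁.h0_class x hx y).1 (T₁.h0_parent hx h)
    have h2 : ∀ x y : T₂.N, x ∈ T₂.h0 → T₂.edge x y → T₂.hyp x y :=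
      fun x y hx h => (T₂.h0_class x hx y).1 (T₂.h0_parent hx h)
    rintro (x₁ | x₁) (y₁ | y₁) (x₂ | x₂) (y₂ | y₂) h hd hx hy hne <;>
      first | exact hx.elim | exact hy.elim | skip
    · rw [depth_inl, depth_inl] at hd
      exact T₁.parents_mem x₁ y₁ x₂ y₂ h hd hx hy fun h => hne (congrArg _ h)
    · exact ⟨h1 _ _ h.1 hx, h2 _ _ h.2 hy⟩
    · exact ⟨h2 _ _ h.1 hx, h1 _ _ h.2 hy⟩
    · rw [depth_inr, depth_inr] at hd
      exact T₂.parents_mem x₁ y₁ x₂ y₂ h hd hx hy fun h => hne (congrArg _ h)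
  L := Sum.elim T₁.L T₂.L

end mul

/-- The set of hyperedges other than `h0`. -/
abbrev Hyp (T : LionsForest d) : Type :=
  Quotient (T.hyp.comap (Subtype.val : {x : T.N // x ∉ T.h0} → T.N))

noncomputable instance (T : LionsForest d) : Fintype T.Hyp := Fintype.ofFinite _

/-- An embedding of node sets respecting `h0` and the hyperedges. -/
structure Emb (T' T : LionsForest d) where
  toFun : T'.N → T.N
  inj : Function.Injective toFun
  h0_iff : ∀ x, toFun x ∈ T.h0 ↔ x ∈ T'.h0
  hyp_iff : ∀ x y, T.hyp (toFun x) (toFun y) ↔ T'.hyp x y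

/-- The injection on the hyperedges other than `h0`. -/
def Emb.hypMap {T' T : LionsForest d} (φ : Emb T' T) : T'.Hyp → T.Hyp :=
  Quotient.map (fun x => ⟨φ.toFun x, fun h => x.2 ((φ.h0_iff x).1 h)⟩)
    fun x y h => (φ.hyp_iff x y).2 h

theorem Emb.hypMap_injective {T' T : LionsForest d} (φ : Emb T' T) :
    Function.Injective φ.hypMap := by
  intro a b
  refine Quotient.inductionOn₂ a b fun x y h => ?_
  have h' : (⟦⟨φ.toFun x, fun h => x.2 ((φ.h0_iff x).1 h)⟩⟧ : T.Hyp) =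
      ⟦⟨φ.toFun y, fun h => y.2 ((φ.h0_iff y).1 h)⟩⟧ := h
  have h2 := Quotient.exact h'
  exact Quotient.sound ((φ.hyp_iff x y).1 h2)

/-- An isomorphism of Lions forests. -/
structure Iso (T' T : LionsForest d) extends Emb T' T where
  surj : Function.Surjective toFun
  edge_iff : ∀ x y, T.edge (toFun x) (toFun y) ↔ T'.edge x y
  L_eq : ∀ x, T.L (toFun x) = T'.L x

def rootEmb (T : LionsForest d) (S : Set T.N) (hS : T.RootClosed S) : Emb (T.root S hS) T where
  toFun := Subtype.val
  inj := Subtype.val_injective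
  h0_iff := fun _ => Iff.rfl
  hyp_iff := fun _ _ => Iff.rfl

def pruneEmb (T : LionsForest d) (S : Set T.N) (hS : T.RootClosed S) : Emb (T.prune S hS) T where
  toFun := Subtype.val
  inj := Subtype.val_injective
  h0_iff := fun _ => Iff.rfl
  hyp_iff := fun _ _ => Iff.rfl

def inlEmb (T₁ T₂ : LionsForest d) : Emb T₁ (T₁.mul T₂) where
  toFun := Sum.inl
  inj := Sum.inl_injective
  h0_iff := fun _ => Iff.rfl
  hyp_iff := fun _ _ => Iff.rfl

def inrEmb (T₁ T₂ : LionsForest d) : Emb T₂ (T₁.mul T₂) where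
  toFun := Sum.inr
  inj := Sum.inr_injective
  h0_iff := fun _ => Iff.rfl
  hyp_iff := fun _ _ => Iff.rfl

end LionsForest

section RandomVariables
variable {Ω : Type*} [MeasurableSpace Ω]

theorem measurePreserving_precomp (μ : Measure Ω) [IsProbabilityMeasure μ] {K K' : Type}
    [Fintype K] [Fintype K'] (ψ : K' → K) (hψ : Function.Injective ψ) :
    MeasurePreserving (fun ω : K → Ω => fun k => ω (ψ k))
      (Measure.pi fun _ => μ) (Measure.pi fun _ => μ) := by
  classical
  have hm : Measurable (fun ω : K → Ω => fun k => ω (ψ k)) := by fun_prop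
  refine ⟨hm, (Measure.pi_eq fun s hs => ?_).symm⟩
  rw [Measure.map_apply hm (MeasurableSet.univ_pi hs)]
  have : (fun ω : K → Ω => fun k => ω (ψ k)) ⁻¹' (Set.univ.pi s) =
      Set.univ.pi fun k => ⋂ (k' : K') (_ : ψ k' = k), s k' := by
    ext ω
    simp only [Set.mem_preimage, Set.mem_pi, Set.mem_univ, true_implies, Set.mem_iInter]
    exact ⟨fun h k k' hk => hk ▸ h k', fun h k' => h _ k' rfl⟩
  rw [this, Measure.pi_pi, ← Finset.prod_subset (Finset.subset_univ (Finset.univ.image ψ)),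
    Finset.prod_image (fun a _ b _ h => hψ h)]
  · refine Finset.prod_congr rfl fun k' _ => congrArg _ ?_
    ext x
    simp only [Set.mem_iInter]
    exact ⟨fun h => h k' rfl, fun h k'' hk => (hψ hk) ▸ h⟩
  · intro k _ hk
    have : (⋂ (k' : K') (_ : ψ k' = k), s k') = Set.univ := by
      refine Set.iInter_eq_univ.2 fun k' => Set.iInter_eq_univ.2 fun h => ?_
      exact absurd (Finset.mem_image.2 ⟨k', Finset.mem_univ _, h⟩) hk
    rw [this, measure_univ]

/-- `Ω × Ω^H`: the free coordinate and one coordinate for every hyperedge other than `h0`. -/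
abbrev Sample (Ω : Type*) {d : ℕ} (T : LionsForest d) : Type _ := Ω × (T.Hyp → Ω)

variable (μ : Measure Ω)

/-- The product measure on `Ω × Ω^H`. -/
noncomputable abbrev law {d : ℕ} (T : LionsForest d) : Measure (Sample Ω T) :=
  μ.prod (Measure.pi fun _ => μ)

/-- The map `(ω₀, ω_H) ↦ (ω₀, ω_H')` forgetting the hyperedges that do not meet `T'`. -/
def LionsForest.Emb.sampleMap (Ω : Type*) {d : ℕ} {T' T : LionsForest d} (φ : T'.Emb T) :
    Sample Ω T → Sample Ω T' :=
  Prod.map id fun ω k => ω (φ.hypMap k)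

theorem LionsForest.Emb.measurePreserving_sampleMap [IsProbabilityMeasure μ] {d : ℕ}
    {T' T : LionsForest d} (φ : T'.Emb T) :
    MeasurePreserving (φ.sampleMap Ω) (law μ T) (law μ T') :=
  (MeasurePreserving.id μ).prod (measurePreserving_precomp μ φ.hypMap φ.hypMap_injective)

variable (d : ℕ) (A : Type*) [TopologicalSpace A]

variable {d} in
/-- Classes of random variables on `Ω × Ω^H` with values in `A ⊗ (ℝ^d)^{⊗ N}`, through their
components in the standard basis of `(ℝ^d)^{⊗ N}`. -/
abbrev RV (T : LionsForest d) : Type _ := (T.N → Fin d) → (Sample Ω T →ₘ[law μ T] A)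

/-- The dual in the almost sure sense: a random variable for every Lions forest. -/
abbrev Functional : Type _ := ∀ T : LionsForest d, RV μ A T

variable {μ d A}

/-- A random variable indexed by `T'` read as one indexed by `T`, along an embedding. -/
noncomputable def pull [IsProbabilityMeasure μ] {T' T : LionsForest d} (φ : T'.Emb T)
    (f : RV μ A T') (i : T.N → Fin d) : Sample Ω T →ₘ[law μ T] A :=
  (f (i ∘ φ.toFun)).compMeasurePreserving (φ.sampleMap Ω) (φ.measurePreserving_sampleMap μ)

/-- A random variable on `Ω` read as a function of the free coordinate. -/
noncomputable def pullFree [IsProbabilityMeasure μ] (T : LionsForest d) (r : Ω →ₘ[μ] A) :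
    Sample Ω T →ₘ[law μ T] A :=
  r.compMeasurePreserving Prod.fst measurePreserving_fst

/-- The values on isomorphic forests are identified. -/
def Natural [IsProbabilityMeasure μ] (f : Functional μ d A) : Prop :=
  ∀ (T' T : LionsForest d) (φ : T'.Iso T), pull φ.toEmb (f T') = f T

variable [CommRing A] [IsTopologicalRing A]

noncomputable instance (T : LionsForest d) : Fintype {S : Set T.N // T.RootClosed S} :=
  Fintype.ofFinite _

noncomputable instance (T : LionsForest d) :
    Fintype {S : Set T.N // T.RootClosed S ∧ S.Nonempty ∧ S ≠ Set.univ} :=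
  Fintype.ofFinite _

open scoped Classical in
/-- The counit: `1` on the empty forest and `0` on all others. -/
noncomputable def unit : Functional μ d A := fun T => if IsEmpty T.N then 1 else 0

variable [IsProbabilityMeasure μ]

/-- `f_P ⊗^{H} g_R` for the prune `P` and the root `R` of a (possibly trivial) cut. -/
noncomputable def cutTerm (f g : Functional μ d A) (T : LionsForest d) (S : Set T.N)
    (hS : T.RootClosed S) : RV μ A T := fun i =>
  pull (T.pruneEmb S hS) (f (T.prune S hS)) i * pull (T.rootEmb S hS) (g (T.root S hS)) i

/-- The coupled convolution product. -/
noncomputable def conv (f g : Functional μ d A) : Functional μ d A := fun T =>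
  ∑ S : {S : Set T.N // T.RootClosed S}, cutTerm f g T S.1 S.2

noncomputable def convPow (f : Functional μ d A) : ℕ → Functional μ d A
  | 0 => unit
  | n + 1 => conv f (convPow f n)

/-- `f_{T₁} ⊗ g_{T₂}`, on the hyperedges of the product. -/
noncomputable def outer (f g : Functional μ d A) (T₁ T₂ : LionsForest d) :
    RV μ A (T₁.mul T₂) := fun i =>
  pull (T₁.inlEmb T₂) (f T₁) i * pull (T₁.inrEmb T₂) (g T₂) i

structure IsCharacter (f : Functional μ d A) : Prop where
  natural : Natural f
  one : ∀ T : LionsForest d, IsEmpty T.N → f T = 1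
  mul : ∀ T₁ T₂ : LionsForest d, f (T₁.mul T₂) = outer f f T₁ T₂

structure IsDerivation (f : Functional μ d A) : Prop where
  natural : Natural f
  leibniz : ∀ T₁ T₂ : LionsForest d,
    f (T₁.mul T₂) = outer f unit T₁ T₂ + outer unit f T₁ T₂

variable (μ d A) in
abbrev Characters : Type _ := {f : Functional μ d A // IsCharacter f}

variable (μ d A) in
abbrev Derivations : Type _ := {f : Functional μ d A // IsDerivation f}

/-- Multiplication of a functional by a random variable of the free coordinate. -/
noncomputable def scale (r : Ω →ₘ[μ] A) (f : Functional μ d A) : Functional μ d A :=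
  fun T i => pullFree T r * f T i

noncomputable def bracket (f g : Functional μ d A) : Functional μ d A := conv f g - conv g f

/-- The geometric series. -/
noncomputable def antipode (f : Functional μ d A) : Functional μ d A := fun T =>
  ∑ᶠ n : ℕ, convPow (unit - f) n T

/-- The left Bogoliubov recursion for `s`; the sum runs over all cuts. -/
def BogoliubovLeft (f s : Functional μ d A) : Prop :=
  (∀ T : LionsForest d, IsEmpty T.N → s T = 1) ∧
    ∀ T : LionsForest d, Nonempty T.N → s T = - f T -
      ∑ S : {S : Set T.N // T.RootClosed S ∧ S.Nonempty ∧ S ≠ Set.univ},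
        cutTerm s f T S.1 S.2.1

/-- The right Bogoliubov recursion for `s`. -/
def BogoliubovRight (f s : Functional μ d A) : Prop :=
  (∀ T : LionsForest d, IsEmpty T.N → s T = 1) ∧
    ∀ T : LionsForest d, Nonempty T.N → s T = - f T -
      ∑ S : {S : Set T.N // T.RootClosed S ∧ S.Nonempty ∧ S ≠ Set.univ},
        cutTerm f s T S.1 S.2.1

variable [Algebra ℝ A] [ContinuousConstSMul ℝ A]

open scoped Nat in
noncomputable def convExp (f : Functional μ d A) : Functional μ d A := fun T =>
  ∑ᶠ n : ℕ, ((n ! : ℝ)⁻¹) • convPow f n T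

noncomputable def convLog (f : Functional μ d A) : Functional μ d A := fun T =>
  ∑ᶠ n : ℕ, ((-1 : ℝ) ^ ((n + 1) + 1) / ((n + 1 : ℕ) : ℝ)) • convPow (f - unit) (n + 1) T

end RandomVariables

end LionsHopf

/-!
Both parts reduce to one formal argument. Let `Z` be a ring in which a map `f` of interest is
nilpotent (or unipotent). The inverse, the exponential and the logarithm are then finite sums, and
the identities between formal power series hold for them (`NilExpLog`). Characters and derivations
are recognised after passing to a ring with two commuting homomorphisms from `Z`: there `f` becomes
the product `f₁ * f₂` for a character, and the sum `f₁ + f₂` for a derivation. Products of commuting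
elements are closed under products and inverses, sums of commuting elements are closed under
commutators, and `exp`, `log` exchange the two. This gives the group, the Lie algebra and the
bijection.

*Coupled bialgebras.* The couplings turn a coupled bialgebra into an ordinary bialgebra with the
comultiplication `P ∘ Δ` (`CouplingSystem.bialgebra`), and `*` into the convolution product of
`WithConv (H →ₗ[R] A)`. The grading gives a connected filtration of this bialgebra
(`IsGradedConnected.isCoalgebraFiltration`). The maps vanishing on a step of the filtration form a
two-sided ideal; maps vanishing at `1` are nilpotent modulo each of these ideals, and the ideals
separate maps (`pow_mem_vanishing`, `ext_of_mk`). The second ring consists of the maps on `H ⊗ H`,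
filtered likewise; the commuting homomorphisms are the pullbacks along `I ⊗ ε` and `ε ⊗ I`, and a
map is pulled back along the multiplication to be compared with them (`isCharacter_iff`,
`isDer_iff`). The Bogoliubov recursions say that `s` is a left, respectively right, inverse.

*Lions forests.* A natural functional `f` and a forest `T` give a matrix indexed by the root-closed
sets of `T`, whose entry at `S' ⊆ S` is the value of `f` on the restriction of `T` to `S \ S'`
(`diffMatrix`). The root-closed sets of this restriction correspond to the root-closed sets between
`S'` and `S`, so the convolution becomes the matrix product (`diffMatrix_conv`). The matrix
determines the value on `T` as its corner entry, and it is strictly triangular, hence nilpotent, if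
`f` vanishes on empty forests (`Natural.ext`, `diffMatrix_pow_eq_zero`). Root-closed sets of a
product are pairs of root-closed sets, so characters have Kronecker products and derivations have
Kronecker sums as matrices over products (`LionsHopf.isCharacter_iff`, `isDerivation_iff`). The
Bogoliubov recursions have at most one solution by induction on the number of nodes, without any
assumption of naturality.
-/

/-! ### Exponential and logarithm of nilpotent and unipotent elements -/

namespace NilExpLog

open PowerSeries

section Eval

variable {Z : Type*} [Ring Z] [Algebra ℚ Z]

theorem aeval_trunc {a : Z} {N : ℕ} (ha : a ^ N = 0) (p : Polynomial ℚ) :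
    Polynomial.aeval a (trunc N (p : ℚ⟦X⟧)) = Polynomial.aeval a p := by
  have h : (Polynomial.X : Polynomial ℚ) ^ N ∣ p - trunc N (p : ℚ⟦X⟧) := by
    rw [Polynomial.X_pow_dvd_iff]
    intro k hk
    simp [coeff_trunc, hk]
  obtain ⟨r, hr⟩ := h
  have h2 := congrArg (Polynomial.aeval a) hr
  rw [map_sub, map_mul, map_pow, Polynomial.aeval_X, ha, zero_mul, sub_eq_zero] at h2
  exact h2.symm

/-- Evaluation of a formal power series at an element with vanishing `N`-th power. -/
noncomputable def evalNil (a : Z) (N : ℕ) (ha : a ^ N = 0) : ℚ⟦X⟧ →ₐ[ℚ] Z :=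
  AlgHom.ofLinearMap ((Polynomial.aeval a).toLinearMap ∘ₗ trunc N)
    (by
      have := aeval_trunc ha 1
      simpa using this)
    (fun p q => by
      have h := aeval_trunc ha (trunc N p * trunc N q)
      rw [Polynomial.coe_mul, trunc_trunc_mul_trunc, map_mul (Polynomial.aeval a)] at h
      exact h)

theorem evalNil_apply (a : Z) (N : ℕ) (ha : a ^ N = 0) (p : ℚ⟦X⟧) :
    evalNil a N ha p = ∑ n ∈ Finset.range N, coeff n p • a ^ n := by
  change Polynomial.aeval a (trunc N p) = _
  simp only [trunc_apply, map_sum, Polynomial.aeval_monomial, Algebra.smul_def,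
    Finset.range_eq_Ico]

theorem evalNil_coe (a : Z) (N : ℕ) (ha : a ^ N = 0) (p : Polynomial ℚ) :
    evalNil a N ha (p : ℚ⟦X⟧) = Polynomial.aeval a p :=
  aeval_trunc ha p

theorem evalNil_X (a : Z) (N : ℕ) (ha : a ^ N = 0) : evalNil a N ha X = a := by
  simpa using evalNil_coe a N ha Polynomial.X

theorem evalNil_pow_eq_zero (a : Z) (N : ℕ) (ha : a ^ N = 0) {q : ℚ⟦X⟧}
    (hq : constantCoeff q = 0) : evalNil a N ha q ^ N = 0 := by
  obtain ⟨r, rfl⟩ := X_dvd_iff.2 hq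
  rw [← map_pow, mul_pow, map_mul, map_pow, evalNil_X, ha, zero_mul]

/-- Evaluation is compatible with substitution, so identities between formal power series carry over
to nilpotent elements. -/
theorem evalNil_subst (a : Z) (N : ℕ) (ha : a ^ N = 0) {q : ℚ⟦X⟧}
    (hq : constantCoeff q = 0) (p : ℚ⟦X⟧) :
    evalNil a N ha (p.subst q) =
      evalNil (evalNil a N ha q) N (evalNil_pow_eq_zero a N ha hq) p := by
  have hs : HasSubst q := HasSubst.of_constantCoeff_zero' hq
  have h : (X : ℚ⟦X⟧) ^ N ∣ p - (trunc N p : Polynomial ℚ) := by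
    rw [X_pow_dvd_iff]
    intro k hk
    simp [coeff_trunc, hk]
  obtain ⟨r, hr⟩ := h
  have hp : p = ((trunc N p : Polynomial ℚ) : ℚ⟦X⟧) + X ^ N * r := by rw [← hr]; ring
  have h1 : evalNil a N ha (p.subst q) = Polynomial.aeval (evalNil a N ha q) (trunc N p) := by
    conv_lhs => rw [hp]
    rw [subst_add hs, subst_mul hs, subst_pow hs, subst_X hs, subst_coe hs, map_add, map_mul,
      map_pow, evalNil_pow_eq_zero a N ha hq, zero_mul, add_zero,
      ← Polynomial.aeval_algHom_apply]
  rw [h1]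
  rfl

end Eval

/-- The formal identity `log (1 + (exp X - 1)) = X`: both sides have the same derivative and no
constant term. -/
theorem log_subst_exp_sub_one : (PowerSeries.log ℚ).subst (PowerSeries.exp ℚ - 1) = X := by
  have hs : HasSubst (PowerSeries.exp ℚ - 1) := HasSubst.exp_sub_one
  refine derivative.ext ?_ ?_
  · rw [derivative_subst hs, deriv_log, map_sub, derivative_exp, derivative_one, sub_zero,
      derivative_X]
    have h1 : (PowerSeries.mk fun n => algebraMap ℚ ℚ ((-1 : ℚ) ^ n)) * (1 + X) = 1 := by
      ext n
      rcases n with - | n <;> simp [mul_add, coeff_succ_mul_X, pow_succ, coeff_one]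
    have h2 := congrArg (PowerSeries.subst (PowerSeries.exp ℚ - 1)) h1
    rw [subst_mul hs, subst_add hs, subst_X hs] at h2
    have h3 : (1 : ℚ⟦X⟧).subst (PowerSeries.exp ℚ - 1) = (1 : ℚ⟦X⟧) := by
      rw [← coe_substAlgHom hs, map_one]
    rw [h3, add_sub_cancel] at h2
    exact h2
  · rw [constantCoeff_X]
    exact constantCoeff_subst_eq_zero (by rw [map_sub, ← constantCoeff_eq]; simp) _
      constantCoeff_log

/-- The formal identity `exp (log (1 + X)) - 1 = X`: the logarithm is a left inverse of
`exp X - 1` under substitution, hence the two-sided inverse. -/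
theorem exp_sub_one_subst_log : (PowerSeries.exp ℚ - 1).subst (PowerSeries.log ℚ) = X := by
  have hu : IsUnit (coeff 1 (PowerSeries.exp ℚ - 1)) := by simp [coeff_one]
  have h0 : constantCoeff (PowerSeries.exp ℚ - 1) = 0 := by simp
  have hE : HasSubst (PowerSeries.exp ℚ - 1) := HasSubst.exp_sub_one
  set F := substInvOfIsUnit (PowerSeries.exp ℚ - 1) hu
  have hF : HasSubst F := HasSubst.substInvOfIsUnit ..
  have h1 : (PowerSeries.exp ℚ - 1).subst F = X := subst_substInvOfIsUnit_right _ h0 hu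
  have h2 : PowerSeries.log ℚ = F := by
    have := congrArg (PowerSeries.subst F) log_subst_exp_sub_one
    rw [subst_comp_subst_apply hE hF, h1, subst_X hF, X_subst] at this
    exact this
  rw [h2, h1]

section Log

variable {Z : Type*} [Ring Z] [Algebra ℚ Z]

/-- The logarithm of a unipotent element; the value is junk (`0`, an empty sum) unless `u - 1` is
nilpotent. -/
noncomputable def log (u : Z) : Z :=
  ∑ n ∈ Finset.range (nilpotencyClass (u - 1)),
    ((-1 : ℚ) ^ ((n + 1) + 1) / ((n + 1 : ℕ) : ℚ)) • (u - 1) ^ (n + 1)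

theorem log_eq_sum {u : Z} {k : ℕ} (h : (u - 1) ^ k = 0) :
    log u = ∑ n ∈ Finset.range k,
      ((-1 : ℚ) ^ ((n + 1) + 1) / ((n + 1 : ℕ) : ℚ)) • (u - 1) ^ (n + 1) := by
  refine Finset.sum_subset (Finset.range_mono (csInf_le' h)) fun n _ hn => ?_
  rw [pow_eq_zero_of_le _ (pow_nilpotencyClass ⟨k, h⟩), smul_zero]
  simp only [Finset.mem_range, not_lt] at hn
  omega

theorem log_eq_evalNil {u : Z} {k : ℕ} (h : (u - 1) ^ k = 0) :
    log u = evalNil (u - 1) k h (PowerSeries.log ℚ) := by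
  -- The logarithmic series starts in degree one: its first `k` terms are those of degree at
  -- most `k`, which evaluation at precision `k + 1` retains.
  have h' : (u - 1) ^ (k + 1) = 0 := by rw [pow_succ, h, zero_mul]
  have e : evalNil (u - 1) k h (PowerSeries.log ℚ) =
      evalNil (u - 1) (k + 1) h' (PowerSeries.log ℚ) := by
    rw [evalNil_apply, evalNil_apply, Finset.sum_range_succ, h, smul_zero, add_zero]
  rw [e, evalNil_apply, Finset.sum_range_succ', log_eq_sum h]
  simp

theorem exp_eq_evalNil {a : Z} {k : ℕ} (h : a ^ k = 0) :
    IsNilpotent.exp a = evalNil a k h (PowerSeries.exp ℚ) := by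
  rw [IsNilpotent.exp_eq_sum h, evalNil_apply]
  simp

theorem isNilpotent_log {u : Z} (h : IsNilpotent (u - 1)) : IsNilpotent (log u) := by
  obtain ⟨k, hk⟩ := h
  exact ⟨k, by rw [log_eq_evalNil hk]; exact evalNil_pow_eq_zero _ _ _ constantCoeff_log⟩

theorem exp_log {u : Z} (h : IsNilpotent (u - 1)) : IsNilpotent.exp (log u) = u := by
  obtain ⟨k, hk⟩ := h
  have h1 := evalNil_subst (u - 1) k hk constantCoeff_log (PowerSeries.exp ℚ - 1)
  rw [exp_sub_one_subst_log, evalNil_X, map_sub, map_one, ← exp_eq_evalNil,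
    ← log_eq_evalNil] at h1
  exact (sub_left_inj.1 h1).symm

theorem log_exp {a : Z} (h : IsNilpotent a) : log (IsNilpotent.exp a) = a := by
  obtain ⟨k, hk⟩ := h
  have h0 : constantCoeff (PowerSeries.exp ℚ - 1) = 0 := by simp
  have h1 := evalNil_subst a k hk h0 (PowerSeries.log ℚ)
  have h2 : evalNil a k hk (PowerSeries.exp ℚ - 1) = IsNilpotent.exp a - 1 := by
    rw [map_sub, map_one, ← exp_eq_evalNil]
  have h3 : (IsNilpotent.exp a - 1) ^ k = 0 := by
    rw [← h2]; exact evalNil_pow_eq_zero a k hk h0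
  rw [log_subst_exp_sub_one, evalNil_X] at h1
  rw [log_eq_evalNil h3]
  simp only [← h2]
  exact h1.symm

theorem map_log {Z' : Type*} [Ring Z'] [Algebra ℚ Z'] (φ : Z →+* Z') {u : Z}
    (h : IsNilpotent (u - 1)) : φ (log u) = log (φ u) := by
  obtain ⟨k, hk⟩ := h
  have hk' : (φ u - 1) ^ k = 0 := by rw [← map_one φ, ← map_sub, ← map_pow, hk, map_zero]
  simp [log_eq_sum hk, log_eq_sum hk', map_rat_smul]

theorem commute_log {u v : Z} (hu : IsNilpotent (u - 1)) (hv : IsNilpotent (v - 1))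
    (h : Commute u v) : Commute (log u) (log v) := by
  obtain ⟨k, hk⟩ := hu
  obtain ⟨l, hl⟩ := hv
  have h1 : Commute (u - 1) (v - 1) :=
    (h.sub_left (Commute.one_left v)).sub_right (Commute.one_right _)
  rw [log_eq_sum hk, log_eq_sum hl]
  exact Commute.sum_left _ _ _ fun i _ => Commute.sum_right _ _ _ fun j _ =>
    ((h1.pow_pow _ _).smul_left _).smul_right _

/-- The logarithm turns products of commuting unipotent elements into sums: both sides have the
same exponential. -/
theorem log_mul_of_commute {u v : Z} (hu : IsNilpotent (u - 1)) (hv : IsNilpotent (v - 1))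
    (h : Commute u v) : log (u * v) = log u + log v := by
  have hc := commute_log hu hv h
  have h1 := IsNilpotent.exp_add_of_commute hc (isNilpotent_log hu) (isNilpotent_log hv)
  rw [exp_log hu, exp_log hv] at h1
  rw [← h1, log_exp (hc.isNilpotent_add (isNilpotent_log hu) (isNilpotent_log hv))]

end Log

end NilExpLog

/-! ### Convolution rings on filtered coalgebras -/

namespace FilteredConv

open scoped TensorProduct
open Coalgebra WithConv LinearMap

section Filtration

variable {R C D : Type*} [CommRing R] [AddCommGroup C] [Module R C] [AddCommGroup D] [Module R D]

/-- The total filtration on `C ⊗ D` of filtrations of `C` and `D`. -/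
def tensorFiltration (F : ℕ → Submodule R C) (G : ℕ → Submodule R D) (n : ℕ) :
    Submodule R (C ⊗[R] D) :=
  ⨆ p ∈ Finset.HasAntidiagonal.antidiagonal n,
    Submodule.map₂ (TensorProduct.mk R C D) (F p.1) (G p.2)

variable {F : ℕ → Submodule R C} {G : ℕ → Submodule R D}

theorem tensorFiltration_le {n : ℕ} {S : Submodule R (C ⊗[R] D)} :
    tensorFiltration F G n ≤ S ↔
      ∀ p q, p + q = n → ∀ x ∈ F p, ∀ y ∈ G q, x ⊗ₜ y ∈ S := by
  simp only [tensorFiltration, iSup_le_iff, Submodule.map₂_le,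
    Finset.HasAntidiagonal.mem_antidiagonal, Prod.forall, TensorProduct.mk_apply]

theorem tmul_mem_tensorFiltration {n p q : ℕ} (h : p + q = n) {x : C} (hx : x ∈ F p) {y : D}
    (hy : y ∈ G q) : x ⊗ₜ[R] y ∈ tensorFiltration F G n :=
  tensorFiltration_le.1 le_rfl p q h x hx y hy

theorem tensorFiltration_monotone (hF : Monotone F) : Monotone (tensorFiltration F G) := by
  refine monotone_nat_of_le_succ fun n => tensorFiltration_le.2 fun p q h x hx y hy => ?_
  exact tmul_mem_tensorFiltration (p := p + 1) (by omega) (hF p.le_succ hx) hy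

end Filtration

/-- An exhaustive increasing filtration of a coalgebra that is compatible with the
comultiplication. -/
structure IsCoalgebraFiltration {R C : Type*} [CommRing R] [AddCommGroup C] [Module R C]
    [Coalgebra R C] (F : ℕ → Submodule R C) : Prop where
  mono : Monotone F
  exhaust : ∀ x, ∃ n, x ∈ F n
  comul_mem : ∀ n, ∀ x ∈ F n, comul (R := R) x ∈ tensorFiltration F F n

section LocSum

variable {R C A : Type*} [CommRing R] [AddCommGroup C] [Module R C] [CommRing A] [Algebra R A]

/-- The series `∑ gₖ` has finitely many non-zero terms at every point, and its sum is `s`. -/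
structure IsLocSum (g : ℕ → WithConv (C →ₗ[R] A)) (s : WithConv (C →ₗ[R] A)) : Prop where
  finite : ∀ x, {k | g k x ≠ 0}.Finite
  eq : ∀ x, s x = ∑ᶠ k, g k x

theorem exists_isLocSum {g : ℕ → WithConv (C →ₗ[R] A)} (h : ∀ x, {k | g k x ≠ 0}.Finite) :
    ∃ s, IsLocSum g s :=
  ⟨toConv
    { toFun := fun x => ∑ᶠ k, g k x
      map_add' := fun x y => by
        simp only [map_add]
        exact finsum_add_distrib (h x) (h y)
      map_smul' := fun r x => by
        simp only [map_smul, RingHom.id_apply]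
        exact (smul_finsum' r (h x)).symm }, h, fun _ => rfl⟩

end LocSum

section

variable {R C D A : Type*} [CommRing R] [AddCommGroup C] [Module R C] [Coalgebra R C]
  [AddCommGroup D] [Module R D] [Coalgebra R D] [CommRing A] [Algebra R A]

/-- The tensor product of filtered coalgebras is filtered. -/
theorem IsCoalgebraFiltration.tensor {F : ℕ → Submodule R C} {G : ℕ → Submodule R D}
    (hF : IsCoalgebraFiltration F) (hG : IsCoalgebraFiltration G) :
    IsCoalgebraFiltration (tensorFiltration F G) where
  mono := tensorFiltration_monotone hF.mono
  exhaust := by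
    intro z
    induction z with
    | zero => exact ⟨0, zero_mem _⟩
    | tmul x y =>
      obtain ⟨m, hm⟩ := hF.exhaust x
      obtain ⟨n, hn⟩ := hG.exhaust y
      exact ⟨m + n, tmul_mem_tensorFiltration rfl hm hn⟩
    | add x y hx hy =>
      obtain ⟨m, hm⟩ := hx
      obtain ⟨n, hn⟩ := hy
      exact ⟨max m n, add_mem (tensorFiltration_monotone hF.mono (le_max_left _ _) hm)
        (tensorFiltration_monotone hF.mono (le_max_right _ _) hn)⟩
  comul_mem := by
    intro n
    suffices h : tensorFiltration F G n ≤ Submodule.comap (comul (R := R) (A := C ⊗[R] D))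
        (tensorFiltration (tensorFiltration F G) (tensorFiltration F G) n) from fun x hx => h hx
    refine tensorFiltration_le.2 fun a b hab x hx y hy => ?_
    rw [Submodule.mem_comap, TensorProduct.comul_tmul]
    have key : ∀ u ∈ tensorFiltration F F a, ∀ v ∈ tensorFiltration G G b,
        TensorProduct.tensorTensorTensorComm R C C D D (u ⊗ₜ v) ∈
          tensorFiltration (tensorFiltration F G) (tensorFiltration F G) n := by
      intro u hu v hv
      have h1 : tensorFiltration F F a ≤ Submodule.comap
          ((TensorProduct.tensorTensorTensorComm R C C D D).toLinearMap ∘ₗ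
            (TensorProduct.mk R _ _).flip v)
          (tensorFiltration (tensorFiltration F G) (tensorFiltration F G) n) := by
        refine tensorFiltration_le.2 fun p q hpq x hx y hy => ?_
        have h2 : tensorFiltration G G b ≤ Submodule.comap
            ((TensorProduct.tensorTensorTensorComm R C C D D).toLinearMap ∘ₗ
              (TensorProduct.mk R _ _) (x ⊗ₜ y))
            (tensorFiltration (tensorFiltration F G) (tensorFiltration F G) n) := by
          refine tensorFiltration_le.2 fun r s hrs z hz w hw => ?_
          exact tmul_mem_tensorFiltration (p := p + r) (q := q + s) (by omega)
            (tmul_mem_tensorFiltration rfl hx hz) (tmul_mem_tensorFiltration rfl hy hw)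
        exact h2 hv
      exact h1 hu
    exact key _ (hF.comul_mem a x hx) _ (hG.comul_mem b y hy)

/-- Precomposition with a homomorphism of coalgebras, as a homomorphism of convolution rings. -/
def precomp (A : Type*) [CommRing A] [Algebra R A] (h : D →ₗc[R] C) :
    WithConv (C →ₗ[R] A) →+* WithConv (D →ₗ[R] A) where
  toFun f := toConv (f.ofConv ∘ₗ h.toLinearMap)
  map_one' := by
    ext x
    change algebraMap R A (counit (R := R) (h x)) = algebraMap R A (counit (R := R) x)
    rw [CoalgHomClass.counit_comp_apply]
  map_mul' f g := WithConv.ext (convMul_comp_coalgHom_distrib f g h)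
  map_zero' := rfl
  map_add' _ _ := rfl

theorem precomp_apply (h : D →ₗc[R] C) (f : WithConv (C →ₗ[R] A)) (x : D) :
    precomp A h f x = f (h x) := rfl

/-- A convolution vanishes on the `n`-th step if its factors kill each other in all pairs of steps
of total degree `n`. -/
theorem convMul_mem_zero {F : ℕ → Submodule R C} (hF : IsCoalgebraFiltration F)
    {n : ℕ} {f g : WithConv (C →ₗ[R] A)}
    (h : ∀ p q, p + q = n → ∀ x ∈ F p, ∀ y ∈ F q, f x * g y = 0) :
    ∀ x ∈ F n, (f * g) x = 0 := by
  intro x hx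
  have h1 : tensorFiltration F F n ≤
      LinearMap.ker (mul' R A ∘ₗ TensorProduct.map f.ofConv g.ofConv) :=
    tensorFiltration_le.2 fun p q hpq x hx y hy => h p q hpq x hx y hy
  exact h1 (hF.comul_mem n x hx)

/-- The ideal of the linear maps that vanish on the `n`-th step of the filtration. -/
def vanishing (A : Type*) [CommRing A] [Algebra R A] {F : ℕ → Submodule R C}
    (hF : IsCoalgebraFiltration F) (n : ℕ) : Ideal (WithConv (C →ₗ[R] A)) where
  carrier := {f | ∀ x ∈ F n, f x = 0}
  add_mem' := fun {f g} hf hg x hx => by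
    change f x + g x = 0
    rw [hf x hx, hg x hx, add_zero]
  zero_mem' := fun _ _ => rfl
  smul_mem' := fun f g hg => convMul_mem_zero hF fun p q hpq x _ y hy => by
    rw [hg y (hF.mono (by omega) hy), mul_zero]

instance {F : ℕ → Submodule R C} (hF : IsCoalgebraFiltration F) (n : ℕ) :
    (vanishing A hF n).IsTwoSided where
  mul_mem_of_left {f} g hf := convMul_mem_zero hF fun p q hpq x hx y _ => by
    rw [hf x (hF.mono (by omega) hx), zero_mul]

/-- Linear maps on a filtered coalgebra are separated by the quotients by the ideals
`vanishing`. -/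
theorem ext_of_mk {F : ℕ → Submodule R C} (hF : IsCoalgebraFiltration F)
    {f g : WithConv (C →ₗ[R] A)}
    (h : ∀ n, Ideal.Quotient.mk (vanishing A hF n) f = Ideal.Quotient.mk (vanishing A hF n) g) :
    f = g := by
  ext x
  obtain ⟨n, hn⟩ := hF.exhaust x
  exact sub_eq_zero.1 ((Ideal.Quotient.eq.1 (h n)) x hn)

/-- Powers of a map vanishing in degree `0` vanish in any given degree. -/
theorem pow_mem_vanishing {F : ℕ → Submodule R C} (hF : IsCoalgebraFiltration F)
    {f : WithConv (C →ₗ[R] A)} (hf : ∀ x ∈ F 0, f x = 0) {n k : ℕ} (hk : n < k) :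
    f ^ k ∈ vanishing A hF n := by
  induction n generalizing k with
  | zero =>
    obtain ⟨k, rfl⟩ : ∃ l, k = l + 1 := ⟨k - 1, by omega⟩
    rw [pow_succ]
    exact Ideal.mul_mem_left _ _ hf
  | succ n ih =>
    obtain ⟨k, rfl⟩ : ∃ l, k = l + 1 := ⟨k - 1, by omega⟩
    rw [pow_succ']
    refine convMul_mem_zero hF fun p q hpq x hx y hy => ?_
    rcases p with - | p
    · rw [hf x hx, zero_mul]
    · rw [ih (k := k) (by omega) y (hF.mono (by omega) hy), mul_zero]

theorem isNilpotent_mk {F : ℕ → Submodule R C} (hF : IsCoalgebraFiltration F)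
    {f : WithConv (C →ₗ[R] A)} (hf : ∀ x ∈ F 0, f x = 0) (n : ℕ) :
    IsNilpotent (Ideal.Quotient.mk (vanishing A hF n) f) :=
  ⟨n + 1, by
    rw [← map_pow]
    exact Ideal.Quotient.eq_zero_iff_mem.2 (pow_mem_vanishing hF hf n.lt_succ_self)⟩

theorem IsLocSum.comp {g : ℕ → WithConv (C →ₗ[R] A)} {s : WithConv (C →ₗ[R] A)}
    (hs : IsLocSum g s) (h : D →ₗc[R] C) :
    IsLocSum (fun k => precomp A h (g k)) (precomp A h s) :=
  ⟨fun x => hs.finite (h x), fun x => hs.eq (h x)⟩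

/-- Modulo the `n`-th ideal, a locally finite series whose tail lies in the ideal is a finite
sum. -/
theorem IsLocSum.mk_eq {F : ℕ → Submodule R C} (hF : IsCoalgebraFiltration F)
    {g : ℕ → WithConv (C →ₗ[R] A)} {s : WithConv (C →ₗ[R] A)} (hs : IsLocSum g s) {n N : ℕ}
    (h : ∀ k, N ≤ k → g k ∈ vanishing A hF n) :
    Ideal.Quotient.mk (vanishing A hF n) s =
      ∑ k ∈ Finset.range N, Ideal.Quotient.mk (vanishing A hF n) (g k) := by
  rw [← map_sum, Ideal.Quotient.eq]
  intro x hx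
  have h1 : ∀ M, (∑ k ∈ Finset.range M, g k) x = ∑ k ∈ Finset.range M, g k x := fun M => by
    induction M with
    | zero => rfl
    | succ M ih => rw [Finset.sum_range_succ, Finset.sum_range_succ, ← ih]; rfl
  change s x - (∑ k ∈ Finset.range N, g k) x = 0
  rw [hs.eq, h1, sub_eq_zero]
  refine finsum_eq_sum_of_support_subset _ fun k hk => ?_
  rw [Finset.coe_range, Set.mem_Iio]
  by_contra hk'
  exact hk (h k (not_lt.1 hk') x hx)

theorem finite_pow_apply_ne_zero {F : ℕ → Submodule R C} (hF : IsCoalgebraFiltration F)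
    {f : WithConv (C →ₗ[R] A)} (hf : ∀ x ∈ F 0, f x = 0) (x : C) :
    {k | (f ^ k) x ≠ 0}.Finite := by
  obtain ⟨n, hn⟩ := hF.exhaust x
  refine (Set.finite_Iic n).subset fun k hk => ?_
  rw [Set.mem_Iic]
  by_contra hk'
  exact hk (pow_mem_vanishing hF hf (not_le.1 hk') x hn)

/-- The Neumann series inverts `f`. -/
theorem IsLocSum.geom_inverse {F : ℕ → Submodule R C} (hF : IsCoalgebraFiltration F)
    {f s : WithConv (C →ₗ[R] A)} (hf : ∀ x ∈ F 0, (1 - f) x = 0)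
    (hs : IsLocSum (fun k => (1 - f) ^ k) s) : s * f = 1 ∧ f * s = 1 := by
  have key : ∀ n, Ideal.Quotient.mk (vanishing A hF n) s =
      ∑ k ∈ Finset.range (n + 1), (Ideal.Quotient.mk (vanishing A hF n) (1 - f)) ^ k := by
    intro n
    simp only [← map_pow]
    exact hs.mk_eq hF fun k hk => pow_mem_vanishing hF hf hk
  have h0 : ∀ n, (Ideal.Quotient.mk (vanishing A hF n) (1 - f)) ^ (n + 1) = 0 := by
    intro n
    rw [← map_pow]
    exact Ideal.Quotient.eq_zero_iff_mem.2 (pow_mem_vanishing hF hf n.lt_succ_self)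
  have h1 : ∀ n, Ideal.Quotient.mk (vanishing A hF n) f =
      1 - Ideal.Quotient.mk (vanishing A hF n) (1 - f) := by
    intro n
    rw [map_sub, map_one, sub_sub_cancel]
  refine ⟨ext_of_mk hF fun n => ?_, ext_of_mk hF fun n => ?_⟩
  · rw [map_mul, key, h1, geom_sum_mul_neg, h0, sub_zero, map_one]
  · rw [map_mul, key, h1, mul_neg_geom_sum, h0, sub_zero, map_one]

section Rat

variable [Algebra ℚ A]

/-- `e` is the sum of the exponential series of `f`. -/
def IsExp (f e : WithConv (C →ₗ[R] A)) : Prop :=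
  IsLocSum (fun k => ((k.factorial : ℚ)⁻¹) • f ^ k) e

/-- `l` is the sum of the logarithmic series of `u`. -/
def IsLog (u l : WithConv (C →ₗ[R] A)) : Prop :=
  IsLocSum (fun k => ((-1 : ℚ) ^ ((k + 1) + 1) / ((k + 1 : ℕ) : ℚ)) • (u - 1) ^ (k + 1)) l

theorem IsExp.comp {f e : WithConv (C →ₗ[R] A)} (he : IsExp f e) (h : D →ₗc[R] C) :
    IsExp (precomp A h f) (precomp A h e) := by
  have := IsLocSum.comp he h
  simp only [map_rat_smul, map_pow] at this
  exact this

theorem IsLog.comp {u l : WithConv (C →ₗ[R] A)} (hl : IsLog u l) (h : D →ₗc[R] C) :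
    IsLog (precomp A h u) (precomp A h l) := by
  have := IsLocSum.comp hl h
  simp only [map_rat_smul, map_pow, map_sub, map_one] at this
  exact this

variable {F : ℕ → Submodule R C}

theorem exists_isExp (hF : IsCoalgebraFiltration F) {f : WithConv (C →ₗ[R] A)}
    (hf : ∀ x ∈ F 0, f x = 0) : ∃ e, IsExp f e :=
  exists_isLocSum fun x => (finite_pow_apply_ne_zero hF hf x).subset fun k hk hk' => hk <| by
    change ((k.factorial : ℚ)⁻¹) • (f ^ k) x = 0
    rw [hk', smul_zero]

theorem exists_isLog (hF : IsCoalgebraFiltration F)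
    {u : WithConv (C →ₗ[R] A)} (hu : ∀ x ∈ F 0, (u - 1) x = 0) :
    ∃ l, IsLog u l :=
  exists_isLocSum fun x => ((finite_pow_apply_ne_zero hF hu x).preimage
    (Nat.succ_injective.injOn)).subset fun k hk hk' => hk <| by
    change ((-1 : ℚ) ^ ((k + 1) + 1) / ((k + 1 : ℕ) : ℚ)) • ((u - 1) ^ (k + 1)) x = 0
    rw [show ((u - 1) ^ (k + 1)) x = 0 from hk', smul_zero]

/-- Modulo the `n`-th ideal, the exponential series is the exponential of a nilpotent element. -/
theorem IsExp.mk_eq (hF : IsCoalgebraFiltration F) {f e : WithConv (C →ₗ[R] A)}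
    (he : IsExp f e) (hf : ∀ x ∈ F 0, f x = 0) (n : ℕ) : Ideal.Quotient.mk (vanishing A hF n) e =
      IsNilpotent.exp (Ideal.Quotient.mk (vanishing A hF n) f) := by
  rw [IsNilpotent.exp_eq_sum (k := n + 1), IsLocSum.mk_eq hF he (N := n + 1)]
  · simp only [map_rat_smul, map_pow]
  · intro k hk x hx
    change ((k.factorial : ℚ)⁻¹) • (f ^ k) x = 0
    rw [pow_mem_vanishing hF hf hk x hx, smul_zero]
  · rw [← map_pow]
    exact Ideal.Quotient.eq_zero_iff_mem.2 (pow_mem_vanishing hF hf n.lt_succ_self)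

/-- Modulo the `n`-th ideal, the logarithmic series is the logarithm of a unipotent element. -/
theorem IsLog.mk_eq (hF : IsCoalgebraFiltration F) {u l : WithConv (C →ₗ[R] A)} (hl : IsLog u l)
    (hu : ∀ x ∈ F 0, (u - 1) x = 0) (n : ℕ) : Ideal.Quotient.mk (vanishing A hF n) l =
      NilExpLog.log (Ideal.Quotient.mk (vanishing A hF n) u) := by
  rw [NilExpLog.log_eq_sum (k := n + 1), IsLocSum.mk_eq hF hl (N := n + 1)]
  · simp only [map_rat_smul, map_pow, map_sub, map_one]
  · intro k hk x hx
    change ((-1 : ℚ) ^ ((k + 1) + 1) / ((k + 1 : ℕ) : ℚ)) • ((u - 1) ^ (k + 1)) x = 0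
    rw [pow_mem_vanishing hF hu (by omega) x hx, smul_zero]
  · rw [← map_one (Ideal.Quotient.mk (vanishing A hF n)), ← map_sub, ← map_pow]
    exact Ideal.Quotient.eq_zero_iff_mem.2 (pow_mem_vanishing hF hu n.lt_succ_self)

end Rat

end

end FilteredConv

/-! ### Characters and derivations of a filtered bialgebra -/

namespace FilteredConv

open scoped TensorProduct
open Coalgebra WithConv LinearMap

section Bialgebra

variable {R H A : Type*} [CommRing R] [Ring H] [Bialgebra R H] [CommRing A] [Algebra R A]

variable (R H) in
/-- The homomorphism `I ⊗ ε`. -/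
noncomputable def fstHom : H ⊗[R] H →ₗc[R] H :=
  (Coalgebra.TensorProduct.rid R R H : H ⊗[R] R →ₗc[R] H).comp
    (Coalgebra.TensorProduct.map (CoalgHom.id R H) (counitCoalgHom R H))

variable (R H) in
/-- The homomorphism `ε ⊗ I`. -/
noncomputable def sndHom : H ⊗[R] H →ₗc[R] H :=
  (Coalgebra.TensorProduct.lid R H : R ⊗[R] H →ₗc[R] H).comp
    (Coalgebra.TensorProduct.map (counitCoalgHom R H) (CoalgHom.id R H))

theorem fstHom_tmul (x y : H) : fstHom R H (x ⊗ₜ y) = counit (R := R) y • x := rfl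

theorem sndHom_tmul (x y : H) : sndHom R H (x ⊗ₜ y) = counit (R := R) x • y := rfl

theorem precomp_fstHom (f : WithConv (H →ₗ[R] A)) : precomp A (fstHom R H) f =
    toConv (mul' R A ∘ₗ TensorProduct.map f.ofConv (1 : WithConv (H →ₗ[R] A)).ofConv) := by
  refine WithConv.ext (TensorProduct.ext' fun x y => ?_)
  change f (fstHom R H (x ⊗ₜ y)) = f x * algebraMap R A (counit (R := R) y)
  rw [fstHom_tmul, map_smul, Algebra.smul_def, mul_comm]

theorem precomp_sndHom (f : WithConv (H →ₗ[R] A)) : precomp A (sndHom R H) f =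
    toConv (mul' R A ∘ₗ TensorProduct.map (1 : WithConv (H →ₗ[R] A)).ofConv f.ofConv) := by
  refine WithConv.ext (TensorProduct.ext' fun x y => ?_)
  change f (sndHom R H (x ⊗ₜ y)) = algebraMap R A (counit (R := R) x) * f y
  rw [sndHom_tmul, map_smul, Algebra.smul_def]

theorem mul_tensor_mul (f g h k : WithConv (H →ₗ[R] A)) :
    toConv (mul' R A ∘ₗ TensorProduct.map f.ofConv g.ofConv) *
      toConv (mul' R A ∘ₗ TensorProduct.map h.ofConv k.ofConv) =
    toConv (mul' R A ∘ₗ TensorProduct.map (f * h).ofConv (g * k).ofConv) := by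
  have h1 := algHom_comp_convMul_distrib (Algebra.TensorProduct.lmul' R (S := A))
    (toConv (TensorProduct.map f.ofConv g.ofConv)) (toConv (TensorProduct.map h.ofConv k.ofConv))
  rw [TensorProduct.map_convMul_map] at h1
  exact (WithConv.ext h1).symm

theorem precomp_fst_mul_precomp_snd_apply (f g : WithConv (H →ₗ[R] A)) (x y : H) :
    (precomp A (fstHom R H) f * precomp A (sndHom R H) g) (x ⊗ₜ y) = f x * g y := by
  rw [precomp_fstHom, precomp_sndHom, mul_tensor_mul, mul_one, one_mul]
  rfl

/-- Pullbacks from the two factors of `H ⊗ H` commute, because `A` is commutative. -/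
theorem commute_precomp_fst_snd (f g : WithConv (H →ₗ[R] A)) :
    Commute (precomp A (fstHom R H) f) (precomp A (sndHom R H) g) := by
  rw [commute_iff_eq, precomp_fstHom, precomp_sndHom, mul_tensor_mul, mul_tensor_mul]
  simp only [mul_one, one_mul]

/-- Characters are the maps whose pullback along the multiplication is the external product. -/
theorem isCharacter_iff (f : WithConv (H →ₗ[R] A)) : CoupledHopf.IsCharacter f.ofConv ↔
    f 1 = 1 ∧ precomp A (Bialgebra.mulCoalgHom R H) f =
      precomp A (fstHom R H) f * precomp A (sndHom R H) f := by
  refine ⟨fun h => ⟨h.map_one, WithConv.ext (TensorProduct.ext' fun x y => ?_)⟩,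
    fun h => ⟨h.1, fun x y => ?_⟩⟩
  · exact (h.map_mul x y).trans (precomp_fst_mul_precomp_snd_apply f f x y).symm
  · have := congrArg (fun g : WithConv (H ⊗[R] H →ₗ[R] A) => g (x ⊗ₜ y)) h.2
    exact this.trans (precomp_fst_mul_precomp_snd_apply f f x y)

/-- A derivation along the counit; the unit of the convolution ring is the counit. -/
def IsDer (f : WithConv (H →ₗ[R] A)) : Prop :=
  ∀ x y, f (x * y) = f x * (1 : WithConv (H →ₗ[R] A)) y + (1 : WithConv (H →ₗ[R] A)) x * f y

/-- Derivations are the maps that are primitive with respect to the multiplication. -/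
theorem isDer_iff (f : WithConv (H →ₗ[R] A)) : IsDer f ↔
    precomp A (Bialgebra.mulCoalgHom R H) f =
      precomp A (fstHom R H) f + precomp A (sndHom R H) f := by
  have key : ∀ x y, (precomp A (fstHom R H) f + precomp A (sndHom R H) f) (x ⊗ₜ[R] y) =
      f x * (1 : WithConv (H →ₗ[R] A)) y + (1 : WithConv (H →ₗ[R] A)) x * f y := by
    intro x y
    have h1 := precomp_fst_mul_precomp_snd_apply f 1 x y
    have h2 := precomp_fst_mul_precomp_snd_apply 1 f x y
    rw [map_one, mul_one] at h1
    rw [map_one, one_mul] at h2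
    exact congrArg₂ (· + ·) h1 h2
  refine ⟨fun h => WithConv.ext (TensorProduct.ext' fun x y => ?_), fun h x y => ?_⟩
  · exact (h x y).trans (key x y).symm
  · have := congrArg (fun g : WithConv (H ⊗[R] H →ₗ[R] A) => g (x ⊗ₜ y)) h
    exact this.trans (key x y)

theorem convMul_apply_one (f g : WithConv (H →ₗ[R] A)) : (f * g) 1 = f 1 * g 1 := by
  change mul' R A (TensorProduct.map f.ofConv g.ofConv (comul (R := R) (1 : H))) = _
  rw [Bialgebra.comul_one]
  rfl

theorem convOne_apply_one : (1 : WithConv (H →ₗ[R] A)) 1 = 1 := by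
  change algebraMap R A (counit (R := R) (1 : H)) = 1
  rw [Bialgebra.counit_one, map_one]

theorem isCharacter_one : CoupledHopf.IsCharacter (1 : WithConv (H →ₗ[R] A)).ofConv := by
  refine (isCharacter_iff 1).2 ⟨convOne_apply_one, ?_⟩
  simp only [map_one, mul_one]

theorem isCharacter_mul {f g : WithConv (H →ₗ[R] A)} (hf : CoupledHopf.IsCharacter f.ofConv)
    (hg : CoupledHopf.IsCharacter g.ofConv) : CoupledHopf.IsCharacter (f * g).ofConv := by
  rw [isCharacter_iff] at hf hg ⊢
  refine ⟨by rw [convMul_apply_one, hf.1, hg.1, one_mul], ?_⟩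
  rw [map_mul, map_mul, map_mul, hf.2, hg.2]
  exact (commute_precomp_fst_snd g f).symm.mul_mul_mul_comm _ _

/-- The convolution inverse of a character is a character: its pullback along the multiplication
and its external square are both inverse to the pullback of the character. -/
theorem isCharacter_of_mul_eq_one {f s : WithConv (H →ₗ[R] A)}
    (hf : CoupledHopf.IsCharacter f.ofConv) (h1 : s * f = 1) (h2 : f * s = 1) :
    CoupledHopf.IsCharacter s.ofConv := by
  rw [isCharacter_iff] at hf ⊢
  constructor
  · have := convMul_apply_one s f
    rwa [h1, convOne_apply_one, hf.1, mul_one, eq_comm] at this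
  · refine left_inv_eq_right_inv (a := precomp A (Bialgebra.mulCoalgHom R H) f) ?_ ?_
    · rw [← map_mul, h1, map_one]
    · rw [hf.2, (commute_precomp_fst_snd s f).symm.mul_mul_mul_comm, ← map_mul, ← map_mul, h2,
        map_one, map_one, one_mul]

theorem IsDer.apply_one {f : WithConv (H →ₗ[R] A)} (hf : IsDer f) : f 1 = 0 := by
  have := hf 1 1
  rw [convOne_apply_one, mul_one, mul_one, one_mul] at this
  exact left_eq_add.1 this

/-- Derivations are closed under the commutator: the mixed terms commute and cancel. -/
theorem isDer_bracket {f g : WithConv (H →ₗ[R] A)} (hf : IsDer f) (hg : IsDer g) :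
    IsDer (f * g - g * f) := by
  rw [isDer_iff] at hf hg ⊢
  have h1 := (commute_precomp_fst_snd f g).eq
  have h2 := (commute_precomp_fst_snd g f).eq
  simp only [map_sub, map_mul, hf, hg, mul_add, add_mul, h1, h2]
  abel

section Filtered

variable {F : ℕ → Submodule R H}

theorem apply_eq_zero_of_connected (h0 : F 0 ≤ 1) {f : WithConv (H →ₗ[R] A)} (hf : f 1 = 0) :
    ∀ x ∈ F 0, f x = 0 := by
  intro x hx
  obtain ⟨r, rfl⟩ := Submodule.mem_one.1 (h0 hx)
  rw [Algebra.algebraMap_eq_smul_one, map_smul, hf, smul_zero]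

theorem tensor_apply_eq_zero_of_connected (h0 : F 0 ≤ 1) {f : WithConv (H ⊗[R] H →ₗ[R] A)}
    (hf : f (1 ⊗ₜ 1) = 0) : ∀ x ∈ tensorFiltration F F 0, f x = 0 := by
  suffices h : tensorFiltration F F 0 ≤ LinearMap.ker f.ofConv from fun x hx => h hx
  refine tensorFiltration_le.2 fun p q hpq x hx y hy => ?_
  obtain ⟨rfl, rfl⟩ : p = 0 ∧ q = 0 := by omega
  obtain ⟨r, rfl⟩ := Submodule.mem_one.1 (h0 hx)
  obtain ⟨s, rfl⟩ := Submodule.mem_one.1 (h0 hy)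
  rw [LinearMap.mem_ker, Algebra.algebraMap_eq_smul_one, Algebra.algebraMap_eq_smul_one,
    TensorProduct.smul_tmul_smul, map_smul, hf, smul_zero]

theorem precomp_tmul_one (h : H ⊗[R] H →ₗc[R] H) (hh : h (1 ⊗ₜ 1) = 1)
    (f : WithConv (H →ₗ[R] A)) : precomp A h f (1 ⊗ₜ 1) = f 1 := by
  rw [precomp_apply, hh]

theorem fstHom_one : fstHom R H (1 ⊗ₜ 1) = 1 := by
  rw [fstHom_tmul, Bialgebra.counit_one, one_smul]

theorem sndHom_one : sndHom R H (1 ⊗ₜ 1) = 1 := by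
  rw [sndHom_tmul, Bialgebra.counit_one, one_smul]

theorem mulHom_one : Bialgebra.mulCoalgHom R H (1 ⊗ₜ 1) = 1 := mul_one (1 : H)

theorem sub_one_apply_eq_zero (h0 : F 0 ≤ 1) {u : WithConv (H →ₗ[R] A)} (hu : u 1 = 1) :
    ∀ x ∈ F 0, (u - 1) x = 0 := by
  refine apply_eq_zero_of_connected h0 ?_
  change u 1 - (1 : WithConv (H →ₗ[R] A)) 1 = 0
  rw [hu, convOne_apply_one, sub_self]

variable [Algebra ℚ A]

theorem IsExp.comp_mk_eq (hF : IsCoalgebraFiltration F) (h0 : F 0 ≤ 1)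
    (h : H ⊗[R] H →ₗc[R] H) (hh : h (1 ⊗ₜ 1) = 1)
    {f e : WithConv (H →ₗ[R] A)} (hf : f 1 = 0) (he : IsExp f e) (n : ℕ) :
    IsNilpotent (Ideal.Quotient.mk (vanishing A (hF.tensor hF) n) (precomp A h f)) ∧
    Ideal.Quotient.mk (vanishing A (hF.tensor hF) n) (precomp A h e) =
      IsNilpotent.exp (Ideal.Quotient.mk (vanishing A (hF.tensor hF) n) (precomp A h f)) := by
  have h1 := tensor_apply_eq_zero_of_connected h0 ((precomp_tmul_one h hh f).trans hf)
  exact ⟨isNilpotent_mk _ h1 n, (he.comp h).mk_eq _ h1 n⟩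

theorem IsLog.comp_mk_eq (hF : IsCoalgebraFiltration F) (h0 : F 0 ≤ 1)
    (h : H ⊗[R] H →ₗc[R] H) (hh : h (1 ⊗ₜ 1) = 1)
    {u l : WithConv (H →ₗ[R] A)} (hu : u 1 = 1) (hl : IsLog u l) (n : ℕ) :
    IsNilpotent (Ideal.Quotient.mk (vanishing A (hF.tensor hF) n) (precomp A h u) - 1) ∧
    Ideal.Quotient.mk (vanishing A (hF.tensor hF) n) (precomp A h l) =
      NilExpLog.log (Ideal.Quotient.mk (vanishing A (hF.tensor hF) n) (precomp A h u)) := by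
  have h1 : ∀ x ∈ tensorFiltration F F 0, (precomp A h u - 1) x = 0 := by
    rw [← map_one (precomp A h), ← map_sub]
    refine tensor_apply_eq_zero_of_connected h0 ((precomp_tmul_one h hh _).trans ?_)
    change u 1 - (1 : WithConv (H →ₗ[R] A)) 1 = 0
    rw [hu, convOne_apply_one, sub_self]
  refine ⟨?_, (hl.comp h).mk_eq _ h1 n⟩
  rw [← map_one (Ideal.Quotient.mk _), ← map_sub]
  exact isNilpotent_mk _ h1 n

/-- The exponential of a derivation is a character: it turns the sum of commuting pullbacks into
a product. -/
theorem IsExp.isCharacter (hF : IsCoalgebraFiltration F) (h0 : F 0 ≤ 1)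
    {f e : WithConv (H →ₗ[R] A)} (hf : IsDer f) (he : IsExp f e) :
    CoupledHopf.IsCharacter e.ofConv := by
  have hf1 := hf.apply_one
  rw [isCharacter_iff]
  constructor
  · have h1 : ∀ k, (((k.factorial : ℚ)⁻¹) • f ^ k) 1 = if k = 0 then (1 : A) else 0 := by
      intro k
      change ((k.factorial : ℚ)⁻¹) • (f ^ k) 1 = _
      rcases k with - | k
      · rw [pow_zero, convOne_apply_one]
        simp
      · rw [pow_succ', convMul_apply_one, hf1]
        simp
    rw [IsLocSum.eq he]
    simp only [h1]
    rw [finsum_eq_single _ 0 fun k hk => if_neg hk, if_pos rfl]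
  · refine ext_of_mk (hF.tensor hF) fun n => ?_
    obtain ⟨-, e0⟩ := he.comp_mk_eq hF h0 _ mulHom_one hf1 n
    obtain ⟨n1, e1⟩ := he.comp_mk_eq hF h0 _ fstHom_one hf1 n
    obtain ⟨n2, e2⟩ := he.comp_mk_eq hF h0 _ sndHom_one hf1 n
    rw [map_mul, e0, e1, e2, (isDer_iff f).1 hf, map_add]
    exact IsNilpotent.exp_add_of_commute ((commute_precomp_fst_snd f f).map _) n1 n2

/-- The logarithm of a character is a derivation: it turns the product of commuting pullbacks into
a sum. -/
theorem IsLog.isDer (hF : IsCoalgebraFiltration F) (h0 : F 0 ≤ 1)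
    {u l : WithConv (H →ₗ[R] A)} (hu : CoupledHopf.IsCharacter u.ofConv) (hl : IsLog u l) :
    IsDer l := by
  rw [isDer_iff]
  refine ext_of_mk (hF.tensor hF) fun n => ?_
  obtain ⟨-, e0⟩ := hl.comp_mk_eq hF h0 _ mulHom_one hu.map_one n
  obtain ⟨n1, e1⟩ := hl.comp_mk_eq hF h0 _ fstHom_one hu.map_one n
  obtain ⟨n2, e2⟩ := hl.comp_mk_eq hF h0 _ sndHom_one hu.map_one n
  rw [map_add, e0, e1, e2, ((isCharacter_iff u).1 hu).2, map_mul]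
  exact NilExpLog.log_mul_of_commute n1 n2 ((commute_precomp_fst_snd u u).map _)

theorem IsExp.eq_of_isLog (hF : IsCoalgebraFiltration F) (h0 : F 0 ≤ 1)
    {f e l : WithConv (H →ₗ[R] A)} (hf : f 1 = 0) (he1 : e 1 = 1) (he : IsExp f e)
    (hl : IsLog e l) : l = f := by
  refine ext_of_mk hF fun n => ?_
  have h1 := apply_eq_zero_of_connected h0 hf
  rw [hl.mk_eq hF (sub_one_apply_eq_zero h0 he1), he.mk_eq hF h1,
    NilExpLog.log_exp (isNilpotent_mk hF h1 n)]

theorem IsLog.eq_of_isExp (hF : IsCoalgebraFiltration F) (h0 : F 0 ≤ 1)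
    {u e l : WithConv (H →ₗ[R] A)} (hu : u 1 = 1) (hl1 : l 1 = 0) (hl : IsLog u l)
    (he : IsExp l e) : e = u := by
  refine ext_of_mk hF fun n => ?_
  have h1 := sub_one_apply_eq_zero h0 hu
  have h2 := isNilpotent_mk hF h1 n
  rw [map_sub, map_one] at h2
  rw [he.mk_eq hF (apply_eq_zero_of_connected h0 hl1), hl.mk_eq hF h1, NilExpLog.exp_log h2]

end Filtered

end Bialgebra

end FilteredConv

/-! ### Coupled bialgebras -/

namespace CoupledHopf

open scoped TensorProduct
open WithConv FilteredConv

variable {R H V₂ V₃ : Type*} [CommRing R] [Ring H] [Algebra R H]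
  [Ring V₂] [Algebra R V₂] [AddCommGroup V₃] [Module R V₃]
  {B : CoupledBialgebra R H V₂ V₃}

/-- The couplings turn a coupled bialgebra into a bialgebra with the comultiplication `P ∘ Δ`. -/
noncomputable abbrev CouplingSystem.bialgebra (K : CouplingSystem B) : Bialgebra R H :=
  Bialgebra.ofAlgHom (K.P.comp B.comul) B.counit
    (by
      ext x
      have e1 : ∀ z : H ⊗[R] H, Algebra.TensorProduct.map (K.P.comp B.comul) (AlgHom.id R H) z =
          TensorProduct.map K.P.toLinearMap LinearMap.id
            (TensorProduct.map B.comul.toLinearMap LinearMap.id z) := by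
        intro z
        rw [TensorProduct.map_map]
        rfl
      have e2 : ∀ z : H ⊗[R] H, Algebra.TensorProduct.map (AlgHom.id R H) (K.P.comp B.comul) z =
          TensorProduct.map LinearMap.id K.P.toLinearMap
            (TensorProduct.map LinearMap.id B.comul.toLinearMap z) := by
        intro z
        rw [TensorProduct.map_map]
        rfl
      change TensorProduct.assoc R H H H (Algebra.TensorProduct.map (K.P.comp B.comul)
          (AlgHom.id R H) (K.P (B.comul x))) =
        Algebra.TensorProduct.map (AlgHom.id R H) (K.P.comp B.comul) (K.P (B.comul x))
      rw [e1, e2, ← K.P₂₁_comulId, ← K.P₁₂_idComul, K.coherence, B.coassoc])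
    (by
      ext x
      refine (TensorProduct.lid R H).injective ?_
      change TensorProduct.lid R H (TensorProduct.map B.counit.toLinearMap LinearMap.id
        (K.P (B.comul x))) = TensorProduct.lid R H ((TensorProduct.lid R H).symm x)
      rw [← K.counitId_eq, B.counitId_comul, LinearEquiv.apply_symm_apply])
    (by
      ext x
      refine (TensorProduct.rid R H).injective ?_
      change TensorProduct.rid R H (TensorProduct.map LinearMap.id B.counit.toLinearMap
        (K.P (B.comul x))) = TensorProduct.rid R H ((TensorProduct.rid R H).symm x)
      rw [← K.idCounit_eq, B.idCounit_comul, LinearEquiv.apply_symm_apply])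

variable {A : Type*} [CommRing A] [Algebra R A]

theorem toConv_unit (K : CouplingSystem B) :
    letI := K.bialgebra; toConv (unit B A) = 1 := rfl

theorem toConv_convPow (K : CouplingSystem B) (f : H →ₗ[R] A) (n : ℕ) :
    letI := K.bialgebra; toConv (convPow K f n) = toConv f ^ n := by
  let := K.bialgebra
  induction n with
  | zero => exact (pow_zero _).symm
  | succ n ih => rw [pow_succ', ← ih]; rfl

/-- The filtration by degree: the `n`-th step is the sum of the `𝓗 i` with `deg i ≤ n`. -/
def degFiltration {ι : Type*} [AddMonoid ι] (deg : ι →+ ℕ) (𝓗 : ι → Submodule R H) (n : ℕ) :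
    Submodule R H := ⨆ i, ⨆ _ : deg i ≤ n, 𝓗 i

section Graded

variable {K : CouplingSystem B} {ι : Type*} [AddMonoid ι] {deg : ι →+ ℕ}
  {𝓗 : ι → Submodule R H} {𝓥 : ι → ι → Submodule R V₂}

theorem mem_degFiltration {i : ι} {n : ℕ} (h : deg i ≤ n) {x : H} (hx : x ∈ 𝓗 i) :
    x ∈ degFiltration deg 𝓗 n :=
  (le_iSup₂ (f := fun i (_ : deg i ≤ n) => 𝓗 i) i h) hx

theorem degFiltration_monotone : Monotone (degFiltration deg 𝓗) := fun _ _ hmn =>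
  iSup₂_le fun _ hi _ hx => mem_degFiltration (hi.trans hmn) hx

/-- The comultiplication `P ∘ Δ` is compatible with the filtration by degree, because `Δ` and `P`
respect the submodules `𝓥 j k`. -/
theorem IsGradedConnected.isCoalgebraFiltration [DecidableEq ι] [GradedAlgebra 𝓗]
    (hK : IsGradedConnected K deg 𝓗 𝓥) :
    letI := K.bialgebra; IsCoalgebraFiltration (degFiltration deg 𝓗) :=
  let := K.bialgebra
  { mono := degFiltration_monotone
    exhaust := fun x => by
      classical
      -- The sum of the degrees of the homogeneous components bounds each of them.
      refine ⟨∑ i ∈ (DirectSum.decompose 𝓗 x).support, deg i, ?_⟩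
      rw [← DirectSum.sum_support_decompose 𝓗 x]
      refine Submodule.sum_mem _ fun i hi => mem_degFiltration ?_ (SetLike.coe_mem _)
      rw [DirectSum.sum_support_decompose 𝓗 x]
      exact Finset.single_le_sum (f := fun i => deg i) (fun _ _ => Nat.zero_le _) hi
    comul_mem := fun n x hx => by
      suffices h : degFiltration deg 𝓗 n ≤ Submodule.comap (K.P.toLinearMap ∘ₗ
          B.comul.toLinearMap) (tensorFiltration (degFiltration deg 𝓗) (degFiltration deg 𝓗) n)
        from h hx
      refine iSup₂_le fun i hi x hx => tensorFiltration_monotone degFiltration_monotone hi ?_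
      have h2 : (⨆ p : ι × ι, ⨆ _ : p.1 + p.2 = i, 𝓥 p.1 p.2) ≤ Submodule.comap K.P.toLinearMap
          (tensorFiltration (degFiltration deg 𝓗) (degFiltration deg 𝓗) (deg i)) := by
        refine iSup₂_le fun p hp v hv => ?_
        obtain ⟨z, hz⟩ := hK.P_mem p.1 p.2 v hv
        rw [Submodule.mem_comap]
        change K.P v ∈ _
        rw [← hz]
        clear hz
        induction z with
        | zero => rw [map_zero]; exact zero_mem _
        | tmul x y =>
          exact tmul_mem_tensorFiltration (by rw [← hp, map_add]) (mem_degFiltration le_rfl x.2)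
            (mem_degFiltration le_rfl y.2)
        | add x y hx hy => rw [map_add]; exact add_mem hx hy
      exact h2 (hK.comul_mem i x hx) }

/-- The filtration is connected: elements of degree `0` are multiples of the unit. -/
theorem IsGradedConnected.degFiltration_zero (hK : IsGradedConnected K deg 𝓗 𝓥) :
    degFiltration deg 𝓗 0 ≤ 1 := by
  refine iSup₂_le fun i hi => ?_
  rw [hK.deg_pos i (Nat.le_zero.1 hi), hK.connected]

end Graded

section Bogoliubov

variable (K : CouplingSystem B)

theorem tensorMap_ζ (f g : H →ₗ[R] A) (x y : H) : tensorMap K f g (B.t₂.ζ x y) = f x * g y := by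
  change LinearMap.mul' R A (TensorProduct.map f g (K.P.toLinearMap (B.t₂.ζ x y))) = _
  rw [K.P_coupling x y]
  rfl

theorem tensorMap_reducedComul (f g : H →ₗ[R] A) (x : H) :
    tensorMap K f g (reducedComul B x) = conv K f g x - f 1 * g x - f x * g 1 := by
  rw [reducedComul, map_sub, map_sub, tensorMap_ζ, tensorMap_ζ]
  rfl

theorem conv_apply_one (f g : H →ₗ[R] A) : conv K f g 1 = f 1 * g 1 := by
  rw [← tensorMap_ζ K, B.ζ_one, ← map_one B.comul]
  rfl

theorem unit_apply (x : H) : unit B A x = algebraMap R A (B.counit x) := rfl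

/-- A linear map is determined by its values at `1` and on the augmentation ideal. -/
theorem eq_unit_of_ker {h : H →ₗ[R] A} (h1 : h 1 = 1) (h2 : ∀ x, B.counit x = 0 → h x = 0) :
    h = unit B A := by
  ext x
  have h3 := h2 (x - algebraMap R H (B.counit x)) (by
    rw [map_sub, AlgHom.commutes, Algebra.algebraMap_self_apply, sub_self])
  rw [map_sub, Algebra.algebraMap_eq_smul_one, map_smul, h1, sub_eq_zero] at h3
  rw [h3, unit_apply, Algebra.algebraMap_eq_smul_one]

/-- The left recursion says that `s` is a left convolution inverse. -/
theorem bogoliubovLeft_iff {f : H →ₗ[R] A} (hf : f 1 = 1) (s : H →ₗ[R] A) :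
    BogoliubovLeft K f s ↔ conv K s f = unit B A := by
  constructor
  · rintro ⟨h1, h2⟩
    refine eq_unit_of_ker (by rw [conv_apply_one, h1, hf, mul_one]) fun x hx => ?_
    have := h2 x hx
    rw [tensorMap_reducedComul, hf, h1] at this
    linear_combination this
  · intro h
    have h1 : s 1 = 1 := by
      have := conv_apply_one K s f
      rwa [h, hf, unit_apply, map_one, map_one, mul_one, eq_comm] at this
    refine ⟨h1, fun x hx => ?_⟩
    rw [tensorMap_reducedComul, h, hf, h1, unit_apply, hx, map_zero]
    ring

/-- The right recursion says that `s` is a right convolution inverse. -/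
theorem bogoliubovRight_iff {f : H →ₗ[R] A} (hf : f 1 = 1) (s : H →ₗ[R] A) :
    BogoliubovRight K f s ↔ conv K f s = unit B A := by
  constructor
  · rintro ⟨h1, h2⟩
    refine eq_unit_of_ker (by rw [conv_apply_one, h1, hf, mul_one]) fun x hx => ?_
    have := h2 x hx
    rw [tensorMap_reducedComul, hf, h1] at this
    linear_combination this
  · intro h
    have h1 : s 1 = 1 := by
      have := conv_apply_one K f s
      rwa [h, hf, unit_apply, map_one, map_one, one_mul, eq_comm] at this
    refine ⟨h1, fun x hx => ?_⟩
    rw [tensorMap_reducedComul, h, hf, h1, unit_apply, hx, map_zero]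
    ring

end Bogoliubov

section Main

variable {K : CouplingSystem B} {ι : Type*} [AddMonoid ι] [DecidableEq ι] {deg : ι →+ ℕ}
  {𝓗 : ι → Submodule R H} [GradedAlgebra 𝓗] {𝓥 : ι → ι → Submodule R V₂}

theorem IsGradedConnected.finite_convPow (hK : IsGradedConnected K deg 𝓗 𝓥) {f : H →ₗ[R] A}
    (hf : f 1 = 0) (x : H) : {n | convPow K f n x ≠ 0}.Finite := by
  let := K.bialgebra
  have h := finite_pow_apply_ne_zero hK.isCoalgebraFiltration
    (apply_eq_zero_of_connected hK.degFiltration_zero (f := toConv f) hf) x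
  simp only [← toConv_convPow] at h
  exact h

theorem unit_sub_apply_one {f : H →ₗ[R] A} (hf : f 1 = 1) : (unit B A - f) 1 = 0 := by
  rw [LinearMap.sub_apply, hf, unit_apply, map_one, map_one, sub_self]

theorem sub_unit_apply_one {f : H →ₗ[R] A} (hf : f 1 = 1) : (f - unit B A) 1 = 0 := by
  rw [LinearMap.sub_apply, hf, unit_apply, map_one, map_one, sub_self]

/-- The geometric series of a character is its convolution inverse and a character. -/
theorem IsGradedConnected.exists_inverse (hK : IsGradedConnected K deg 𝓗 𝓥) {f : H →ₗ[R] A}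
    (hf : IsCharacter f) : ∃ s : H →ₗ[R] A, IsCharacter s ∧ (∀ x, s x = antipode K f x) ∧
      conv K s f = unit B A ∧ conv K f s = unit B A := by
  let := K.bialgebra
  have h0 : ∀ x ∈ degFiltration deg 𝓗 0, ((1 : WithConv (H →ₗ[R] A)) - toConv f) x = 0 :=
    apply_eq_zero_of_connected hK.degFiltration_zero (unit_sub_apply_one (B := B) hf.map_one)
  obtain ⟨s, hs⟩ := exists_isLocSum (g := fun k => ((1 : WithConv (H →ₗ[R] A)) - toConv f) ^ k)
    (finite_pow_apply_ne_zero hK.isCoalgebraFiltration h0)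
  obtain ⟨h1, h2⟩ := hs.geom_inverse hK.isCoalgebraFiltration h0
  refine ⟨s.ofConv, isCharacter_of_mul_eq_one (f := toConv f) hf h1 h2, fun x => ?_,
    congrArg ofConv h1, congrArg ofConv h2⟩
  refine (hs.eq x).trans (finsum_congr fun n => ?_)
  have := toConv_convPow K (unit B A - f) n
  exact (congrArg (fun g : WithConv (H →ₗ[R] A) => g x) this).symm

theorem isCharacter_unit (K : CouplingSystem B) : IsCharacter (unit B A) := by
  let := K.bialgebra
  exact FilteredConv.isCharacter_one (R := R) (H := H) (A := A)

theorem IsCharacter.conv (K : CouplingSystem B) {f g : H →ₗ[R] A} (hf : IsCharacter f)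
    (hg : IsCharacter g) : IsCharacter (conv K f g) := by
  let := K.bialgebra
  exact isCharacter_mul (f := toConv f) (g := toConv g) hf hg

theorem conv_assoc (K : CouplingSystem B) (f g h : H →ₗ[R] A) :
    conv K (conv K f g) h = conv K f (conv K g h) := by
  let := K.bialgebra
  exact congrArg ofConv (mul_assoc (toConv f) (toConv g) (toConv h))

theorem unit_conv (K : CouplingSystem B) (f : H →ₗ[R] A) : conv K (unit B A) f = f := by
  let := K.bialgebra
  exact congrArg ofConv (one_mul (toConv f))

theorem conv_unit (K : CouplingSystem B) (f : H →ₗ[R] A) : conv K f (unit B A) = f := by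
  let := K.bialgebra
  exact congrArg ofConv (mul_one (toConv f))

theorem IsGradedConnected.exists_group (hK : IsGradedConnected K deg 𝓗 𝓥) :
    ∃ _ : Group (Characters R H A),
      (∀ f g : Characters R H A, (f * g).1 = conv K f.1 g.1) ∧
      (1 : Characters R H A).1 = unit B A ∧
      ∀ f : Characters R H A, ∀ x : H, (f⁻¹).1 x = antipode K f.1 x := by
  choose inv h1 h2 h3 h4 using fun f : Characters R H A => hK.exists_inverse f.2
  let : Mul (Characters R H A) := ⟨fun f g => ⟨conv K f.1 g.1, f.2.conv K g.2⟩⟩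
  let : One (Characters R H A) := ⟨⟨unit B A, isCharacter_unit K⟩⟩
  let : Inv (Characters R H A) := ⟨fun f => ⟨inv f, h1 f⟩⟩
  exact ⟨Group.ofLeftAxioms (fun f g h => Subtype.ext (conv_assoc K _ _ _))
    (fun f => Subtype.ext (unit_conv K _)) (fun f => Subtype.ext (h3 f)),
    fun _ _ => rfl, rfl, h2⟩

theorem IsGradedConnected.bogoliubov (hK : IsGradedConnected K deg 𝓗 𝓥) {f : H →ₗ[R] A}
    (hf : IsCharacter f) (s : H →ₗ[R] A) :
    (BogoliubovLeft K f s ↔ ∀ x, s x = antipode K f x) ∧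
      (BogoliubovRight K f s ↔ ∀ x, s x = antipode K f x) := by
  obtain ⟨t, -, ht, h1, h2⟩ := hK.exists_inverse hf
  rw [bogoliubovLeft_iff K hf.map_one, bogoliubovRight_iff K hf.map_one]
  have e : (∀ x, s x = antipode K f x) ↔ s = t := by
    simp only [← ht, LinearMap.ext_iff]
  rw [e]
  refine ⟨⟨fun h => ?_, fun h => h ▸ h1⟩, ⟨fun h => ?_, fun h => h ▸ h2⟩⟩
  · rw [← conv_unit K s, ← h2, ← conv_assoc, h, unit_conv]
  · rw [← unit_conv K s, ← h1, conv_assoc, h, conv_unit]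

/-- The commutator bracket of two derivations. -/
noncomputable def derivationBracket (K : CouplingSystem B) :
    Derivations B A →ₗ[R] Derivations B A →ₗ[R] Derivations B A :=
  letI := K.bialgebra
  LinearMap.mk₂ R
    (fun f g => ⟨conv K f.1 g.1 - conv K g.1 f.1,
      isDer_bracket (f := toConv f.1) (g := toConv g.1) f.2 g.2⟩)
    (fun f f' g => Subtype.ext <| congrArg ofConv (show
      (toConv f.1 + toConv f'.1) * toConv g.1 - toConv g.1 * (toConv f.1 + toConv f'.1) =
        toConv f.1 * toConv g.1 - toConv g.1 * toConv f.1 +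
          (toConv f'.1 * toConv g.1 - toConv g.1 * toConv f'.1) by noncomm_ring))
    (fun c f g => Subtype.ext <| congrArg ofConv (show
      (c • toConv f.1) * toConv g.1 - toConv g.1 * (c • toConv f.1) =
        c • (toConv f.1 * toConv g.1 - toConv g.1 * toConv f.1) by
      rw [smul_mul_assoc, mul_smul_comm, smul_sub]))
    (fun f g g' => Subtype.ext <| congrArg ofConv (show
      toConv f.1 * (toConv g.1 + toConv g'.1) - (toConv g.1 + toConv g'.1) * toConv f.1 =
        toConv f.1 * toConv g.1 - toConv g.1 * toConv f.1 +
          (toConv f.1 * toConv g'.1 - toConv g'.1 * toConv f.1) by noncomm_ring))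
    (fun c f g => Subtype.ext <| congrArg ofConv (show
      toConv f.1 * (c • toConv g.1) - (c • toConv g.1) * toConv f.1 =
        c • (toConv f.1 * toConv g.1 - toConv g.1 * toConv f.1) by
      rw [smul_mul_assoc, mul_smul_comm, smul_sub]))

theorem derivationBracket_jacobi (K : CouplingSystem B) (f g h : Derivations B A) :
    derivationBracket K f (derivationBracket K g h) =
      derivationBracket K (derivationBracket K f g) h +
        derivationBracket K g (derivationBracket K f h) := by
  let := K.bialgebra
  have key : ∀ a b c : WithConv (H →ₗ[R] A), a * (b * c - c * b) - (b * c - c * b) * a =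
      ((a * b - b * a) * c - c * (a * b - b * a)) +
        (b * (a * c - c * a) - (a * c - c * a) * b) := fun a b c => by
    simp only [mul_sub, sub_mul, mul_assoc]
    abel
  exact Subtype.ext (congrArg ofConv (key (toConv f.1) (toConv g.1) (toConv h.1)))

theorem apply_one_of_mem_derivations (K : CouplingSystem B) {f : H →ₗ[R] A}
    (hf : f ∈ Derivations B A) : f 1 = 0 := by
  let := K.bialgebra
  exact IsDer.apply_one (f := toConv f) hf

section Rat

variable [Algebra ℚ A]

theorem IsGradedConnected.exists_exp (hK : IsGradedConnected K deg 𝓗 𝓥) {f : H →ₗ[R] A}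
    (hf : f ∈ Derivations B A) : letI := K.bialgebra; ∃ e : H →ₗ[R] A, IsCharacter e ∧
      (∀ x, e x = convExp K f x) ∧ IsExp (toConv f) (toConv e) := by
  let := K.bialgebra
  obtain ⟨e, he⟩ := exists_isExp hK.isCoalgebraFiltration (f := toConv f)
    (apply_eq_zero_of_connected hK.degFiltration_zero (apply_one_of_mem_derivations K hf))
  refine ⟨e.ofConv, he.isCharacter hK.isCoalgebraFiltration hK.degFiltration_zero hf,
    fun x => ?_, he⟩
  refine (IsLocSum.eq he x).trans (finsum_congr fun n => ?_)
  rw [← toConv_convPow]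
  rfl

theorem IsGradedConnected.exists_log (hK : IsGradedConnected K deg 𝓗 𝓥) {u : H →ₗ[R] A}
    (hu : IsCharacter u) : letI := K.bialgebra; ∃ l : H →ₗ[R] A, l ∈ Derivations B A ∧
      (∀ x, l x = convLog K u x) ∧ IsLog (toConv u) (toConv l) := by
  let := K.bialgebra
  obtain ⟨l, hl⟩ := exists_isLog hK.isCoalgebraFiltration (u := toConv u)
    (sub_one_apply_eq_zero hK.degFiltration_zero hu.map_one)
  refine ⟨l.ofConv, hl.isDer hK.isCoalgebraFiltration hK.degFiltration_zero hu,
    fun x => ?_, hl⟩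
  refine (IsLocSum.eq hl x).trans (finsum_congr fun n => ?_)
  rw [← toConv_unit K, ← toConv_sub, ← toConv_convPow]
  rfl

theorem IsGradedConnected.exists_exp_equiv (hK : IsGradedConnected K deg 𝓗 𝓥) :
    ∃ E : Derivations B A ≃ Characters R H A,
      (∀ f x, (E f).1 x = convExp K f.1 x) ∧ ∀ F x, (E.symm F).1 x = convLog K F.1 x := by
  let := K.bialgebra
  choose e h1 h2 h3 using fun f : Derivations B A => hK.exists_exp f.2
  choose l k1 k2 k3 using fun u : Characters R H A => hK.exists_log u.2
  refine ⟨⟨fun f => ⟨e f, h1 f⟩, fun u => ⟨l u, k1 u⟩, fun f => Subtype.ext ?_,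
    fun u => Subtype.ext ?_⟩, h2, k2⟩
  · exact congrArg ofConv ((h3 f).eq_of_isLog hK.isCoalgebraFiltration hK.degFiltration_zero
      (apply_one_of_mem_derivations K f.2) (h1 f).map_one (k3 ⟨e f, h1 f⟩))
  · exact congrArg ofConv ((k3 u).eq_of_isExp hK.isCoalgebraFiltration hK.degFiltration_zero
      u.2.map_one (apply_one_of_mem_derivations K (k1 u)) (h3 ⟨l u, k1 u⟩))

end Rat

end Main

end CoupledHopf

/-! ### Restrictions of Lions forests and values of natural functionals -/

namespace LionsHopf

open MeasureTheory Relation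

section RandomVariableRing

variable {α : Type*} [MeasurableSpace α] {ν : Measure α} {A : Type*} [TopologicalSpace A]
  [CommRing A] [IsTopologicalRing A]

/-- Classes of random variables with values in a commutative topological ring form a commutative
ring; the additive group and the multiplicative monoid are those of Mathlib. -/
instance instCommRingAEEqFun : CommRing (α →ₘ[ν] A) :=
  { (inferInstance : AddCommGroup (α →ₘ[ν] A)), (inferInstance : CommMonoid (α →ₘ[ν] A)) with
    left_distrib := fun f g h => AEEqFun.induction_on₃ f g h fun f hf g hg h hh => by
      simp only [AEEqFun.mk_add_mk, AEEqFun.mk_mul_mk, mul_add]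
    right_distrib := fun f g h => AEEqFun.induction_on₃ f g h fun f hf g hg h hh => by
      simp only [AEEqFun.mk_add_mk, AEEqFun.mk_mul_mk, add_mul]
    zero_mul := fun f => AEEqFun.induction_on f fun f hf => by
      simp only [AEEqFun.zero_def, AEEqFun.mk_mul_mk]
      exact AEEqFun.mk_eq_mk.2 (Filter.Eventually.of_forall fun x => zero_mul (f x))
    mul_zero := fun f => AEEqFun.induction_on f fun f hf => by
      simp only [AEEqFun.zero_def, AEEqFun.mk_mul_mk]
      exact AEEqFun.mk_eq_mk.2 (Filter.Eventually.of_forall fun x => mul_zero (f x)) }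

instance instAlgebraAEEqFun {𝕜 : Type*} [CommRing 𝕜] [Algebra 𝕜 A] [ContinuousConstSMul 𝕜 A] :
    Algebra 𝕜 (α →ₘ[ν] A) :=
  Algebra.ofModule
    (fun c f g => AEEqFun.induction_on₂ f g fun f hf g hg => by
      simp only [AEEqFun.smul_mk, AEEqFun.mk_mul_mk, smul_mul_assoc])
    (fun c f g => AEEqFun.induction_on₂ f g fun f hf g hg => by
      simp only [AEEqFun.smul_mk, AEEqFun.mk_mul_mk, mul_smul_comm])

variable {β : Type*} [MeasurableSpace β] {ν' : Measure β}

/-- Composition with a measure preserving map, as a ring homomorphism. -/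
noncomputable def compHom (φ : α → β) (h : MeasurePreserving φ ν ν') :
    (β →ₘ[ν'] A) →+* (α →ₘ[ν] A) where
  toFun f := f.compMeasurePreserving φ h
  map_one' := rfl
  map_zero' := rfl
  map_mul' f g := AEEqFun.induction_on₂ f g fun _ _ _ _ => rfl
  map_add' f g := AEEqFun.induction_on₂ f g fun _ _ _ _ => rfl

end RandomVariableRing

namespace LionsForest

variable {d : ℕ}

/-- The composition of two embeddings. -/
def Emb.comp {T'' T' T : LionsForest d} (φ : Emb T' T) (ψ : Emb T'' T') : Emb T'' T where
  toFun := φ.toFun ∘ ψ.toFun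
  inj := φ.inj.comp ψ.inj
  h0_iff x := (φ.h0_iff _).trans (ψ.h0_iff x)
  hyp_iff x y := (φ.hyp_iff _ _).trans (ψ.hyp_iff x y)

/-- An isomorphism onto a restriction of `T`: an embedding that reflects the edges and preserves
the labels. -/
structure FullEmb (T' T : LionsForest d) extends Emb T' T where
  edge_iff : ∀ x y, T.edge (toFun x) (toFun y) ↔ T'.edge x y
  L_eq : ∀ x, T.L (toFun x) = T'.L x

namespace FullEmb

/-- The identity, as a full embedding. -/
protected def id (T : LionsForest d) : FullEmb T T where
  toFun := id
  inj := Function.injective_id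
  h0_iff _ := Iff.rfl
  hyp_iff _ _ := Iff.rfl
  edge_iff _ _ := Iff.rfl
  L_eq _ := rfl

/-- The composition of two full embeddings. -/
def comp {T'' T' T : LionsForest d} (φ : FullEmb T' T) (ψ : FullEmb T'' T') :
    FullEmb T'' T where
  toEmb := φ.toEmb.comp ψ.toEmb
  edge_iff x y := (φ.edge_iff _ _).trans (ψ.edge_iff x y)
  L_eq x := (φ.L_eq _).trans (ψ.L_eq x)

/-- The inclusion of the root of a cut. -/
def root (T : LionsForest d) (S : Set T.N) (hS : T.RootClosed S) : FullEmb (T.root S hS) T where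
  toEmb := T.rootEmb S hS
  edge_iff _ _ := Iff.rfl
  L_eq _ := rfl

/-- The inclusion of the prune of a cut. -/
def prune (T : LionsForest d) (S : Set T.N) (hS : T.RootClosed S) : FullEmb (T.prune S hS) T where
  toEmb := T.pruneEmb S hS
  edge_iff _ _ := Iff.rfl
  L_eq _ := rfl

/-- The inclusion of the left factor of a product. -/
def inl (T₁ T₂ : LionsForest d) : FullEmb T₁ (T₁.mul T₂) where
  toEmb := T₁.inlEmb T₂
  edge_iff _ _ := Iff.rfl
  L_eq _ := rfl

/-- The inclusion of the right factor of a product. -/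
def inr (T₁ T₂ : LionsForest d) : FullEmb T₂ (T₁.mul T₂) where
  toEmb := T₁.inrEmb T₂
  edge_iff _ _ := Iff.rfl
  L_eq _ := rfl

/-- The product of two embeddings. -/
def mul {I₁ I₂ T₁ T₂ : LionsForest d} (φ₁ : FullEmb I₁ T₁) (φ₂ : FullEmb I₂ T₂) :
    FullEmb (I₁.mul I₂) (T₁.mul T₂) where
  toFun := Sum.map φ₁.toFun φ₂.toFun
  inj := φ₁.inj.sumMap φ₂.inj
  h0_iff := by
    rintro (x | x)
    exacts [φ₁.h0_iff x, φ₂.h0_iff x]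
  hyp_iff := by
    rintro (x | x) (y | y)
    exacts [φ₁.hyp_iff x y, and_congr (φ₁.h0_iff x) (φ₂.h0_iff y),
      and_congr (φ₂.h0_iff x) (φ₁.h0_iff y), φ₂.hyp_iff x y]
  edge_iff := by
    rintro (x | x) (y | y)
    exacts [φ₁.edge_iff x y, Iff.rfl, Iff.rfl, φ₂.edge_iff x y]
  L_eq := by
    rintro (x | x)
    exacts [φ₁.L_eq x, φ₂.L_eq x]

variable {T T' T'' : LionsForest d}

theorem range_id : Set.range (FullEmb.id T).toFun = Set.univ := Set.range_id

theorem range_comp (φ : FullEmb T' T) (ψ : FullEmb T'' T') :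
    Set.range (φ.comp ψ).toFun = φ.toFun '' Set.range ψ.toFun :=
  Set.range_comp φ.toFun ψ.toFun

theorem range_root (S : Set T.N) (hS : T.RootClosed S) :
    Set.range (FullEmb.root T S hS).toFun = S := Subtype.range_val

theorem range_prune (S : Set T.N) (hS : T.RootClosed S) :
    Set.range (FullEmb.prune T S hS).toFun = Sᶜ := Subtype.range_val

theorem range_mul {I₁ I₂ T₁ T₂ : LionsForest d} (φ₁ : FullEmb I₁ T₁) (φ₂ : FullEmb I₂ T₂) :
    Set.range (φ₁.mul φ₂).toFun =
      Sum.inl '' Set.range φ₁.toFun ∪ Sum.inr '' Set.range φ₂.toFun := by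
  ext x
  constructor
  · rintro ⟨y | y, rfl⟩
    exacts [Or.inl ⟨_, ⟨y, rfl⟩, rfl⟩, Or.inr ⟨_, ⟨y, rfl⟩, rfl⟩]
  · rintro (⟨_, ⟨y, rfl⟩, rfl⟩ | ⟨_, ⟨y, rfl⟩, rfl⟩)
    exacts [⟨.inl y, rfl⟩, ⟨.inr y, rfl⟩]

/-- Two embeddings with the same range differ by an isomorphism. -/
theorem exists_iso_of_range_eq (φ : FullEmb T' T) (ψ : FullEmb T'' T)
    (h : Set.range φ.toFun = Set.range ψ.toFun) :
    ∃ e : Iso T' T'', ψ.toEmb.comp e.toEmb = φ.toEmb := by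
  have h1 : ∀ x, ∃ y, ψ.toFun y = φ.toFun x := fun x => by
    have : φ.toFun x ∈ Set.range ψ.toFun := h ▸ Set.mem_range_self x
    exact this
  choose e he using h1
  refine ⟨⟨⟨e, fun x y hxy => φ.inj ?_, fun x => ?_, fun x y => ?_⟩, fun y => ?_, fun x y => ?_,
    fun x => ?_⟩, ?_⟩
  · rw [← he, ← he, hxy]
  · rw [← ψ.h0_iff, he, φ.h0_iff]
  · rw [← ψ.hyp_iff, he, he, φ.hyp_iff]
  · have : ψ.toFun y ∈ Set.range φ.toFun := h ▸ Set.mem_range_self y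
    obtain ⟨x, hx⟩ := this
    exact ⟨x, ψ.inj ((he x).trans hx)⟩
  · rw [← ψ.edge_iff, he, he, φ.edge_iff]
  · rw [← ψ.L_eq, he, φ.L_eq]
  · have : ψ.toFun ∘ e = φ.toFun := funext he
    cases φ with | mk φ _ _ => cases φ; subst this; rfl

end FullEmb

/-- An isomorphism as a full embedding. -/
def Iso.toFullEmb {T' T : LionsForest d} (φ : Iso T' T) : FullEmb T' T where
  toEmb := φ.toEmb
  edge_iff := φ.edge_iff
  L_eq := φ.L_eq

/-- Two empty forests are isomorphic. -/
def Iso.ofIsEmpty (T' T : LionsForest d) [IsEmpty T'.N] [IsEmpty T.N] : Iso T' T where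
  toFun := isEmptyElim
  inj x := isEmptyElim x
  h0_iff x := isEmptyElim x
  hyp_iff x := isEmptyElim x
  surj x := isEmptyElim x
  edge_iff x := isEmptyElim x
  L_eq x := isEmptyElim x

/-- The poset of root-closed sets of nodes. -/
abbrev RootClosedSet (T : LionsForest d) : Type := {S : Set T.N // T.RootClosed S}

theorem rootClosed_univ (T : LionsForest d) : T.RootClosed Set.univ := fun _ _ _ _ => trivial

theorem rootClosed_empty (T : LionsForest d) : T.RootClosed ∅ := fun _ _ _ h => h.elim

theorem rootClosed_preimage (T : LionsForest d) (S S' : T.RootClosedSet) :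
    (T.root S.1 S.2).RootClosed ((FullEmb.root T S.1 S.2).toFun ⁻¹' S'.1) :=
  fun x y h hx => S'.2 x.1 y.1 h hx

/-- The restriction of `T` to the difference `S \ S'` of two root-closed sets, as the prune of the
root at `S`. -/
abbrev interval (T : LionsForest d) (S S' : T.RootClosedSet) : LionsForest d :=
  (T.root S.1 S.2).prune _ (T.rootClosed_preimage S S')

/-- The inclusion of `interval` into `T`. -/
def intervalEmb (T : LionsForest d) (S S' : T.RootClosedSet) : FullEmb (T.interval S S') T :=
  (FullEmb.root T S.1 S.2).comp (FullEmb.prune _ _ (T.rootClosed_preimage S S'))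

theorem range_intervalEmb (T : LionsForest d) (S S' : T.RootClosedSet) :
    Set.range (T.intervalEmb S S').toFun = S.1 \ S'.1 := by
  rw [intervalEmb, FullEmb.range_comp, FullEmb.range_prune]
  ext x
  constructor
  · rintro ⟨y, hy, rfl⟩
    exact ⟨y.2, hy⟩
  · rintro ⟨h1, h2⟩
    exact ⟨⟨x, h1⟩, h2, rfl⟩

end LionsForest

open LionsForest

section Values

variable {Ω : Type*} [MeasurableSpace Ω] {μ : Measure Ω} [IsProbabilityMeasure μ] {d : ℕ}
  {A : Type*} [TopologicalSpace A]

theorem pull_comp {T'' T' T : LionsForest d} (φ : T'.Emb T) (ψ : T''.Emb T')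
    (f : RV μ A T'') : pull φ (pull ψ f : RV μ A T') = pull (φ.comp ψ) f := by
  funext i
  refine (AEEqFun.compMeasurePreserving_comp _ _ _).symm.trans ?_
  have : ψ.sampleMap Ω ∘ φ.sampleMap Ω = (φ.comp ψ).sampleMap Ω := by
    funext ω
    refine Prod.ext rfl (funext fun k => ?_)
    induction k using Quotient.inductionOn
    rfl
  simp only [this]
  rfl

theorem pull_id {T : LionsForest d} (f : RV μ A T) : pull (FullEmb.id T).toEmb f = f := by
  funext i
  have : (FullEmb.id T).sampleMap Ω = id := by
    funext ω
    refine Prod.ext rfl (funext fun k => ?_)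
    induction k using Quotient.inductionOn
    rfl
  simp only [pull, this]
  exact AEEqFun.compMeasurePreserving_id _

theorem compMeasurePreserving_pullFree {T' T : LionsForest d} (φ : T'.Emb T) (r : Ω →ₘ[μ] A) :
    (pullFree T' r).compMeasurePreserving (φ.sampleMap Ω) (φ.measurePreserving_sampleMap μ) =
      pullFree T r :=
  (AEEqFun.compMeasurePreserving_comp _ _ _).symm

theorem pull_smul {𝕜 : Type*} [CommRing A] [CommRing 𝕜] [Algebra 𝕜 A] [ContinuousConstSMul 𝕜 A]
    {T' T : LionsForest d} (φ : T'.Emb T) (c : 𝕜) (f : RV μ A T') :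
    pull φ (c • f) = c • (pull φ f : RV μ A T) := by
  funext i
  exact AEEqFun.induction_on (f (i ∘ φ.toFun)) (p := fun g =>
    (c • g).compMeasurePreserving (φ.sampleMap Ω) (φ.measurePreserving_sampleMap μ) =
      c • g.compMeasurePreserving (φ.sampleMap Ω) (φ.measurePreserving_sampleMap μ))
    fun g hg => rfl

/-- Naturality, for full embeddings with the same range. -/
theorem Natural.pull_eq_pull {f : Functional μ d A} (hf : Natural f) {T'' T' T : LionsForest d}
    (φ : FullEmb T' T) (ψ : FullEmb T'' T) (h : Set.range φ.toFun = Set.range ψ.toFun) :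
    (pull φ.toEmb (f T') : RV μ A T) = pull ψ.toEmb (f T'') := by
  obtain ⟨e, he⟩ := φ.exists_iso_of_range_eq ψ h
  rw [← he, ← pull_comp, hf _ _ e]

variable [CommRing A]

open scoped Classical in
/-- The value of `f` on the restriction of `T` to the set of nodes `U`, as a random variable
indexed by `T`; it is `0` if no Lions forest is a restriction of `T` to `U`. -/
noncomputable def valueOn (f : Functional μ d A) (T : LionsForest d) (U : Set T.N) : RV μ A T :=
  if h : ∃ (T' : LionsForest d) (φ : FullEmb T' T), Set.range φ.toFun = U then
    pull h.choose_spec.choose.toEmb (f h.choose)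
  else 0

theorem Natural.valueOn_eq {f : Functional μ d A} (hf : Natural f) {T' T : LionsForest d}
    (φ : FullEmb T' T) {U : Set T.N} (hU : Set.range φ.toFun = U) :
    valueOn f T U = pull φ.toEmb (f T') := by
  have h : ∃ (T' : LionsForest d) (φ : FullEmb T' T), Set.range φ.toFun = U := ⟨T', φ, hU⟩
  rw [valueOn, dif_pos h]
  exact hf.pull_eq_pull _ _ (h.choose_spec.choose_spec.trans hU.symm)

theorem Natural.valueOn_univ {f : Functional μ d A} (hf : Natural f) (T : LionsForest d) :
    valueOn f T Set.univ = f T := by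
  rw [hf.valueOn_eq _ FullEmb.range_id, pull_id]

theorem Natural.smul {𝕜 : Type*} [CommRing 𝕜] [Algebra 𝕜 A] [ContinuousConstSMul 𝕜 A]
    {f : Functional μ d A} (hf : Natural f) (c : 𝕜) : Natural (c • f) := fun T' T φ => by
  rw [Pi.smul_apply, pull_smul, hf T' T φ]
  rfl

variable [IsTopologicalRing A]

/-- The map `pull` as a homomorphism. -/
noncomputable def pullHom {T' T : LionsForest d} (φ : T'.Emb T) : RV μ A T' →+* RV μ A T :=
  RingHom.pi fun i => (compHom (φ.sampleMap Ω) (φ.measurePreserving_sampleMap μ)).comp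
    (Pi.evalRingHom (fun _ : T'.N → Fin d => Sample Ω T' →ₘ[law μ T'] A) (i ∘ φ.toFun))

theorem pullHom_apply {T' T : LionsForest d} (φ : T'.Emb T) (f : RV μ A T') :
    pullHom φ f = pull φ f := rfl

theorem pull_mul {T' T : LionsForest d} (φ : T'.Emb T) (f g : RV μ A T') :
    pull φ (f * g) = (pull φ f : RV μ A T) * pull φ g := map_mul (pullHom φ) f g

theorem pull_add {T' T : LionsForest d} (φ : T'.Emb T) (f g : RV μ A T') :
    pull φ (f + g) = (pull φ f : RV μ A T) + pull φ g := map_add (pullHom φ) f g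

theorem pull_one {T' T : LionsForest d} (φ : T'.Emb T) :
    pull φ (1 : RV μ A T') = (1 : RV μ A T) :=
  map_one (pullHom (μ := μ) (A := A) φ)

theorem pull_zero {T' T : LionsForest d} (φ : T'.Emb T) :
    pull φ (0 : RV μ A T') = (0 : RV μ A T) :=
  map_zero (pullHom (μ := μ) (A := A) φ)

/-- `valueOn` as a homomorphism. -/
noncomputable def valueOnHom (T : LionsForest d) (U : Set T.N) :
    Functional μ d A →+ RV μ A T where
  toFun f := valueOn f T U
  map_zero' := by
    rw [valueOn]
    split_ifs
    · exact pull_zero _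
    · rfl
  map_add' f g := by
    simp only [valueOn]
    split_ifs
    · exact pull_add _ _ _
    · exact (add_zero _).symm

theorem valueOn_smul {𝕜 : Type*} [CommRing 𝕜] [Algebra 𝕜 A] [ContinuousConstSMul 𝕜 A] (c : 𝕜)
    (f : Functional μ d A) (T : LionsForest d) (U : Set T.N) :
    valueOn (c • f) T U = c • valueOn f T U := by
  simp only [valueOn]
  split_ifs
  · exact pull_smul _ _ _
  · exact (smul_zero c).symm

theorem cutTerm_eq {f g : Functional μ d A} (hf : Natural f) (hg : Natural g)
    (T : LionsForest d) (S : Set T.N) (hS : T.RootClosed S) :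
    cutTerm f g T S hS = valueOn f T Sᶜ * valueOn g T S := by
  rw [hf.valueOn_eq (FullEmb.prune T S hS) (FullEmb.range_prune S hS),
    hg.valueOn_eq (FullEmb.root T S hS) (FullEmb.range_root S hS)]
  rfl

/-- The convolution on a restriction of `T`, in terms of values on restrictions of `T`. -/
theorem pull_conv {f g : Functional μ d A} (hf : Natural f) (hg : Natural g)
    {T' T : LionsForest d} (φ : FullEmb T' T) : (pull φ.toEmb (conv f g T') : RV μ A T) =
      ∑ V : T'.RootClosedSet, valueOn f T (φ.toFun '' V.1ᶜ) * valueOn g T (φ.toFun '' V.1) := by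
  rw [← pullHom_apply, conv, map_sum]
  refine Finset.sum_congr rfl fun V _ => ?_
  rw [cutTerm_eq hf hg, map_mul, pullHom_apply, pullHom_apply,
    hf.valueOn_eq (FullEmb.prune T' V.1 V.2) (FullEmb.range_prune V.1 V.2),
    hg.valueOn_eq (FullEmb.root T' V.1 V.2) (FullEmb.range_root V.1 V.2), pull_comp, pull_comp,
    hf.valueOn_eq (φ.comp (FullEmb.prune T' V.1 V.2))
      (by rw [FullEmb.range_comp, FullEmb.range_prune]),
    hg.valueOn_eq (φ.comp (FullEmb.root T' V.1 V.2))
      (by rw [FullEmb.range_comp, FullEmb.range_root])]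
  rfl

/-- An isomorphism carries root-closed sets to root-closed sets. -/
def LionsForest.Iso.rootClosedEquiv {T' T : LionsForest d} (φ : T'.Iso T) :
    T'.RootClosedSet ≃ T.RootClosedSet where
  toFun V := ⟨φ.toFun '' V.1, by
    rintro _ y h ⟨x, hx, rfl⟩
    obtain ⟨y, rfl⟩ := φ.surj y
    exact ⟨y, V.2 x y ((φ.edge_iff x y).1 h) hx, rfl⟩⟩
  invFun U := ⟨φ.toFun ⁻¹' U.1, fun x y h hx => U.2 _ _ ((φ.edge_iff x y).2 h) hx⟩
  left_inv V := Subtype.ext (Set.preimage_image_eq V.1 φ.inj)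
  right_inv U := Subtype.ext (Set.image_preimage_eq U.1 φ.surj)

theorem Natural.conv {f g : Functional μ d A} (hf : Natural f) (hg : Natural g) :
    Natural (conv f g) := by
  intro T' T φ
  have h1 := pull_conv hf hg φ.toFullEmb
  have h2 := pull_conv hf hg (FullEmb.id T)
  rw [pull_id] at h2
  rw [h2]
  refine h1.trans (Fintype.sum_equiv φ.rootClosedEquiv _ _ fun V => ?_)
  have e1 : φ.toFullEmb.toFun '' V.1ᶜ = (FullEmb.id T).toFun '' (φ.rootClosedEquiv V).1ᶜ := by
    rw [show (FullEmb.id T).toFun = id from rfl, Set.image_id]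
    exact Set.image_compl_eq ⟨φ.inj, φ.surj⟩
  have e2 : φ.toFullEmb.toFun '' V.1 = (FullEmb.id T).toFun '' (φ.rootClosedEquiv V).1 := by
    rw [show (FullEmb.id T).toFun = id from rfl, Set.image_id]
    rfl
  rw [e1, e2]

theorem natural_unit : Natural (unit : Functional μ d A) := by
  intro T' T φ
  have h : IsEmpty T'.N ↔ IsEmpty T.N :=
    ⟨fun _ => φ.surj.isEmpty, fun _ => Function.isEmpty φ.toFun⟩
  by_cases hT : IsEmpty T.N
  · rw [unit, unit, if_pos hT, if_pos (h.2 hT)]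
    exact pull_one _
  · rw [unit, unit, if_neg hT, if_neg (mt h.1 hT)]
    exact pull_zero _

theorem natural_zero : Natural (0 : Functional μ d A) := fun _ _ _ => pull_zero _

theorem Natural.add {f g : Functional μ d A} (hf : Natural f) (hg : Natural g) :
    Natural (f + g) := fun T' T φ => by
  rw [Pi.add_apply, pull_add, hf T' T φ, hg T' T φ]
  rfl

theorem Natural.sub {f g : Functional μ d A} (hf : Natural f) (hg : Natural g) :
    Natural (f - g) := fun T' T φ => by
  have := map_sub (pullHom φ.toEmb) (f T') (g T')
  rw [pullHom_apply, pullHom_apply, pullHom_apply, hf T' T φ, hg T' T φ] at this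
  exact this

theorem Natural.convPow {f : Functional μ d A} (hf : Natural f) (n : ℕ) :
    Natural (convPow f n) := by
  induction n with
  | zero => exact natural_unit
  | succ n ih => exact hf.conv ih

theorem pull_scale {T' T : LionsForest d} (φ : T'.Emb T) (r : Ω →ₘ[μ] A)
    (f : Functional μ d A) (i : T.N → Fin d) :
    pull φ (scale r f T') i = pullFree T r * pull φ (f T') i := by
  have h := map_mul (compHom (A := A) (φ.sampleMap Ω) (φ.measurePreserving_sampleMap μ))
    (pullFree T' r) (f T' (i ∘ φ.toFun))
  refine h.trans (congrArg (· * pull φ (f T') i) ?_)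
  exact compMeasurePreserving_pullFree φ r

theorem Natural.scale {f : Functional μ d A} (hf : Natural f) (r : Ω →ₘ[μ] A) :
    Natural (scale r f) := fun T' T φ => by
  funext i
  rw [pull_scale, hf T' T φ]
  rfl

end Values

end LionsHopf

/-! ### Convolution as a product of matrices -/

namespace LionsHopf

open MeasureTheory LionsForest

variable {Ω : Type*} [MeasurableSpace Ω] {μ : Measure Ω} {d : ℕ}
  {A : Type*} [TopologicalSpace A] [CommRing A]

section LocSum

variable [IsTopologicalRing A]

/-- The sum of a series of functionals with finitely many non-zero terms on each forest. -/
noncomputable def locSum (g : ℕ → Functional μ d A) : Functional μ d A := fun T =>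
  ∑ᶠ n, g n T

variable {g : ℕ → Functional μ d A}

theorem locSum_apply (h0 : ∀ n T, Nat.card T.N < n → g n T = 0) {T : LionsForest d} {N : ℕ}
    (hN : Nat.card T.N < N) : locSum g T = (∑ n ∈ Finset.range N, g n) T := by
  rw [Finset.sum_apply]
  refine finsum_eq_sum_of_support_subset _ fun n hn => ?_
  rw [Finset.coe_range, Set.mem_Iio]
  by_contra h
  exact hn (h0 n T (by omega))

end LocSum

variable [IsProbabilityMeasure μ]

noncomputable instance decidableEqRootClosedSet (T : LionsForest d) :
    DecidableEq T.RootClosedSet := Classical.decEq _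

section Matrices

open scoped Classical in
/-- The matrix, indexed by the root-closed sets of `T'`, whose entry at `S ⊇ S'` is the value of
`f` on the restriction of `T` to the image of `S \ S'`. The other entries are `0`. -/
noncomputable def diffMatrix (f : Functional μ d A) {T' T : LionsForest d} (φ : FullEmb T' T)
    (i : T.N → Fin d) :
    Matrix T'.RootClosedSet T'.RootClosedSet (Sample Ω T →ₘ[law μ T] A) :=
  Matrix.of fun S S' => if S'.1 ⊆ S.1 then valueOn f T (φ.toFun '' (S.1 \ S'.1)) i else 0

variable {T T' : LionsForest d} (φ : FullEmb T' T) (i : T.N → Fin d)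

theorem diffMatrix_of_subset (f : Functional μ d A) {S S' : T'.RootClosedSet} (h : S'.1 ⊆ S.1) :
    diffMatrix f φ i S S' = valueOn f T (φ.toFun '' (S.1 \ S'.1)) i := if_pos h

theorem diffMatrix_of_not_subset (f : Functional μ d A) {S S' : T'.RootClosedSet}
    (h : ¬ S'.1 ⊆ S.1) : diffMatrix f φ i S S' = 0 := if_neg h

theorem diffMatrix_apply {f : Functional μ d A} (hf : Natural f) {S S' : T'.RootClosedSet}
    (h : S'.1 ⊆ S.1) : diffMatrix f φ i S S' =
      pull (φ.comp (T'.intervalEmb S S')).toEmb (f (T'.interval S S')) i := by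
  rw [diffMatrix_of_subset φ i f h, hf.valueOn_eq (φ.comp (T'.intervalEmb S S'))
    (by rw [FullEmb.range_comp, range_intervalEmb])]

/-- The corner entry of the matrix is the value on `T`. -/
theorem diffMatrix_corner {f : Functional μ d A} (hf : Natural f) :
    diffMatrix f (FullEmb.id T) i ⟨Set.univ, T.rootClosed_univ⟩ ⟨∅, T.rootClosed_empty⟩ =
      f T i := by
  rw [diffMatrix_of_subset _ _ _ (Set.empty_subset _)]
  simp only [Set.sdiff_empty, Set.image_univ, FullEmb.range_id, hf.valueOn_univ]

/-- Natural functionals are determined by their matrices, through the corner entry. -/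
theorem Natural.ext {f g : Functional μ d A} (hf : Natural f) (hg : Natural g)
    (h : ∀ (T : LionsForest d) (i : T.N → Fin d),
      diffMatrix f (FullEmb.id T) i = diffMatrix g (FullEmb.id T) i) : f = g := by
  funext T i
  rw [← diffMatrix_corner i hf, h, diffMatrix_corner i hg]

variable [IsTopologicalRing A]

/-- `diffMatrix` as a homomorphism. -/
noncomputable def diffMatrixHom : Functional μ d A →+
    Matrix T'.RootClosedSet T'.RootClosedSet (Sample Ω T →ₘ[law μ T] A) where
  toFun f := diffMatrix f φ i
  map_zero' := by
    ext1 S S'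
    by_cases h : S'.1 ⊆ S.1
    · rw [diffMatrix_of_subset φ i _ h]
      exact congrFun (map_zero (valueOnHom (μ := μ) (A := A) T _)) i
    · rw [diffMatrix_of_not_subset φ i _ h]
      rfl
  map_add' f g := by
    ext1 S S'
    rw [Matrix.add_apply]
    by_cases h : S'.1 ⊆ S.1
    · simp only [diffMatrix_of_subset φ i _ h]
      exact congrFun (map_add (valueOnHom (μ := μ) (A := A) T _) f g) i
    · simp only [diffMatrix_of_not_subset φ i _ h]
      exact (add_zero _).symm

theorem diffMatrix_sub (f g : Functional μ d A) :
    diffMatrix (f - g) φ i = diffMatrix f φ i - diffMatrix g φ i :=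
  map_sub (diffMatrixHom φ i) f g

theorem diffMatrix_sum {κ : Type*} (s : Finset κ) (f : κ → Functional μ d A) :
    diffMatrix (∑ k ∈ s, f k) φ i = ∑ k ∈ s, diffMatrix (f k) φ i :=
  map_sum (diffMatrixHom φ i) f s

theorem diffMatrix_smul {𝕜 : Type*} [CommRing 𝕜] [Algebra 𝕜 A] [ContinuousConstSMul 𝕜 A] (c : 𝕜)
    (f : Functional μ d A) : diffMatrix (c • f) φ i = c • diffMatrix f φ i := by
  ext1 S S'
  rw [Matrix.smul_apply]
  by_cases h : S'.1 ⊆ S.1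
  · simp only [diffMatrix_of_subset φ i _ h, valueOn_smul]
    rfl
  · simp only [diffMatrix_of_not_subset φ i _ h, smul_zero]

/-- The root-closed subsets of an interval, as root-closed sets of the forest: the nodes of `S'` are
added. Only the case `S' ⊆ S` matters; intersecting with `S` makes this a definition for all
pairs. -/
def LionsForest.intervalUnion (T : LionsForest d) (S S' : T.RootClosedSet)
    (V : (T.interval S S').RootClosedSet) : T.RootClosedSet :=
  ⟨(T.intervalEmb S S').toFun '' V.1 ∪ (S.1 ∩ S'.1), by
    rintro x y h (⟨x, hx, rfl⟩ | hx)
    · have hyS : y ∈ S.1 := S.2 _ _ h (by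
        have : (T.intervalEmb S S').toFun x ∈ S.1 \ S'.1 := by
          rw [← range_intervalEmb]; exact Set.mem_range_self x
        exact this.1)
      by_cases hy : y ∈ S'.1
      · exact Or.inr ⟨hyS, hy⟩
      · have : y ∈ Set.range (T.intervalEmb S S').toFun := by
          rw [range_intervalEmb]; exact ⟨hyS, hy⟩
        obtain ⟨y, rfl⟩ := this
        exact Or.inl ⟨y, V.2 _ _ (((T.intervalEmb S S').edge_iff _ _).1 h) hx, rfl⟩
    · exact Or.inr ⟨S.2 _ _ h hx.1, S'.2 _ _ h hx.2⟩⟩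

/-- The convolution of natural functionals is the product of matrices: the root-closed sets of the
restriction to `S \ S'` correspond to the root-closed sets between `S'` and `S`. -/
theorem diffMatrix_conv {f g : Functional μ d A} (hf : Natural f) (hg : Natural g) :
    diffMatrix (conv f g) φ i = diffMatrix f φ i * diffMatrix g φ i := by
  ext1 S S'
  rw [Matrix.mul_apply]
  by_cases h : S'.1 ⊆ S.1
  · rw [diffMatrix_apply φ i (hf.conv hg) h, pull_conv hf hg, Finset.sum_apply]
    set ι := T'.intervalEmb S S' with hι
    have hr : Set.range ι.toFun = S.1 \ S'.1 := T'.range_intervalEmb S S'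
    have hV : ∀ V : Set (T'.interval S S').N, ι.toFun '' V ⊆ S.1 \ S'.1 := fun V => by
      rw [← hr]; exact Set.image_subset_range _ _
    have hu : ∀ V, (T'.intervalUnion S S' V).1 = ι.toFun '' V.1 ∪ S'.1 := fun V => by
      change ι.toFun '' V.1 ∪ (S.1 ∩ S'.1) = _
      rw [Set.inter_eq_self_of_subset_right h]
    have hd : ∀ V, (T'.intervalUnion S S' V).1 \ S'.1 = ι.toFun '' V.1 := fun V => by
      rw [hu, Set.union_sdiff_right]
      exact (Set.disjoint_left.2 fun x hx => (hV _ hx).2).sdiff_eq_left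
    have hc : ∀ V, S.1 \ (T'.intervalUnion S S' V).1 = ι.toFun '' V.1ᶜ := fun V => by
      rw [hu, Set.image_compl_eq_range_sdiff_image ι.inj, hr, Set.sdiff_sdiff, Set.union_comm]
    refine Fintype.sum_of_injective (T'.intervalUnion S S') ?_ _ _ ?_ ?_
    · intro V V' hVV'
      have := hd V
      rw [hVV', hd V'] at this
      exact Subtype.ext (ι.inj.image_injective this.symm)
    · intro U hU
      by_cases h1 : U.1 ⊆ S.1
      · by_cases h2 : S'.1 ⊆ U.1
        · -- Every root-closed set between `S'` and `S` is in the range of `intervalUnion`.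
          refine absurd ⟨⟨ι.toFun ⁻¹' U.1, fun x y hxy hx =>
            U.2 _ _ ((ι.edge_iff _ _).2 hxy) hx⟩, Subtype.ext ?_⟩ hU
          rw [hu, Set.image_preimage_eq_inter_range, hr]
          ext x
          constructor
          · rintro (hx | hx)
            exacts [hx.1, h2 hx]
          · intro hx
            by_cases hx' : x ∈ S'.1
            exacts [Or.inr hx', Or.inl ⟨hx, h1 hx, hx'⟩]
        · rw [diffMatrix_of_not_subset φ i g h2, mul_zero]
      · rw [diffMatrix_of_not_subset φ i f h1, zero_mul]
    · intro V
      have h1 : (T'.intervalUnion S S' V).1 ⊆ S.1 := by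
        rw [hu]
        exact Set.union_subset ((hV _).trans Set.sdiff_subset) h
      have h2 : S'.1 ⊆ (T'.intervalUnion S S' V).1 := by
        rw [hu]
        exact Set.subset_union_right
      rw [diffMatrix_of_subset φ i f h1, diffMatrix_of_subset φ i g h2, hd, hc,
        Set.image_image, Set.image_image]
      rfl
  · rw [diffMatrix_of_not_subset φ i _ h]
    refine (Finset.sum_eq_zero fun U _ => ?_).symm
    by_cases h1 : U.1 ⊆ S.1
    · rw [diffMatrix_of_not_subset φ i g fun h2 => h (h2.trans h1), mul_zero]
    · rw [diffMatrix_of_not_subset φ i f h1, zero_mul]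

theorem isEmpty_interval_iff (S S' : T'.RootClosedSet) :
    IsEmpty (T'.interval S S').N ↔ S.1 ⊆ S'.1 := by
  rw [← Set.sdiff_eq_empty, ← range_intervalEmb, Set.range_eq_empty_iff]

theorem diffMatrix_unit : diffMatrix (unit : Functional μ d A) φ i = 1 := by
  ext1 S S'
  by_cases h : S'.1 ⊆ S.1
  · rw [diffMatrix_apply φ i natural_unit h, unit, Matrix.one_apply]
    by_cases h' : S.1 ⊆ S'.1
    · rw [if_pos ((isEmpty_interval_iff S S').2 h'), if_pos (Subtype.ext (h'.antisymm h)),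
        pull_one]
      rfl
    · rw [if_neg (mt (isEmpty_interval_iff S S').1 h'),
        if_neg fun e : S = S' => h' (e ▸ subset_rfl), pull_zero]
      rfl
  · rw [diffMatrix_of_not_subset φ i _ h, Matrix.one_apply_ne]
    rintro rfl
    exact h subset_rfl

theorem diffMatrix_convPow {f : Functional μ d A} (hf : Natural f) (n : ℕ) :
    diffMatrix (convPow f n) φ i = diffMatrix f φ i ^ n := by
  induction n with
  | zero => exact diffMatrix_unit φ i
  | succ n ih => rw [pow_succ', ← ih]; exact diffMatrix_conv φ i hf (hf.convPow n)

/-- A matrix that strictly decreases a bounded rank is nilpotent. -/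
theorem pow_eq_zero_of_strictly_decreasing {J W : Type*} [Fintype J] [DecidableEq J] [CommRing W]
    {M : Matrix J J W} (r : J → ℕ) (h : ∀ a b, M a b ≠ 0 → r b < r a) {N n : ℕ}
    (hN : ∀ a, r a ≤ N) (hn : N < n) : M ^ n = 0 := by
  have key : ∀ k a b, (M ^ k) a b ≠ 0 → r b + k ≤ r a := by
    intro k
    induction k with
    | zero =>
      intro a b hab
      rw [pow_zero] at hab
      have : a = b := by
        by_contra hne
        exact hab (Matrix.one_apply_ne hne)
      rw [this, add_zero]
    | succ k ih =>
      intro a b hab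
      rw [pow_succ, Matrix.mul_apply] at hab
      obtain ⟨c, -, hc⟩ := Finset.exists_ne_zero_of_sum_ne_zero hab
      have h1 := ih a c (left_ne_zero_of_mul hc)
      have h2 := h c b (right_ne_zero_of_mul hc)
      omega
  ext1 a b
  by_contra hab
  have := key n a b hab
  have := hN a
  omega

/-- A functional that vanishes on empty forests. -/
def VanishesOnEmpty (f : Functional μ d A) : Prop := ∀ T : LionsForest d, IsEmpty T.N → f T = 0

/-- The matrix of a functional that vanishes on empty forests is strictly triangular. -/
theorem diffMatrix_pow_eq_zero {f : Functional μ d A} (hf : Natural f) (h0 : VanishesOnEmpty f)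
    {n : ℕ} (hn : Nat.card T'.N < n) : diffMatrix f φ i ^ n = 0 := by
  refine pow_eq_zero_of_strictly_decreasing (fun S => Set.ncard S.1) (fun S S' h => ?_)
    (fun S => Set.ncard_le_card S.1) hn
  have h1 : S'.1 ⊆ S.1 := by
    by_contra h1
    exact h (diffMatrix_of_not_subset φ i f h1)
  refine Set.ncard_lt_ncard (LE.le.ssubset_of_not_superset h1 fun h2 => h ?_) (Set.toFinite _)
  rw [diffMatrix_apply φ i hf h1, h0 _ ((isEmpty_interval_iff S S').2 h2), pull_zero]
  rfl

theorem isNilpotent_diffMatrix {f : Functional μ d A} (hf : Natural f) (h0 : VanishesOnEmpty f) :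
    IsNilpotent (diffMatrix f φ i) := ⟨_, diffMatrix_pow_eq_zero φ i hf h0 (Nat.lt_succ_self _)⟩

/-- Convolution powers beyond the number of nodes vanish. -/
theorem convPow_eq_zero {f : Functional μ d A} (hf : Natural f) (h0 : VanishesOnEmpty f)
    (T : LionsForest d) {n : ℕ} (hn : Nat.card T.N < n) : convPow f n T = 0 := by
  funext i
  rw [← diffMatrix_corner i (hf.convPow n), diffMatrix_convPow _ _ hf,
    diffMatrix_pow_eq_zero _ _ hf h0 hn]
  rfl

theorem finite_convPow {f : Functional μ d A} (hf : Natural f) (h0 : VanishesOnEmpty f)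
    (T : LionsForest d) : {n | convPow f n T ≠ 0}.Finite :=
  (Set.finite_Iic (Nat.card T.N)).subset fun n hn => by
    by_contra h
    exact hn (convPow_eq_zero hf h0 T (not_le.1 h))

end Matrices

variable [IsTopologicalRing A]

section Algebra

theorem conv_assoc {f g h : Functional μ d A} (hf : Natural f) (hg : Natural g)
    (hh : Natural h) : conv (conv f g) h = conv f (conv g h) :=
  ((hf.conv hg).conv hh).ext (hf.conv (hg.conv hh)) fun T i => by
    rw [diffMatrix_conv _ _ (hf.conv hg) hh, diffMatrix_conv _ _ hf hg,
      diffMatrix_conv _ _ hf (hg.conv hh), diffMatrix_conv _ _ hg hh, mul_assoc]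

theorem unit_conv {f : Functional μ d A} (hf : Natural f) : conv unit f = f :=
  (natural_unit.conv hf).ext hf fun T i => by
    rw [diffMatrix_conv _ _ natural_unit hf, diffMatrix_unit, one_mul]

end Algebra

section Series

variable {g : ℕ → Functional μ d A}

theorem natural_locSum (h0 : ∀ n T, Nat.card T.N < n → g n T = 0) (hg : ∀ n, Natural (g n)) :
    Natural (locSum g) := by
  intro T' T φ
  have hc : Nat.card T'.N = Nat.card T.N := Nat.card_congr (Equiv.ofBijective _ ⟨φ.inj, φ.surj⟩)
  rw [locSum_apply h0 (Nat.lt_succ_self _), locSum_apply h0 (Nat.lt_succ_self _), hc,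
    Finset.sum_apply, Finset.sum_apply, ← pullHom_apply, map_sum]
  exact Finset.sum_congr rfl fun n _ => hg n T' T φ

/-- The matrix of a locally finite series is a finite sum, since only restrictions of `T'` enter. -/
theorem diffMatrix_locSum (h0 : ∀ n T, Nat.card T.N < n → g n T = 0) (hg : ∀ n, Natural (g n))
    {T T' : LionsForest d} (φ : FullEmb T' T) (i : T.N → Fin d) {N : ℕ}
    (hN : Nat.card T'.N < N) :
    diffMatrix (locSum g) φ i = ∑ n ∈ Finset.range N, diffMatrix (g n) φ i := by
  rw [← diffMatrix_sum]
  ext1 S S'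
  by_cases h : S'.1 ⊆ S.1
  · have hc : Nat.card (T'.interval S S').N ≤ Nat.card T'.N :=
      Nat.card_le_card_of_injective _ (T'.intervalEmb S S').inj
    have hnat : Natural (∑ n ∈ Finset.range N, g n) := by
      intro T₁ T₂ ψ
      rw [Finset.sum_apply, Finset.sum_apply, ← pullHom_apply, map_sum]
      exact Finset.sum_congr rfl fun n _ => hg n T₁ T₂ ψ
    rw [diffMatrix_apply φ i (natural_locSum h0 hg) h, diffMatrix_apply φ i hnat h,
      locSum_apply h0 (N := N) (by omega)]
  · rw [diffMatrix_of_not_subset φ i _ h, diffMatrix_of_not_subset φ i _ h]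

end Series

end LionsHopf

/-! ### Products of forests as Kronecker products -/

namespace LionsHopf

open MeasureTheory LionsForest

variable {d : ℕ}

section Product

variable (T₁ T₂ : LionsForest d)

/-- A root-closed set of a product is a pair of root-closed sets of the factors. -/
def rootClosedMulEquiv : (T₁.mul T₂).RootClosedSet ≃ T₁.RootClosedSet × T₂.RootClosedSet where
  toFun S := (⟨Sum.inl ⁻¹' S.1, fun x y h hx => S.2 (.inl x) (.inl y) h hx⟩,
    ⟨Sum.inr ⁻¹' S.1, fun x y h hx => S.2 (.inr x) (.inr y) h hx⟩)
  invFun p := ⟨Sum.inl '' p.1.1 ∪ Sum.inr '' p.2.1, by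
    rintro (x | x) (y | y) h hx
    · refine Or.inl ⟨y, p.1.2 x y h ?_, rfl⟩
      rcases hx with ⟨_, hx, hx'⟩ | ⟨_, hx, hx'⟩ <;> cases hx'
      exact hx
    · exact h.elim
    · exact h.elim
    · refine Or.inr ⟨y, p.2.2 x y h ?_, rfl⟩
      rcases hx with ⟨_, hx, hx'⟩ | ⟨_, hx, hx'⟩ <;> cases hx'
      exact hx⟩
  left_inv S := Subtype.ext (Set.image_preimage_inl_union_image_preimage_inr S.1)
  right_inv p := by
    refine Prod.ext (Subtype.ext ?_) (Subtype.ext ?_)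
    · refine Set.ext fun x => ⟨?_, fun hx => Or.inl ⟨x, hx, rfl⟩⟩
      rintro (⟨y, hy, h⟩ | ⟨y, hy, h⟩) <;> cases h
      exact hy
    · refine Set.ext fun x => ⟨?_, fun hx => Or.inr ⟨x, hx, rfl⟩⟩
      rintro (⟨y, hy, h⟩ | ⟨y, hy, h⟩) <;> cases h
      exact hy

theorem rootClosedMul_subset_iff (S S' : (T₁.mul T₂).RootClosedSet) : S'.1 ⊆ S.1 ↔
    (rootClosedMulEquiv T₁ T₂ S').1.1 ⊆ (rootClosedMulEquiv T₁ T₂ S).1.1 ∧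
      (rootClosedMulEquiv T₁ T₂ S').2.1 ⊆ (rootClosedMulEquiv T₁ T₂ S).2.1 := by
  refine ⟨fun h => ⟨Set.preimage_mono h, Set.preimage_mono h⟩, fun h => ?_⟩
  rintro (x | x) hx
  exacts [h.1 hx, h.2 hx]

open scoped Kronecker

variable (W : Type*) [CommRing W]

/-- `M ↦ M ⊗ 1`, with the root-closed sets of a product as indices. -/
noncomputable def leftFactor : Matrix T₁.RootClosedSet T₁.RootClosedSet W →+*
    Matrix (T₁.mul T₂).RootClosedSet (T₁.mul T₂).RootClosedSet W where
  toFun M := (M ⊗ₖ (1 : Matrix T₂.RootClosedSet T₂.RootClosedSet W)).submatrix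
    (rootClosedMulEquiv T₁ T₂) (rootClosedMulEquiv T₁ T₂)
  map_one' := by
    rw [Matrix.one_kronecker_one, Matrix.submatrix_one_equiv]
  map_mul' M M' := by
    rw [Matrix.submatrix_mul_equiv, ← Matrix.mul_kronecker_mul, one_mul]
  map_zero' := by
    rw [Matrix.zero_kronecker]
    rfl
  map_add' M M' := by
    rw [Matrix.add_kronecker]
    rfl

/-- `M ↦ 1 ⊗ M`, with the root-closed sets of a product as indices. -/
noncomputable def rightFactor : Matrix T₂.RootClosedSet T₂.RootClosedSet W →+*
    Matrix (T₁.mul T₂).RootClosedSet (T₁.mul T₂).RootClosedSet W where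
  toFun M := ((1 : Matrix T₁.RootClosedSet T₁.RootClosedSet W) ⊗ₖ M).submatrix
    (rootClosedMulEquiv T₁ T₂) (rootClosedMulEquiv T₁ T₂)
  map_one' := by
    rw [Matrix.one_kronecker_one, Matrix.submatrix_one_equiv]
  map_mul' M M' := by
    rw [Matrix.submatrix_mul_equiv, ← Matrix.mul_kronecker_mul, one_mul]
  map_zero' := by
    rw [Matrix.kronecker_zero]
    rfl
  map_add' M M' := by
    rw [Matrix.kronecker_add]
    rfl

variable {W}

theorem leftFactor_mul_rightFactor (M : Matrix T₁.RootClosedSet T₁.RootClosedSet W)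
    (N : Matrix T₂.RootClosedSet T₂.RootClosedSet W) :
    leftFactor T₁ T₂ W M * rightFactor T₁ T₂ W N = (M ⊗ₖ N).submatrix
      (rootClosedMulEquiv T₁ T₂) (rootClosedMulEquiv T₁ T₂) := by
  change Matrix.submatrix _ _ _ * Matrix.submatrix _ _ _ = _
  rw [Matrix.submatrix_mul_equiv, ← Matrix.mul_kronecker_mul, one_mul, mul_one]

theorem commute_leftFactor_rightFactor (M : Matrix T₁.RootClosedSet T₁.RootClosedSet W)
    (N : Matrix T₂.RootClosedSet T₂.RootClosedSet W) :
    Commute (leftFactor T₁ T₂ W M) (rightFactor T₁ T₂ W N) := by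
  rw [commute_iff_eq, leftFactor_mul_rightFactor]
  change _ = Matrix.submatrix _ _ _ * Matrix.submatrix _ _ _
  rw [Matrix.submatrix_mul_equiv, ← Matrix.mul_kronecker_mul, one_mul, mul_one]

end Product

section Criteria

variable {Ω : Type*} [MeasurableSpace Ω] {μ : Measure Ω} [IsProbabilityMeasure μ]
  {A : Type*} [TopologicalSpace A] [CommRing A] [IsTopologicalRing A]
  (T₁ T₂ : LionsForest d) (i : (T₁.mul T₂).N → Fin d)

/-- The Kronecker product of the matrices of `f` over `T₁` and of `g` over `T₂`. -/
noncomputable def outerMatrix (f g : Functional μ d A) :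
    Matrix (T₁.mul T₂).RootClosedSet (T₁.mul T₂).RootClosedSet
      (Sample Ω (T₁.mul T₂) →ₘ[law μ (T₁.mul T₂)] A) :=
  leftFactor T₁ T₂ _ (diffMatrix f (FullEmb.inl T₁ T₂) i) *
    rightFactor T₁ T₂ _ (diffMatrix g (FullEmb.inr T₁ T₂) i)

theorem outerMatrix_unit_right (f : Functional μ d A) : outerMatrix T₁ T₂ i f unit =
    leftFactor T₁ T₂ _ (diffMatrix f (FullEmb.inl T₁ T₂) i) := by
  rw [outerMatrix, diffMatrix_unit, map_one, mul_one]

theorem outerMatrix_unit_left (f : Functional μ d A) : outerMatrix T₁ T₂ i unit f =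
    rightFactor T₁ T₂ _ (diffMatrix f (FullEmb.inr T₁ T₂) i) := by
  rw [outerMatrix, diffMatrix_unit, map_one, one_mul]

theorem outerMatrix_apply (f g : Functional μ d A) (S S' : (T₁.mul T₂).RootClosedSet) :
    outerMatrix T₁ T₂ i f g S S' =
      diffMatrix f (FullEmb.inl T₁ T₂) i (rootClosedMulEquiv T₁ T₂ S).1
          (rootClosedMulEquiv T₁ T₂ S').1 *
        diffMatrix g (FullEmb.inr T₁ T₂) i (rootClosedMulEquiv T₁ T₂ S).2
          (rootClosedMulEquiv T₁ T₂ S').2 := by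
  rw [outerMatrix, leftFactor_mul_rightFactor]
  rfl

variable {T₁ T₂}

/-- The external product on a product of restrictions. -/
theorem pull_outer {f g : Functional μ d A} {I₁ I₂ : LionsForest d} (φ₁ : FullEmb I₁ T₁)
    (φ₂ : FullEmb I₂ T₂) : pull (φ₁.mul φ₂).toEmb (outer f g I₁ I₂) i =
      pull ((FullEmb.inl T₁ T₂).comp φ₁).toEmb (f I₁) i *
        pull ((FullEmb.inr T₁ T₂).comp φ₂).toEmb (g I₂) i := by
  have h := congrFun (pull_mul (φ₁.mul φ₂).toEmb (pull (I₁.inlEmb I₂) (f I₁))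
    (pull (I₁.inrEmb I₂) (g I₂))) i
  refine h.trans ?_
  rw [pull_comp, pull_comp]
  rfl

/-- The restriction of a product to a difference of root-closed sets is the product of the
restrictions of the factors. -/
theorem range_mul_intervalEmb (S S' : (T₁.mul T₂).RootClosedSet) :
    Set.range ((T₁.intervalEmb (rootClosedMulEquiv T₁ T₂ S).1 (rootClosedMulEquiv T₁ T₂ S').1).mul
      (T₂.intervalEmb (rootClosedMulEquiv T₁ T₂ S).2 (rootClosedMulEquiv T₁ T₂ S').2)).toFun =
      S.1 \ S'.1 := by
  rw [FullEmb.range_mul, range_intervalEmb, range_intervalEmb]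
  exact Set.image_preimage_inl_union_image_preimage_inr (S.1 \ S'.1)

/-- If `h` takes every product to a sum of external products, then the matrix of `h` over a
product is the sum of the matrices of these external products. -/
theorem diffMatrix_mul_eq {κ : Type*} (s : Finset κ) {h : Functional μ d A}
    {f g : κ → Functional μ d A} (hh : Natural h) (hf : ∀ k, Natural (f k))
    (hg : ∀ k, Natural (g k)) (H : ∀ T₁ T₂ : LionsForest d,
      h (T₁.mul T₂) = ∑ k ∈ s, outer (f k) (g k) T₁ T₂) :
    diffMatrix h (FullEmb.id (T₁.mul T₂)) i = ∑ k ∈ s, outerMatrix T₁ T₂ i (f k) (g k) := by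
  ext1 S S'
  rw [Matrix.sum_apply]
  simp only [outerMatrix_apply]
  by_cases hS : S'.1 ⊆ S.1
  · obtain ⟨h1, h2⟩ := (rootClosedMul_subset_iff T₁ T₂ S S').1 hS
    rw [diffMatrix_of_subset _ _ _ hS, hh.valueOn_eq
      (U := (FullEmb.id (T₁.mul T₂)).toFun '' (S.1 \ S'.1)) _
      ((range_mul_intervalEmb S S').trans (Set.image_id _).symm), H, ← pullHom_apply, map_sum,
      Finset.sum_apply]
    refine Finset.sum_congr rfl fun k _ => ?_
    rw [diffMatrix_apply _ _ (hf k) h1, diffMatrix_apply _ _ (hg k) h2]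
    exact pull_outer i _ _
  · rw [diffMatrix_of_not_subset _ _ _ hS]
    refine (Finset.sum_eq_zero fun k _ => ?_).symm
    rw [rootClosedMul_subset_iff, not_and_or] at hS
    rcases hS with hS | hS
    · rw [diffMatrix_of_not_subset _ _ _ hS, zero_mul]
    · rw [diffMatrix_of_not_subset _ _ (g k) hS, mul_zero]

/-- The corner entry of the matrix of an external product. -/
theorem outerMatrix_corner {f g : Functional μ d A} (hf : Natural f) (hg : Natural g) :
    outerMatrix T₁ T₂ i f g ⟨Set.univ, rootClosed_univ _⟩ ⟨∅, rootClosed_empty _⟩ =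
      outer f g T₁ T₂ i := by
  rw [outerMatrix_apply, diffMatrix_of_subset _ _ _ (Set.empty_subset _),
    diffMatrix_of_subset _ _ _ (Set.empty_subset _),
    hf.valueOn_eq (FullEmb.inl T₁ T₂), hg.valueOn_eq (FullEmb.inr T₁ T₂)]
  · rfl
  · change _ = _ '' (Set.univ \ ∅)
    rw [Set.sdiff_empty, Set.image_univ]
  · change _ = _ '' (Set.univ \ ∅)
    rw [Set.sdiff_empty, Set.image_univ]

/-- Characters are the natural functionals whose matrices over products are Kronecker products. -/
theorem isCharacter_iff {f : Functional μ d A} : IsCharacter f ↔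
    Natural f ∧ (∀ T : LionsForest d, IsEmpty T.N → f T = 1) ∧
      ∀ (T₁ T₂ : LionsForest d) (i : (T₁.mul T₂).N → Fin d),
        diffMatrix f (FullEmb.id (T₁.mul T₂)) i =
          leftFactor T₁ T₂ _ (diffMatrix f (FullEmb.inl T₁ T₂) i) *
            rightFactor T₁ T₂ _ (diffMatrix f (FullEmb.inr T₁ T₂) i) := by
  refine ⟨fun h => ⟨h.natural, h.one, fun T₁ T₂ i => ?_⟩, fun h => ⟨h.1, h.2.1, fun T₁ T₂ => ?_⟩⟩
  · have := diffMatrix_mul_eq i {()} (f := fun _ => f) (g := fun _ => f) h.natural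
      (fun _ => h.natural) (fun _ => h.natural) (fun T₁ T₂ => by
        rw [Finset.sum_singleton, h.mul])
    rw [this, Finset.sum_singleton]
    rfl
  · funext i
    rw [← diffMatrix_corner i h.1, h.2.2, ← outerMatrix_corner i h.1 h.1]
    rfl

/-- Derivations are the natural functionals whose matrices over products are Kronecker sums. -/
theorem isDerivation_iff {f : Functional μ d A} : IsDerivation f ↔
    Natural f ∧ ∀ (T₁ T₂ : LionsForest d) (i : (T₁.mul T₂).N → Fin d),
      diffMatrix f (FullEmb.id (T₁.mul T₂)) i =
        leftFactor T₁ T₂ _ (diffMatrix f (FullEmb.inl T₁ T₂) i) +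
          rightFactor T₁ T₂ _ (diffMatrix f (FullEmb.inr T₁ T₂) i) := by
  refine ⟨fun h => ⟨h.natural, fun T₁ T₂ i => ?_⟩, fun h => ⟨h.1, fun T₁ T₂ => ?_⟩⟩
  · have := diffMatrix_mul_eq i Finset.univ (f := fun b : Bool => if b then f else unit)
      (g := fun b : Bool => if b then unit else f) h.natural
      (fun b => by cases b; exacts [natural_unit, h.natural])
      (fun b => by cases b; exacts [h.natural, natural_unit]) (fun T₁ T₂ => by
        rw [Fintype.sum_bool, h.leibniz]
        rfl)
    rw [this, Fintype.sum_bool, ← outerMatrix_unit_right, ← outerMatrix_unit_left]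
    rfl
  · funext i
    rw [← diffMatrix_corner i h.1, h.2, Pi.add_apply,
      ← outerMatrix_corner i h.1 natural_unit, ← outerMatrix_corner i natural_unit h.1,
      outerMatrix_unit_right, outerMatrix_unit_left]
    rfl

/-- A derivation vanishes on empty forests: there the Leibniz rule reads `f T = f T + f T`. -/
theorem IsDerivation.vanishesOnEmpty {f : Functional μ d A} (hf : IsDerivation f) :
    VanishesOnEmpty f := by
  intro T hT
  have hT' : IsEmpty (T.mul T).N := inferInstanceAs (IsEmpty (T.N ⊕ T.N))
  have h1 : (pull (T.inlEmb T) (f T) : RV μ A (T.mul T)) = f (T.mul T) := by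
    have := hf.natural.pull_eq_pull (FullEmb.inl T T) (FullEmb.id (T.mul T))
      (Set.eq_empty_of_isEmpty _ |>.trans (Set.eq_empty_of_isEmpty _).symm)
    rw [pull_id] at this
    exact this
  have h2 : (pull (T.inrEmb T) (f T) : RV μ A (T.mul T)) = f (T.mul T) := by
    have := hf.natural.pull_eq_pull (FullEmb.inr T T) (FullEmb.id (T.mul T))
      (Set.eq_empty_of_isEmpty _ |>.trans (Set.eq_empty_of_isEmpty _).symm)
    rw [pull_id] at this
    exact this
  have h3 := hf.leibniz T T
  have hu : (unit T : RV μ A T) = 1 := if_pos hT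
  have h4 : outer f unit T T = f (T.mul T) := by
    funext i
    rw [outer, hu, pull_one, h1]
    exact mul_one _
  have h5 : outer unit f T T = f (T.mul T) := by
    funext i
    rw [outer, hu, pull_one, h2]
    exact one_mul _
  rw [h4, h5] at h3
  have h6 : f (T.mul T) = 0 := left_eq_add.1 h3
  rw [← hf.natural _ _ (Iso.ofIsEmpty (T.mul T) T), h6, pull_zero]

end Criteria

end LionsHopf

/-! ### The group of characters -/

namespace LionsHopf

open MeasureTheory LionsForest

variable {Ω : Type*} [MeasurableSpace Ω] {μ : Measure Ω} [IsProbabilityMeasure μ] {d : ℕ}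
  {A : Type*} [TopologicalSpace A] [CommRing A] [IsTopologicalRing A]

section Group

theorem isCharacter_unit : IsCharacter (unit : Functional μ d A) := by
  refine isCharacter_iff.2 ⟨natural_unit, fun T hT => if_pos hT, fun T₁ T₂ i => ?_⟩
  simp only [diffMatrix_unit, map_one, mul_one]

theorem conv_apply_of_isEmpty {f g : Functional μ d A} (hf : Natural f) (hg : Natural g)
    (T : LionsForest d) [IsEmpty T.N] : conv f g T = f T * g T := by
  have : Unique T.RootClosedSet :=
    { default := ⟨∅, T.rootClosed_empty⟩
      uniq := fun S => Subtype.ext (Set.eq_empty_of_isEmpty S.1) }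
  rw [conv, Fintype.sum_unique, cutTerm_eq hf hg, ← hf.valueOn_univ, ← hg.valueOn_univ]
  simp only [Set.eq_empty_of_isEmpty]

/-- The convolution of characters is a character: the Kronecker factors commute. -/
theorem IsCharacter.conv {f g : Functional μ d A} (hf : IsCharacter f) (hg : IsCharacter g) :
    IsCharacter (conv f g) := by
  have h1 := isCharacter_iff.1 hf
  have h2 := isCharacter_iff.1 hg
  refine isCharacter_iff.2 ⟨h1.1.conv h2.1, fun T hT => ?_, fun T₁ T₂ i => ?_⟩
  · rw [conv_apply_of_isEmpty h1.1 h2.1, hf.one T hT, hg.one T hT, one_mul]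
  · rw [diffMatrix_conv _ _ h1.1 h2.1, diffMatrix_conv _ _ h1.1 h2.1,
      diffMatrix_conv _ _ h1.1 h2.1, h1.2.2, h2.2.2, map_mul, map_mul]
    exact (commute_leftFactor_rightFactor T₁ T₂ _ _).symm.mul_mul_mul_comm _ _

theorem IsCharacter.vanishesOnEmpty_unit_sub {f : Functional μ d A} (hf : IsCharacter f) :
    VanishesOnEmpty (unit - f) := fun T hT => by
  rw [Pi.sub_apply, hf.one T hT, unit, if_pos hT, sub_self]

theorem IsCharacter.vanishesOnEmpty_sub_unit {f : Functional μ d A} (hf : IsCharacter f) :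
    VanishesOnEmpty (f - unit) := fun T hT => by
  rw [Pi.sub_apply, hf.one T hT, unit, if_pos hT, sub_self]

theorem IsCharacter.natural_antipode {f : Functional μ d A} (hf : IsCharacter f) :
    Natural (antipode f) :=
  natural_locSum (fun _ T => convPow_eq_zero (natural_unit.sub hf.natural)
    hf.vanishesOnEmpty_unit_sub T) fun n => (natural_unit.sub hf.natural).convPow n

/-- The matrix of the antipode is the Neumann series of the matrix of the character. -/
theorem IsCharacter.diffMatrix_antipode {f : Functional μ d A} (hf : IsCharacter f)
    {T T' : LionsForest d} (φ : FullEmb T' T) (i : T.N → Fin d) :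
    diffMatrix (antipode f) φ i =
      ∑ n ∈ Finset.range (Nat.card T'.N + 1), (1 - diffMatrix f φ i) ^ n := by
  have hn := natural_unit.sub hf.natural
  rw [← diffMatrix_unit (A := A), ← diffMatrix_sub]
  simp only [← diffMatrix_convPow _ _ hn]
  exact diffMatrix_locSum (fun _ T => convPow_eq_zero hn hf.vanishesOnEmpty_unit_sub T)
    (fun n => hn.convPow n) φ i (Nat.lt_succ_self _)

theorem IsCharacter.one_sub_diffMatrix_pow {f : Functional μ d A} (hf : IsCharacter f)
    {T T' : LionsForest d} (φ : FullEmb T' T) (i : T.N → Fin d) :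
    (1 - diffMatrix f φ i) ^ (Nat.card T'.N + 1) = 0 := by
  rw [← diffMatrix_unit (A := A), ← diffMatrix_sub]
  exact diffMatrix_pow_eq_zero φ i (natural_unit.sub hf.natural) hf.vanishesOnEmpty_unit_sub
    (Nat.lt_succ_self _)

theorem IsCharacter.diffMatrix_antipode_mul {f : Functional μ d A} (hf : IsCharacter f)
    {T T' : LionsForest d} (φ : FullEmb T' T) (i : T.N → Fin d) :
    diffMatrix (antipode f) φ i * diffMatrix f φ i = 1 := by
  have h := geom_sum_mul_neg (1 - diffMatrix f φ i) (Nat.card T'.N + 1)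
  rwa [hf.one_sub_diffMatrix_pow, sub_sub_cancel, sub_zero, ← hf.diffMatrix_antipode] at h

theorem IsCharacter.mul_diffMatrix_antipode {f : Functional μ d A} (hf : IsCharacter f)
    {T T' : LionsForest d} (φ : FullEmb T' T) (i : T.N → Fin d) :
    diffMatrix f φ i * diffMatrix (antipode f) φ i = 1 := by
  have h := mul_neg_geom_sum (1 - diffMatrix f φ i) (Nat.card T'.N + 1)
  rwa [hf.one_sub_diffMatrix_pow, sub_sub_cancel, sub_zero, ← hf.diffMatrix_antipode] at h

theorem IsCharacter.antipode_conv {f : Functional μ d A} (hf : IsCharacter f) :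
    LionsHopf.conv (antipode f) f = unit :=
  (hf.natural_antipode.conv hf.natural).ext natural_unit fun T i => by
    rw [diffMatrix_conv _ _ hf.natural_antipode hf.natural, hf.diffMatrix_antipode_mul,
      diffMatrix_unit]

theorem IsCharacter.conv_antipode {f : Functional μ d A} (hf : IsCharacter f) :
    LionsHopf.conv f (antipode f) = unit :=
  (hf.natural.conv hf.natural_antipode).ext natural_unit fun T i => by
    rw [diffMatrix_conv _ _ hf.natural hf.natural_antipode, hf.mul_diffMatrix_antipode,
      diffMatrix_unit]

theorem IsCharacter.antipode_one {f : Functional μ d A} (hf : IsCharacter f)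
    (T : LionsForest d) (hT : IsEmpty T.N) : antipode f T = 1 := by
  have h := conv_apply_of_isEmpty hf.natural_antipode hf.natural T
  rw [hf.antipode_conv, hf.one T hT, mul_one, unit, if_pos hT] at h
  exact h.symm

/-- The antipode of a character is a character: over a product, its matrix and the Kronecker
product of its matrices are both inverse to the matrix of the character. -/
theorem IsCharacter.antipode {f : Functional μ d A} (hf : IsCharacter f) :
    IsCharacter (antipode f) := by
  refine isCharacter_iff.2 ⟨hf.natural_antipode, hf.antipode_one, fun T₁ T₂ i => ?_⟩
  refine left_inv_eq_right_inv (hf.diffMatrix_antipode_mul _ i) ?_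
  rw [(isCharacter_iff.1 hf).2.2,
    (commute_leftFactor_rightFactor T₁ T₂ _ _).symm.mul_mul_mul_comm, ← map_mul, ← map_mul,
    hf.mul_diffMatrix_antipode, hf.mul_diffMatrix_antipode, map_one, map_one, one_mul]

theorem exists_group : ∃ _ : Group (Characters μ d A),
    (∀ f g : Characters μ d A, (f * g).1 = conv f.1 g.1) ∧
    (1 : Characters μ d A).1 = unit ∧ ∀ f : Characters μ d A, (f⁻¹).1 = antipode f.1 := by
  let : Mul (Characters μ d A) := ⟨fun f g => ⟨conv f.1 g.1, f.2.conv g.2⟩⟩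
  let : One (Characters μ d A) := ⟨⟨unit, isCharacter_unit⟩⟩
  let : Inv (Characters μ d A) := ⟨fun f => ⟨antipode f.1, f.2.antipode⟩⟩
  exact ⟨Group.ofLeftAxioms
    (fun f g h => Subtype.ext (conv_assoc f.2.natural g.2.natural h.2.natural))
    (fun f => Subtype.ext (unit_conv f.2.natural)) (fun f => Subtype.ext f.2.antipode_conv),
    fun _ _ => rfl, rfl, fun _ => rfl⟩

end Group

/-! ### The Bogoliubov recursions -/

section Bogoliubov

theorem valueOn_empty {f : Functional μ d A} (hf : Natural f)
    (h1 : ∀ T : LionsForest d, IsEmpty T.N → f T = 1) (T : LionsForest d) :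
    valueOn f T ∅ = 1 := by
  rw [hf.valueOn_eq (FullEmb.root T ∅ T.rootClosed_empty) (FullEmb.range_root _ _),
    h1 _ (inferInstanceAs (IsEmpty (∅ : Set T.N))), pull_one]

/-- The convolution as a sum over the cuts and the two trivial root-closed sets. -/
theorem conv_eq_add_sum_cuts {f g : Functional μ d A} (hf : Natural f) (hg : Natural g)
    (hf1 : ∀ T : LionsForest d, IsEmpty T.N → f T = 1)
    (hg1 : ∀ T : LionsForest d, IsEmpty T.N → g T = 1) (T : LionsForest d) [Nonempty T.N] :
    conv f g T = f T + g T +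
      ∑ S : {S : Set T.N // T.RootClosed S ∧ S.Nonempty ∧ S ≠ Set.univ},
        cutTerm f g T S.1 S.2.1 := by
  let e : T.RootClosedSet := ⟨∅, T.rootClosed_empty⟩
  let u : T.RootClosedSet := ⟨Set.univ, T.rootClosed_univ⟩
  have hue : u ≠ e := fun h => Set.empty_ne_univ (congrArg Subtype.val h).symm
  have hmem : u ∈ Finset.univ.erase e := Finset.mem_erase.2 ⟨hue, Finset.mem_univ _⟩
  rw [conv, ← Finset.add_sum_erase _ _ (Finset.mem_univ e), ← Finset.add_sum_erase _ _ hmem,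
    ← add_assoc]
  congr 1
  · rw [cutTerm_eq hf hg, cutTerm_eq hf hg]
    simp only [e, u, Set.compl_empty, Set.compl_univ, valueOn_empty hf hf1,
      valueOn_empty hg hg1, hf.valueOn_univ, hg.valueOn_univ, one_mul, mul_one]
  · refine Finset.sum_bij' (fun S hS => ⟨S.1, S.2, ?_, ?_⟩) (fun S _ => ⟨S.1, S.2.1⟩) ?_ ?_ ?_ ?_ ?_
    · rw [Finset.mem_erase, Finset.mem_erase] at hS
      exact Set.nonempty_iff_ne_empty.2 fun h => hS.2.1 (Subtype.ext h)
    · rw [Finset.mem_erase] at hS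
      exact fun h => hS.1 (Subtype.ext h)
    · exact fun _ _ => Finset.mem_univ _
    · intro S _
      rw [Finset.mem_erase, Finset.mem_erase]
      exact ⟨fun h => S.2.2.2 (congrArg Subtype.val h),
        fun h => S.2.2.1.ne_empty (congrArg Subtype.val h), Finset.mem_univ _⟩
    · exact fun _ _ => rfl
    · exact fun _ _ => rfl
    · exact fun _ _ => rfl

/-- The prune of a cut is smaller than the forest, so the left recursion is well founded. -/
theorem card_prune_lt (T : LionsForest d) {S : Set T.N} (hS : T.RootClosed S)
    (h : S.Nonempty) : Nat.card (T.prune S hS).N < Nat.card T.N := by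
  obtain ⟨x, hx⟩ := h
  have := Set.ncard_lt_ncard ⟨Set.subset_univ Sᶜ, fun h => h (Set.mem_univ x) hx⟩ (Set.toFinite _)
  rwa [Set.ncard_univ] at this

/-- The root of a cut is smaller than the forest, so the right recursion is well founded. -/
theorem card_root_lt (T : LionsForest d) {S : Set T.N} (hS : T.RootClosed S)
    (h : S ≠ Set.univ) : Nat.card (T.root S hS).N < Nat.card T.N := by
  have := Set.ncard_lt_ncard (Set.ssubset_univ_iff.2 h) (Set.toFinite _)
  rwa [Set.ncard_univ] at this

/-- The recursion determines its solution, by induction on the number of nodes; naturality is not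
needed. -/
theorem BogoliubovLeft.unique {f s t : Functional μ d A} (hs : BogoliubovLeft f s)
    (ht : BogoliubovLeft f t) : s = t := by
  funext T
  induction hn : Nat.card T.N using Nat.strong_induction_on generalizing T with
  | _ n ih =>
    subst hn
    rcases isEmpty_or_nonempty T.N with hT | hT
    · rw [hs.1 T hT, ht.1 T hT]
    · rw [hs.2 T hT, ht.2 T hT]
      refine congrArg _ (Finset.sum_congr rfl fun S _ => ?_)
      unfold cutTerm
      rw [ih _ (card_prune_lt T S.2.1 S.2.2.1) _ rfl]

theorem BogoliubovRight.unique {f s t : Functional μ d A} (hs : BogoliubovRight f s)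
    (ht : BogoliubovRight f t) : s = t := by
  funext T
  induction hn : Nat.card T.N using Nat.strong_induction_on generalizing T with
  | _ n ih =>
    subst hn
    rcases isEmpty_or_nonempty T.N with hT | hT
    · rw [hs.1 T hT, ht.1 T hT]
    · rw [hs.2 T hT, ht.2 T hT]
      refine congrArg _ (Finset.sum_congr rfl fun S _ => ?_)
      unfold cutTerm
      rw [ih _ (card_root_lt T S.2.1 S.2.2.2) _ rfl]

theorem IsCharacter.bogoliubovLeft {f : Functional μ d A} (hf : IsCharacter f) :
    BogoliubovLeft f (LionsHopf.antipode f) := by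
  refine ⟨hf.antipode_one, fun T hT => ?_⟩
  have h := conv_eq_add_sum_cuts hf.natural_antipode hf.natural hf.antipode_one hf.one T
  rw [hf.antipode_conv, unit, if_neg (not_isEmpty_iff.2 hT)] at h
  rw [neg_sub_left, eq_neg_iff_add_eq_zero, h]
  abel

theorem IsCharacter.bogoliubovRight {f : Functional μ d A} (hf : IsCharacter f) :
    BogoliubovRight f (LionsHopf.antipode f) := by
  refine ⟨hf.antipode_one, fun T hT => ?_⟩
  have h := conv_eq_add_sum_cuts hf.natural hf.natural_antipode hf.one hf.antipode_one T
  rw [hf.conv_antipode, unit, if_neg (not_isEmpty_iff.2 hT)] at h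
  rw [neg_sub_left, eq_neg_iff_add_eq_zero, h]
  abel

end Bogoliubov

/-! ### The Lie algebra of derivations -/

section Lie

theorem isDerivation_zero : IsDerivation (0 : Functional μ d A) :=
  isDerivation_iff.2 ⟨natural_zero, fun T₁ T₂ i => by
    have h : ∀ {T T' : LionsForest d} (φ : FullEmb T' T) (i : T.N → Fin d),
        diffMatrix (0 : Functional μ d A) φ i = 0 := fun φ i => map_zero (diffMatrixHom φ i)
    rw [h, h, h, map_zero, map_zero, add_zero]⟩

theorem diffMatrix_add {T T' : LionsForest d} (φ : FullEmb T' T) (i : T.N → Fin d)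
    (f g : Functional μ d A) : diffMatrix (f + g) φ i = diffMatrix f φ i + diffMatrix g φ i :=
  map_add (diffMatrixHom φ i) f g

theorem IsDerivation.add {f g : Functional μ d A} (hf : IsDerivation f) (hg : IsDerivation g) :
    IsDerivation (f + g) := by
  rw [isDerivation_iff] at hf hg ⊢
  refine ⟨hf.1.add hg.1, fun T₁ T₂ i => ?_⟩
  simp only [diffMatrix_add, hf.2, hg.2, map_add]
  abel

theorem IsDerivation.scale {f : Functional μ d A} (hf : IsDerivation f) (r : Ω →ₘ[μ] A) :
    IsDerivation (scale r f) where
  natural := hf.natural.scale r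
  leibniz T₁ T₂ := by
    funext i
    simp only [LionsHopf.scale, hf.leibniz, Pi.add_apply, outer, mul_add]
    rw [← mul_assoc, mul_left_comm, ← pull_scale, ← pull_scale]

theorem diffMatrix_bracket {f g : Functional μ d A} (hf : Natural f) (hg : Natural g)
    {T T' : LionsForest d} (φ : FullEmb T' T) (i : T.N → Fin d) :
    diffMatrix (bracket f g) φ i = diffMatrix f φ i * diffMatrix g φ i -
      diffMatrix g φ i * diffMatrix f φ i := by
  rw [bracket, diffMatrix_sub, diffMatrix_conv _ _ hf hg, diffMatrix_conv _ _ hg hf]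

theorem Natural.bracket {f g : Functional μ d A} (hf : Natural f) (hg : Natural g) :
    Natural (bracket f g) := (hf.conv hg).sub (hg.conv hf)

/-- Derivations are closed under the bracket: the mixed Kronecker terms commute and cancel. -/
theorem IsDerivation.bracket {f g : Functional μ d A} (hf : IsDerivation f)
    (hg : IsDerivation g) : IsDerivation (bracket f g) := by
  rw [isDerivation_iff] at hf hg ⊢
  refine ⟨hf.1.bracket hg.1, fun T₁ T₂ i => ?_⟩
  have h1 := (commute_leftFactor_rightFactor T₁ T₂ (diffMatrix f (FullEmb.inl T₁ T₂) i)
    (diffMatrix g (FullEmb.inr T₁ T₂) i)).eq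
  have h2 := (commute_leftFactor_rightFactor T₁ T₂ (diffMatrix g (FullEmb.inl T₁ T₂) i)
    (diffMatrix f (FullEmb.inr T₁ T₂) i)).eq
  simp only [diffMatrix_bracket hf.1 hg.1, hf.2, hg.2, map_sub, map_mul, mul_add, add_mul, h1, h2]
  abel

theorem cutTerm_add_left (f f' g : Functional μ d A) (T : LionsForest d) (S : Set T.N)
    (hS : T.RootClosed S) :
    cutTerm (f + f') g T S hS = cutTerm f g T S hS + cutTerm f' g T S hS := by
  funext i
  simp only [cutTerm, Pi.add_apply, pull_add, add_mul]

theorem cutTerm_add_right (f g g' : Functional μ d A) (T : LionsForest d) (S : Set T.N)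
    (hS : T.RootClosed S) :
    cutTerm f (g + g') T S hS = cutTerm f g T S hS + cutTerm f g' T S hS := by
  funext i
  simp only [cutTerm, Pi.add_apply, pull_add, mul_add]

theorem conv_add_left (f f' g : Functional μ d A) : conv (f + f') g = conv f g + conv f' g := by
  funext T
  simp only [conv, Pi.add_apply, cutTerm_add_left, Finset.sum_add_distrib]

theorem conv_add_right (f g g' : Functional μ d A) : conv f (g + g') = conv f g + conv f g' := by
  funext T
  simp only [conv, Pi.add_apply, cutTerm_add_right, Finset.sum_add_distrib]

theorem conv_scale_left (r : Ω →ₘ[μ] A) (f g : Functional μ d A) :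
    conv (scale r f) g = scale r (conv f g) := by
  funext T i
  simp only [conv, scale, Finset.sum_apply, Finset.mul_sum]
  refine Finset.sum_congr rfl fun S _ => ?_
  exact (congrArg (· * _) (pull_scale _ r f i)).trans (mul_assoc _ _ _)

theorem conv_scale_right (r : Ω →ₘ[μ] A) (f g : Functional μ d A) :
    conv f (scale r g) = scale r (conv f g) := by
  funext T i
  simp only [conv, scale, Finset.sum_apply, Finset.mul_sum]
  refine Finset.sum_congr rfl fun S _ => ?_
  exact (congrArg (_ * ·) (pull_scale _ r g i)).trans (mul_left_comm _ _ _)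

theorem scale_sub (r : Ω →ₘ[μ] A) (f g : Functional μ d A) :
    scale r (f - g) = scale r f - scale r g := by
  funext T i
  exact mul_sub _ _ _

theorem bracket_add_left (f g h : Functional μ d A) :
    bracket (f + g) h = bracket f h + bracket g h := by
  simp only [bracket, conv_add_left, conv_add_right]
  abel

theorem bracket_add_right (f g h : Functional μ d A) :
    bracket f (g + h) = bracket f g + bracket f h := by
  simp only [bracket, conv_add_left, conv_add_right]
  abel

theorem bracket_scale_left (r : Ω →ₘ[μ] A) (f g : Functional μ d A) :
    bracket (scale r f) g = scale r (bracket f g) := by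
  simp only [bracket, conv_scale_left, conv_scale_right, scale_sub]

theorem bracket_scale_right (r : Ω →ₘ[μ] A) (f g : Functional μ d A) :
    bracket f (scale r g) = scale r (bracket f g) := by
  simp only [bracket, conv_scale_left, conv_scale_right, scale_sub]

theorem bracket_jacobi {f g h : Functional μ d A} (hf : Natural f) (hg : Natural g)
    (hh : Natural h) :
    bracket f (bracket g h) = bracket (bracket f g) h + bracket g (bracket f h) := by
  have h1 := hf.bracket (hg.bracket hh)
  have h2 := (hf.bracket hg).bracket hh
  have h3 := hg.bracket (hf.bracket hh)
  refine h1.ext (h2.add h3) fun T i => ?_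
  simp only [diffMatrix_add, diffMatrix_bracket, hf, hg, hh, hf.bracket hg, hg.bracket hh,
    hf.bracket hh, mul_sub, sub_mul, mul_assoc]
  abel

end Lie

/-! ### Exponential and logarithm of functionals -/

section ExpLog

theorem isNilpotent_diffMatrix_sub_one {f : Functional μ d A} (hf : Natural f)
    (h0 : VanishesOnEmpty (f - unit)) {T T' : LionsForest d} (φ : FullEmb T' T)
    (i : T.N → Fin d) : IsNilpotent (diffMatrix f φ i - 1) := by
  have := isNilpotent_diffMatrix φ i (hf.sub natural_unit) h0
  rwa [diffMatrix_sub, diffMatrix_unit] at this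

variable [Algebra ℝ A] [ContinuousConstSMul ℝ A]

/-- Restriction of scalars from `ℝ` to `ℚ`. -/
noncomputable abbrev ratAlgebra (Z : Type*) [Ring Z] [Algebra ℝ Z] : Algebra ℚ Z :=
  Algebra.compHom Z (algebraMap ℚ ℝ)

open scoped Nat in
theorem convExp_eq_locSum (f : Functional μ d A) :
    convExp f = locSum fun n => ((n ! : ℝ)⁻¹) • convPow f n := rfl

theorem convLog_eq_locSum (f : Functional μ d A) : convLog f = locSum fun n =>
    ((-1 : ℝ) ^ ((n + 1) + 1) / ((n + 1 : ℕ) : ℝ)) • convPow (f - unit) (n + 1) := rfl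

theorem smul_convPow_eq_zero {f : Functional μ d A} (hf : Natural f) (h0 : VanishesOnEmpty f)
    (c : ℝ) {n : ℕ} (T : LionsForest d) (h : Nat.card T.N < n) : (c • convPow f n) T = 0 := by
  rw [Pi.smul_apply, convPow_eq_zero hf h0 T h, smul_zero]

theorem natural_convExp {f : Functional μ d A} (hf : Natural f) (h0 : VanishesOnEmpty f) :
    Natural (convExp f) :=
  natural_locSum (fun _ T h => smul_convPow_eq_zero hf h0 _ T h) fun n => (hf.convPow n).smul _

theorem natural_convLog {f : Functional μ d A} (hf : Natural f)
    (h0 : VanishesOnEmpty (f - unit)) : Natural (convLog f) :=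
  natural_locSum (fun _ T h => smul_convPow_eq_zero (hf.sub natural_unit) h0 _ T (by omega))
    fun n => ((hf.sub natural_unit).convPow (n + 1)).smul _

/-- The matrix of the exponential is the exponential of the nilpotent matrix. -/
theorem diffMatrix_convExp {f : Functional μ d A} (hf : Natural f) (h0 : VanishesOnEmpty f)
    {T T' : LionsForest d} (φ : FullEmb T' T) (i : T.N → Fin d) :
    letI := ratAlgebra (Matrix T'.RootClosedSet T'.RootClosedSet (Sample Ω T →ₘ[law μ T] A))
    diffMatrix (convExp f) φ i = IsNilpotent.exp (diffMatrix f φ i) := by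
  let := ratAlgebra (Matrix T'.RootClosedSet T'.RootClosedSet (Sample Ω T →ₘ[law μ T] A))
  rw [convExp_eq_locSum, diffMatrix_locSum ?_ ?_ φ i (Nat.lt_succ_self _),
    IsNilpotent.exp_eq_sum (diffMatrix_pow_eq_zero φ i hf h0 (Nat.lt_succ_self _))]
  · refine Finset.sum_congr rfl fun n _ => ?_
    rw [diffMatrix_smul, diffMatrix_convPow _ _ hf]
    change _ = (algebraMap ℚ ℝ _) • diffMatrix f φ i ^ n
    simp
  · exact fun _ T h => smul_convPow_eq_zero hf h0 _ T h
  · exact fun n => (hf.convPow n).smul _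

/-- The matrix of the logarithm is the logarithm of the unipotent matrix. -/
theorem diffMatrix_convLog {f : Functional μ d A} (hf : Natural f)
    (h0 : VanishesOnEmpty (f - unit))
    {T T' : LionsForest d} (φ : FullEmb T' T) (i : T.N → Fin d) :
    letI := ratAlgebra (Matrix T'.RootClosedSet T'.RootClosedSet (Sample Ω T →ₘ[law μ T] A))
    diffMatrix (convLog f) φ i = NilExpLog.log (diffMatrix f φ i) := by
  let := ratAlgebra (Matrix T'.RootClosedSet T'.RootClosedSet (Sample Ω T →ₘ[law μ T] A))
  have hn := hf.sub natural_unit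
  have h1 := diffMatrix_pow_eq_zero φ i hn h0 (Nat.lt_succ_self _)
  rw [diffMatrix_sub, diffMatrix_unit] at h1
  rw [convLog_eq_locSum, diffMatrix_locSum ?_ ?_ φ i (Nat.lt_succ_self _),
    NilExpLog.log_eq_sum h1]
  · refine Finset.sum_congr rfl fun n _ => ?_
    rw [diffMatrix_smul, diffMatrix_convPow _ _ hn, diffMatrix_sub, diffMatrix_unit]
    change _ = (algebraMap ℚ ℝ _) • (diffMatrix f φ i - 1) ^ (n + 1)
    simp
  · exact fun n T h => smul_convPow_eq_zero hn h0 _ T (by omega)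
  · exact fun n => (hn.convPow (n + 1)).smul _

/-- The exponential turns Kronecker sums into Kronecker products. -/
theorem IsDerivation.isCharacter_convExp {f : Functional μ d A} (hf : IsDerivation f) :
    IsCharacter (convExp f) := by
  have h0 := hf.vanishesOnEmpty
  have hn := hf.natural
  refine isCharacter_iff.2 ⟨natural_convExp hn h0, fun T hT => ?_, fun T₁ T₂ i => ?_⟩
  · rw [convExp_eq_locSum, locSum_apply (N := 1) (fun _ T h => smul_convPow_eq_zero hn h0 _ T h)
      (by rw [Nat.card_of_isEmpty]; exact one_pos), Finset.sum_range_one, Pi.smul_apply]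
    rw [Nat.factorial_zero, Nat.cast_one, inv_one, one_smul]
    exact if_pos hT
  · let := fun T T' : LionsForest d =>
      ratAlgebra (Matrix T'.RootClosedSet T'.RootClosedSet (Sample Ω T →ₘ[law μ T] A))
    have n1 := isNilpotent_diffMatrix (FullEmb.inl T₁ T₂) i hn h0
    have n2 := isNilpotent_diffMatrix (FullEmb.inr T₁ T₂) i hn h0
    rw [diffMatrix_convExp hn h0, diffMatrix_convExp hn h0, diffMatrix_convExp hn h0,
      IsNilpotent.map_exp n1, IsNilpotent.map_exp n2, (isDerivation_iff.1 hf).2]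
    exact IsNilpotent.exp_add_of_commute (commute_leftFactor_rightFactor _ _ _ _) (n1.map _)
      (n2.map _)

/-- The logarithm turns Kronecker products into Kronecker sums. -/
theorem IsCharacter.isDerivation_convLog {f : Functional μ d A} (hf : IsCharacter f) :
    IsDerivation (convLog f) := by
  have h0 := hf.vanishesOnEmpty_sub_unit
  have hn := hf.natural
  refine isDerivation_iff.2 ⟨natural_convLog hn h0, fun T₁ T₂ i => ?_⟩
  let := fun T T' : LionsForest d =>
    ratAlgebra (Matrix T'.RootClosedSet T'.RootClosedSet (Sample Ω T →ₘ[law μ T] A))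
  have n1 := isNilpotent_diffMatrix_sub_one hn h0 (FullEmb.inl T₁ T₂) i
  have n2 := isNilpotent_diffMatrix_sub_one hn h0 (FullEmb.inr T₁ T₂) i
  rw [diffMatrix_convLog hn h0, diffMatrix_convLog hn h0, diffMatrix_convLog hn h0,
    NilExpLog.map_log _ n1, NilExpLog.map_log _ n2, (isCharacter_iff.1 hf).2.2]
  have m1 := n1.map (leftFactor T₁ T₂ (Sample Ω (T₁.mul T₂) →ₘ[law μ (T₁.mul T₂)] A))
  have m2 := n2.map (rightFactor T₁ T₂ (Sample Ω (T₁.mul T₂) →ₘ[law μ (T₁.mul T₂)] A))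
  rw [map_sub, map_one] at m1 m2
  exact NilExpLog.log_mul_of_commute m1 m2 (commute_leftFactor_rightFactor _ _ _ _)

theorem IsDerivation.convLog_convExp {f : Functional μ d A} (hf : IsDerivation f) :
    convLog (convExp f) = f := by
  have hc := hf.isCharacter_convExp
  refine (natural_convLog hc.natural hc.vanishesOnEmpty_sub_unit).ext hf.natural fun T i => ?_
  let := ratAlgebra (Matrix T.RootClosedSet T.RootClosedSet (Sample Ω T →ₘ[law μ T] A))
  rw [diffMatrix_convLog hc.natural hc.vanishesOnEmpty_sub_unit,
    diffMatrix_convExp hf.natural hf.vanishesOnEmpty,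
    NilExpLog.log_exp (isNilpotent_diffMatrix _ _ hf.natural hf.vanishesOnEmpty)]

theorem IsCharacter.convExp_convLog {f : Functional μ d A} (hf : IsCharacter f) :
    convExp (convLog f) = f := by
  have hd := hf.isDerivation_convLog
  refine (natural_convExp hd.natural hd.vanishesOnEmpty).ext hf.natural fun T i => ?_
  let := ratAlgebra (Matrix T.RootClosedSet T.RootClosedSet (Sample Ω T →ₘ[law μ T] A))
  rw [diffMatrix_convExp hd.natural hd.vanishesOnEmpty,
    diffMatrix_convLog hf.natural hf.vanishesOnEmpty_sub_unit,
    NilExpLog.exp_log (isNilpotent_diffMatrix_sub_one hf.natural hf.vanishesOnEmpty_sub_unit _ _)]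

variable (μ d A) in
/-- The exponential as a bijection of the derivations and the characters. -/
noncomputable def expEquiv : Derivations μ d A ≃ Characters μ d A where
  toFun f := ⟨convExp f.1, f.2.isCharacter_convExp⟩
  invFun f := ⟨convLog f.1, f.2.isDerivation_convLog⟩
  left_inv f := Subtype.ext f.2.convLog_convExp
  right_inv f := Subtype.ext f.2.convExp_convLog

end ExpLog

end LionsHopf

/-! ### Coupled bialgebras and Lions forests together -/

theorem mainTheorem4 :
    -- Coupled bialgebras over a commutative ring `R`, maps into a commutative `R`-algebra `A`.
    (∀ (R H V₂ V₃ A : Type*) [CommRing R] [Ring H] [Algebra R H] [Ring V₂] [Algebra R V₂]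
      [AddCommGroup V₃] [Module R V₃] [CommRing A] [Algebra R A]
      (B : CoupledHopf.CoupledBialgebra R H V₂ V₃) (K : CoupledHopf.CouplingSystem B)
      (ι : Type*) [AddMonoid ι] [DecidableEq ι] (deg : ι →+ ℕ)
      (𝓗 : ι → Submodule R H) [GradedAlgebra 𝓗] (𝓥 : ι → ι → Submodule R V₂)
      (_ : CoupledHopf.IsGradedConnected K deg 𝓗 𝓥),
      -- the characters form a group, with the antipode as the inverse
      ((∀ f : CoupledHopf.Characters R H A, ∀ x : H,
          {n | CoupledHopf.convPow K (CoupledHopf.unit B A - f.1) n x ≠ 0}.Finite) ∧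
        ∃ _ : Group (CoupledHopf.Characters R H A),
          (∀ f g : CoupledHopf.Characters R H A, (f * g).1 = CoupledHopf.conv K f.1 g.1) ∧
          (1 : CoupledHopf.Characters R H A).1 = CoupledHopf.unit B A ∧
          ∀ f : CoupledHopf.Characters R H A, ∀ x : H,
            (f⁻¹).1 x = CoupledHopf.antipode K f.1 x) ∧
      -- the antipode is the unique solution of each of the Bogoliubov recursions
      (∀ (f : CoupledHopf.Characters R H A) (s : H →ₗ[R] A),
        (CoupledHopf.BogoliubovLeft K f.1 s ↔ ∀ x, s x = CoupledHopf.antipode K f.1 x) ∧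
        (CoupledHopf.BogoliubovRight K f.1 s ↔ ∀ x, s x = CoupledHopf.antipode K f.1 x)) ∧
      -- the derivations form a Lie algebra
      (∃ br : CoupledHopf.Derivations B A →ₗ[R] CoupledHopf.Derivations B A →ₗ[R]
          CoupledHopf.Derivations B A,
        (∀ f g, (br f g).1 = CoupledHopf.conv K f.1 g.1 - CoupledHopf.conv K g.1 f.1) ∧
        (∀ f, br f f = 0) ∧
        ∀ f g h, br f (br g h) = br (br f g) h + br g (br f h)) ∧
      -- the exponential and the logarithm
      (∀ [Algebra ℚ A],
        (∀ f : CoupledHopf.Derivations B A, ∀ x : H,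
          {n | CoupledHopf.convPow K f.1 n x ≠ 0}.Finite) ∧
        (∀ F : CoupledHopf.Characters R H A, ∀ x : H,
          {n | CoupledHopf.convPow K (F.1 - CoupledHopf.unit B A) n x ≠ 0}.Finite) ∧
        ∃ E : CoupledHopf.Derivations B A ≃ CoupledHopf.Characters R H A,
          (∀ f x, (E f).1 x = CoupledHopf.convExp K f.1 x) ∧
          ∀ F x, (E.symm F).1 x = CoupledHopf.convLog K F.1 x)) ∧
    -- The coupled bialgebra of Lions forests, with the dual in the almost sure sense.
    (∀ (Ω : Type*) [MeasurableSpace Ω] (μ : MeasureTheory.Measure Ω)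
      [MeasureTheory.IsProbabilityMeasure μ] (d : ℕ) (A : Type*) [CommRing A]
      [TopologicalSpace A] [IsTopologicalRing A],
      -- the characters form a group, with the antipode as the inverse
      ((∀ f : LionsHopf.Characters μ d A, ∀ T : LionsHopf.LionsForest d,
          {n | LionsHopf.convPow (LionsHopf.unit - f.1) n T ≠ 0}.Finite) ∧
        ∃ _ : Group (LionsHopf.Characters μ d A),
          (∀ f g : LionsHopf.Characters μ d A, (f * g).1 = LionsHopf.conv f.1 g.1) ∧
          (1 : LionsHopf.Characters μ d A).1 = LionsHopf.unit ∧
          ∀ f : LionsHopf.Characters μ d A, (f⁻¹).1 = LionsHopf.antipode f.1) ∧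
      -- the antipode is the unique solution of each of the Bogoliubov recursions
      (∀ (f : LionsHopf.Characters μ d A) (s : LionsHopf.Functional μ d A),
        (LionsHopf.BogoliubovLeft f.1 s ↔ s = LionsHopf.antipode f.1) ∧
        (LionsHopf.BogoliubovRight f.1 s ↔ s = LionsHopf.antipode f.1)) ∧
      -- the derivations form a Lie algebra over the random variables on `Ω`
      (LionsHopf.IsDerivation (0 : LionsHopf.Functional μ d A) ∧
        (∀ f g : LionsHopf.Derivations μ d A, LionsHopf.IsDerivation (f.1 + g.1)) ∧
        (∀ (r : Ω →ₘ[μ] A) (f : LionsHopf.Derivations μ d A),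
          LionsHopf.IsDerivation (LionsHopf.scale r f.1)) ∧
        (∀ f g : LionsHopf.Derivations μ d A,
          LionsHopf.IsDerivation (LionsHopf.bracket f.1 g.1)) ∧
        (∀ f g h : LionsHopf.Derivations μ d A, LionsHopf.bracket (f.1 + g.1) h.1 =
          LionsHopf.bracket f.1 h.1 + LionsHopf.bracket g.1 h.1) ∧
        (∀ f g h : LionsHopf.Derivations μ d A, LionsHopf.bracket f.1 (g.1 + h.1) =
          LionsHopf.bracket f.1 g.1 + LionsHopf.bracket f.1 h.1) ∧
        (∀ (r : Ω →ₘ[μ] A) (f g : LionsHopf.Derivations μ d A),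
          LionsHopf.bracket (LionsHopf.scale r f.1) g.1 =
            LionsHopf.scale r (LionsHopf.bracket f.1 g.1) ∧
          LionsHopf.bracket f.1 (LionsHopf.scale r g.1) =
            LionsHopf.scale r (LionsHopf.bracket f.1 g.1)) ∧
        (∀ f : LionsHopf.Derivations μ d A, LionsHopf.bracket f.1 f.1 = 0) ∧
        ∀ f g h : LionsHopf.Derivations μ d A,
          LionsHopf.bracket f.1 (LionsHopf.bracket g.1 h.1) =
            LionsHopf.bracket (LionsHopf.bracket f.1 g.1) h.1 +
              LionsHopf.bracket g.1 (LionsHopf.bracket f.1 h.1)) ∧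
      -- the exponential and the logarithm
      (∀ [Algebra ℝ A] [ContinuousConstSMul ℝ A],
        (∀ (f : LionsHopf.Derivations μ d A) (T : LionsHopf.LionsForest d),
          {n | LionsHopf.convPow f.1 n T ≠ 0}.Finite) ∧
        (∀ (F : LionsHopf.Characters μ d A) (T : LionsHopf.LionsForest d),
          {n | LionsHopf.convPow (F.1 - LionsHopf.unit) n T ≠ 0}.Finite) ∧
        ∃ E : LionsHopf.Derivations μ d A ≃ LionsHopf.Characters μ d A,
          (∀ f, (E f).1 = LionsHopf.convExp f.1) ∧
          ∀ F, (E.symm F).1 = LionsHopf.convLog F.1)) := by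
  refine ⟨?_, ?_⟩
  · intro R H V₂ V₃ A _ _ _ _ _ _ _ _ _ B K ι _ _ deg 𝓗 _ 𝓥 hK
    refine ⟨⟨fun f => hK.finite_convPow (CoupledHopf.unit_sub_apply_one f.2.map_one),
      hK.exists_group⟩, fun f s => hK.bogoliubov f.2 s,
      ⟨CoupledHopf.derivationBracket K, fun _ _ => rfl, fun _ => Subtype.ext (sub_self _),
        CoupledHopf.derivationBracket_jacobi K⟩, ?_⟩
    intro _
    exact ⟨fun f => hK.finite_convPow (CoupledHopf.apply_one_of_mem_derivations K f.2),
      fun F => hK.finite_convPow (CoupledHopf.sub_unit_apply_one F.2.map_one),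
      hK.exists_exp_equiv⟩
  · intro Ω _ μ _ d A _ _ _
    refine ⟨⟨fun f => LionsHopf.finite_convPow (LionsHopf.natural_unit.sub f.2.natural)
        f.2.vanishesOnEmpty_unit_sub, LionsHopf.exists_group⟩,
      fun f s => ⟨⟨fun hs => hs.unique f.2.bogoliubovLeft, fun hs => hs ▸ f.2.bogoliubovLeft⟩,
        ⟨fun hs => hs.unique f.2.bogoliubovRight, fun hs => hs ▸ f.2.bogoliubovRight⟩⟩,
      ⟨LionsHopf.isDerivation_zero, fun f g => f.2.add g.2, fun r f => f.2.scale r,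
        fun f g => f.2.bracket g.2, fun f g h => LionsHopf.bracket_add_left f.1 g.1 h.1,
        fun f g h => LionsHopf.bracket_add_right f.1 g.1 h.1,
        fun r f g => ⟨LionsHopf.bracket_scale_left r f.1 g.1,
          LionsHopf.bracket_scale_right r f.1 g.1⟩, fun _ => sub_self _,
        fun f g h => LionsHopf.bracket_jacobi f.2.natural g.2.natural h.2.natural⟩, ?_⟩
    intro _ _
    exact ⟨fun f => LionsHopf.finite_convPow f.2.natural f.2.vanishesOnEmpty,
      fun F => LionsHopf.finite_convPow (F.2.natural.sub LionsHopf.natural_unit)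
        F.2.vanishesOnEmpty_sub_unit,
      LionsHopf.expEquiv μ d A, fun _ => rfl, fun _ => rfl⟩
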